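/- For each sample size $n\ge 1$ let $\mathbf y=X\beta^0+\epsilon$, where $X$ is an $n\times p$ design matrix ($p=p_n$), either deterministic or random and independent of $\epsilon$, $\epsilon\sim N(0,\sigma_0^2I_n)$ with $\sigma_0>0$ fixed, and $\beta^0\in\mathbb R^p$ is deterministic. A model is a subset $\gamma\subset\{1,\dots,p\}$; $X_\gamma$ is the submatrix of the columns of $X$ indexed by $\gamma$, $P_\gamma=X_\gamma(X_\gamma^TX_\gamma)^{-1}X_\gamma^T$ (with $P_\emptyset=0$), and $\gamma^0=\{j:\beta^0_j\ne0\}$ is the true model, with $s_n=|\gamma^0|$. Write $\lambda_-$ and $\lambda_+$ for the minimal and maximal eigenvalue. Given hyperparameters $c_1,\dots,c_p>0$, a fixed $\nu>0$ and a prior probability $p(\gamma)$ on the models, consider the Bayesian model $$\mathbf y\mid\beta,\sigma^2\sim N(X\beta,\sigma^2I_n),\quad \beta_j\mid\gamma,\sigma^2\sim N(0,c_j\sigma^2)\text{ for } j\in\gamma,\quad \beta_j=0\text{ for } j\notin\gamma,\quad 1/\sigma^2\sim\chi^2_\nu,\quad \gamma\sim p(\gamma),$$ the $\beta_j$ being independent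 given $\gamma,\sigma^2$, and let $p(\gamma\mid Z)$ be the posterior probability of $\gamma$ given $Z=(\mathbf y,X)$. Let $S_1=\{\gamma:\gamma^0\subsetneq\gamma\}$, $S_2=\{\gamma:\gamma^0\not\subset\gamma\}$, and $$\varphi_{\min}(n)=\min_{\gamma\in S_2}\lambda_-\Bigl(\tfrac1nX_{\gamma^0\setminus\gamma}^T(I_n-P_\gamma)X_{\gamma^0\setminus\gamma}\Bigr),\qquad \varphi_{\max}(n)=\max_{\gamma\in S_2}\lambda_+\Bigl(\tfrac1nX_{\gamma^0\setminus\gamma}^TX_{\gamma^0\setminus\gamma}\Bigr).$$ Suppose that $\gamma^0\neq\emptyset$ for every $n\ge1$ and that the following hold. 1. $p(\gamma^0)>0$ and there is a constant $C_0>0$ with $\max_\gamma p(\gamma)/p(\gamma^0)\le C_0$ for every $n$. 2. There are constants $C_1,C_2>0$ such that, with probability one, $\liminf_n\varphi_{\min}(n)\ge C_1$ and $\limsup_n\varphi_{\max}(n)\le C_2$. 3. There is a positive sequence $\psi_n$ with $\min_{j\in\gamma^0}|\beta^0_j|\ge\psi_n$ and $\sqrt n\,\psi_n\to\infty$. 4.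 $p\to\infty$, $s_n\le p\le n$ and $p\log n=o\bigl(n\log(1+\min\{\psi_n^2,1\})\bigr)$. 5. There are sequences $0<\underline\phi_n\le\bar\phi_n$ with $\bar\phi_n=O(n^{\delta_0})$ for some $\delta_0>0$ and $\|\beta^0\|_2^2=O(\underline\phi_n)$. 6. There are $C_3>0$ and $\delta\ge0$ such that $n^{1-\delta}\underline\phi_n\to\infty$ and, for every $n$, with probability one, $$\lambda_-\Bigl(\tfrac1nX_{\gamma\setminus\gamma^0}^T(I_n-P_{\gamma^0})X_{\gamma\setminus\gamma^0}\Bigr)\ge C_3n^{-\delta}\quad\text{for all }\gamma\in S_1.$$ Then, as $n\to\infty$: (a) If $p^{\alpha_0}=o(n^{1-\delta}\underline\phi_n)$ for some $\alpha_0>2$, then $$\sup_{c_1,\dots,c_p\in[\underline\phi_n,\bar\phi_n]}\ \max_{\gamma\ne\gamma^0}\ \frac{p(\gamma\mid Z)}{p(\gamma^0\mid Z)}\to0\quad\text{in probability.}$$ (b) If $p^{\alpha_0+2}=o(n^{1-\delta}\underline\phi_n)$ for some $\alpha_0>2$, then $$\sup_{c_1,\dots,c_p\in[\underline\phi_n,\bar\phi_n]}\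 \sum_{\gamma\ne\gamma^0}p(\gamma\mid Z)\to0\quad\text{and}\quad \inf_{c_1,\dots,c_p\in[\underline\phi_n,\bar\phi_n]}p(\gamma^0\mid Z)\to1\quad\text{in probability.}$$ -/

import Mathlib

open MeasureTheory ProbabilityTheory Filter Topology Asymptotics
open scoped ENNReal NNReal Matrix

/-! A model (state vector) `γ` on `p` covariates is the finite set of the indices it includes. -/

/-- The state vector of a coefficient vector: the set of its nonzero coordinates. -/
noncomputable def stateVector {p : ℕ} (β : Fin p → ℝ) : Finset (Fin p) :=
  Finset.univ.filter fun j => β j ≠ 0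

/-- The submatrix `X_γ` of the columns of `X` that belong to `γ`. -/
def colSub {n p : ℕ} (X : Matrix (Fin n) (Fin p) ℝ) (γ : Finset (Fin p)) :
    Matrix (Fin n) {j // j ∈ γ} ℝ :=
  X.submatrix id Subtype.val

/-- `P_γ = X_γ (X_γᵀ X_γ)⁻¹ X_γᵀ`; it is `0` for the empty model. -/
noncomputable def projMat {n p : ℕ} (X : Matrix (Fin n) (Fin p) ℝ) (γ : Finset (Fin p)) :
    Matrix (Fin n) (Fin n) ℝ :=
  colSub X γ * ((colSub X γ)ᵀ * colSub X γ)⁻¹ * (colSub X γ)ᵀ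

/-- The minimal eigenvalue of a real symmetric matrix (of positive size). -/
noncomputable def minEig {ι : Type*} [Fintype ι] [DecidableEq ι] (A : Matrix ι ι ℝ) : ℝ :=
  sInf (spectrum ℝ A)

/-- The maximal eigenvalue of a real symmetric matrix (of positive size). -/
noncomputable def maxEig {ι : Type*} [Fintype ι] [DecidableEq ι] (A : Matrix ι ι ℝ) : ℝ :=
  sSup (spectrum ℝ A)

/-- `S₁`: the models that strictly contain `γ₀`. -/
def overModels {p : ℕ} (γ₀ : Finset (Fin p)) : Set (Finset (Fin p)) :=
  {γ | γ₀ ⊆ γ ∧ γ ≠ γ₀}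

/-- `S₂`: the models that do not contain `γ₀`. -/
def nonOverModels {p : ℕ} (γ₀ : Finset (Fin p)) : Set (Finset (Fin p)) :=
  {γ | ¬ γ₀ ⊆ γ}

/-- `n⁻¹ X_ηᵀ (I - P_γ) X_η`. -/
noncomputable def residGram {n p : ℕ} (X : Matrix (Fin n) (Fin p) ℝ) (η γ : Finset (Fin p)) :
    Matrix {j // j ∈ η} {j // j ∈ η} ℝ :=
  (1 / (n : ℝ)) • ((colSub X η)ᵀ * (1 - projMat X γ) * colSub X η)

/-- `φ_min`, the minimum over `γ ∈ S₂` of `λ₋(n⁻¹ X_{γ₀∖γ}ᵀ (I - P_γ) X_{γ₀∖γ})`. -/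
noncomputable def phiMin {n p : ℕ} (X : Matrix (Fin n) (Fin p) ℝ) (γ₀ : Finset (Fin p)) : ℝ :=
  sInf ((fun γ => minEig (residGram X (γ₀ \ γ) γ)) '' nonOverModels γ₀)

/-- `φ_max`, the maximum over `γ ∈ S₂` of `λ₊(n⁻¹ X_{γ₀∖γ}ᵀ X_{γ₀∖γ})`. -/
noncomputable def phiMax {n p : ℕ} (X : Matrix (Fin n) (Fin p) ℝ) (γ₀ : Finset (Fin p)) : ℝ :=
  sSup ((fun γ => maxEig ((1 / (n : ℝ)) • ((colSub X (γ₀ \ γ))ᵀ * colSub X (γ₀ \ γ)))) ''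
    nonOverModels γ₀)

/-! The hierarchical Bayesian model. -/

/-- The density at `y` of `N(X β, σ² I_n)`. -/
noncomputable def likelihood {n p : ℕ} (X : Matrix (Fin n) (Fin p) ℝ) (β : Fin p → ℝ)
    (σsq : ℝ) (y : Fin n → ℝ) : ℝ :=
  ∏ i, gaussianPDFReal ((X *ᵥ β) i) σsq.toNNReal (y i)

/-- The prior of `β` given `γ` and `σ²`: the coordinates are independent, with
`β_j ∼ N(0, c_j σ²)` for `j ∈ γ` and `β_j = 0` for `j ∉ γ`. -/
noncomputable def coefPrior {p : ℕ} (c : Fin p → ℝ) (γ : Finset (Fin p)) (σsq : ℝ) :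
    Measure (Fin p → ℝ) :=
  Measure.pi fun j =>
    if j ∈ γ then gaussianReal 0 (c j * σsq).toNNReal else Measure.dirac 0

/-- The chi-squared distribution with `ν` degrees of freedom. -/
noncomputable def chiSquared (ν : ℝ) : Measure ℝ :=
  gammaMeasure (ν / 2) (1 / 2)

/-- The marginal density of `y` given the model `γ` (and `X`), where `1/σ² ∼ χ²_ν`: here the
variable `τ` stands for `1/σ²`. -/
noncomputable def marginalLikelihood {n p : ℕ} (ν : ℝ) (c : Fin p → ℝ)
    (X : Matrix (Fin n) (Fin p) ℝ) (y : Fin n → ℝ) (γ : Finset (Fin p)) : ℝ :=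
  ∫ τ, ∫ β, likelihood X β τ⁻¹ y ∂(coefPrior c γ τ⁻¹) ∂(chiSquared ν)

/-- The posterior probability `p(γ | Z)` of the model `γ`, given `Z = (y, X)`. -/
noncomputable def posterior {n p : ℕ} (ν : ℝ) (prior : PMF (Finset (Fin p))) (c : Fin p → ℝ)
    (X : Matrix (Fin n) (Fin p) ℝ) (y : Fin n → ℝ) (γ : Finset (Fin p)) : ℝ :=
  (prior γ).toReal * marginalLikelihood ν c X y γ /
    ∑ γ', (prior γ').toReal * marginalLikelihood ν c X y γ'

/-!
Integrating out `β` and `1/σ²` gives `p(γ | Z)` proportional to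
`p(γ) det(1 + W Wᵀ)^(-1/2) (1 + R)^(-(n+ν)/2)`, where `W` is `X_γ` with its columns scaled by `√c_j`
and `R = yᵀ (1 + W Wᵀ)⁻¹ y` is the ridge residual of `y`.

A model that misses a true covariate has a ridge residual inflated by an amount of order
`n min(ψ_n², 1)`. The resulting factor `(1 + t)^(-(n+ν)/2)`, with `t` of order `min(ψ_n², 1)`,
beats the ratio of determinants, which is `exp(O(p log n))`, because
`p log n = o(n log(1 + min(ψ_n², 1)))`; it even leaves a factor `exp(-2p)`, enough to sum over all
`2^p` models.

A model that strictly contains the true one, with `k` spurious covariates, pays a factor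
`(C₃ n^(1-δ) φ)^(-k/2)` in the determinant. Its gain in fit is the squared norm of a projection of
the noise onto a space of dimension at most `k`, which a chi-squared tail bound and a union bound
over the models keep below `α k σ₀² log p` for any `α > 2`. As the true residual is about `n σ₀²`,
the gain is at most a factor `p^(α₀ k/2)`, whence a geometric bound with ratio
`√(p^α₀ / (C₃ n^(1-δ) φ))`.

All of these bounds hold simultaneously for all prior variances `c` in the allowed range.
-/

/-! ### Quadratic forms and orthogonal projections -/

section DotProduct

variable {R m : Type*} [CommRing R] [Fintype m]

lemma dotProduct_self_add (x z : m → R) :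
    (x + z) ⬝ᵥ (x + z) = x ⬝ᵥ x + 2 * (x ⬝ᵥ z) + z ⬝ᵥ z := by
  rw [add_dotProduct, dotProduct_add, dotProduct_add, dotProduct_comm z x]
  ring

lemma dotProduct_self_sub (x z : m → R) :
    (x - z) ⬝ᵥ (x - z) = x ⬝ᵥ x - 2 * (x ⬝ᵥ z) + z ⬝ᵥ z := by
  rw [sub_dotProduct, dotProduct_sub, dotProduct_sub, dotProduct_comm z x]
  ring

variable [LinearOrder R] [IsStrictOrderedRing R]

lemma dotProduct_self_nonneg (x : m → R) : 0 ≤ x ⬝ᵥ x :=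
  Finset.sum_nonneg fun i _ => mul_self_nonneg (x i)

lemma dotProduct_self_add_le (x z : m → R) :
    (x + z) ⬝ᵥ (x + z) ≤ 2 * (x ⬝ᵥ x + z ⬝ᵥ z) := by
  have h := dotProduct_self_nonneg (x - z)
  rw [dotProduct_self_sub] at h
  rw [dotProduct_self_add]
  linarith

end DotProduct

section QuadraticForm

variable {m ι : Type*} [Fintype m] [Fintype ι]

lemma dotProduct_transpose_mul_self_mulVec {R : Type*} [CommSemiring R] (W : Matrix m ι R)
    (x : ι → R) : x ⬝ᵥ (Wᵀ * W) *ᵥ x = (W *ᵥ x) ⬝ᵥ (W *ᵥ x) := by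
  rw [← Matrix.mulVec_mulVec, Matrix.dotProduct_transpose_mulVec]

lemma dotProduct_one_sub_mulVec {R : Type*} [Ring R] [DecidableEq m] (A : Matrix m m R)
    (x : m → R) : x ⬝ᵥ (1 - A) *ᵥ x = x ⬝ᵥ x - x ⬝ᵥ A *ᵥ x := by
  rw [Matrix.sub_mulVec, Matrix.one_mulVec, dotProduct_sub]

lemma dotProduct_mulVec_of_isStarProjection {A : Matrix m m ℝ} (hA : IsStarProjection A)
    (x : m → ℝ) : x ⬝ᵥ A *ᵥ x = (A *ᵥ x) ⬝ᵥ (A *ᵥ x) := by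
  have hAA : Aᵀ * A = A := by
    rw [← Matrix.conjTranspose_eq_transpose_of_trivial, ← Matrix.star_eq_conjTranspose,
      hA.isSelfAdjoint, hA.isIdempotentElem]
  rw [← dotProduct_transpose_mul_self_mulVec, hAA]

lemma dotProduct_mulVec_nonneg_of_isStarProjection {A : Matrix m m ℝ} (hA : IsStarProjection A)
    (x : m → ℝ) : 0 ≤ x ⬝ᵥ A *ᵥ x := by
  rw [dotProduct_mulVec_of_isStarProjection hA]
  exact dotProduct_self_nonneg _

lemma dotProduct_mulVec_le_of_isStarProjection {A : Matrix m m ℝ} (hA : IsStarProjection A)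
    (x : m → ℝ) : x ⬝ᵥ A *ᵥ x ≤ x ⬝ᵥ x := by
  classical
  have h := dotProduct_mulVec_nonneg_of_isStarProjection hA.one_sub x
  rwa [dotProduct_one_sub_mulVec, sub_nonneg] at h

open scoped MatrixOrder in
lemma dotProduct_mulVec_mono {A B : Matrix m m ℝ} (h : A ≤ B) (x : m → ℝ) :
    x ⬝ᵥ A *ᵥ x ≤ x ⬝ᵥ B *ᵥ x := by
  have hx := (Matrix.le_iff.1 h).dotProduct_mulVec_nonneg x
  rwa [star_trivial, Matrix.sub_mulVec, dotProduct_sub, sub_nonneg] at hx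

lemma isUnit_det_transpose_mul_self [DecidableEq ι] {W : Matrix m ι ℝ}
    (h : ∀ v, W *ᵥ v = 0 → v = 0) : IsUnit (Wᵀ * W).det := by
  have hinj : Function.Injective W.mulVec := fun v w hvw =>
    sub_eq_zero.1 (h (v - w) (by rw [Matrix.mulVec_sub]; exact sub_eq_zero.2 hvw))
  have hunit := (Matrix.PosDef.conjTranspose_mul_self W hinj).isUnit
  rwa [Matrix.conjTranspose_eq_transpose_of_trivial, Matrix.isUnit_iff_isUnit_det] at hunit

/-- The matrix `W (Wᵀ W)⁻¹ Wᵀ`: the orthogonal projection onto the column space of `W` when `W`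
has full column rank, and the junk value `0` otherwise. -/
noncomputable def colProj [DecidableEq ι] (W : Matrix m ι ℝ) : Matrix m m ℝ :=
  W * (Wᵀ * W)⁻¹ * Wᵀ

section ColProj

variable [DecidableEq ι]

lemma colProj_mul_self {W : Matrix m ι ℝ} (h : IsUnit (Wᵀ * W).det) : colProj W * W = W := by
  rw [colProj, Matrix.mul_assoc, Matrix.mul_assoc, Matrix.nonsing_inv_mul _ h, Matrix.mul_one]

lemma isStarProjection_colProj (W : Matrix m ι ℝ) : IsStarProjection (colProj W) where
  isIdempotentElem := by
    rw [IsIdempotentElem]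
    by_cases h : IsUnit (Wᵀ * W).det
    · nth_rewrite 2 [colProj]
      rw [← Matrix.mul_assoc, ← Matrix.mul_assoc, colProj_mul_self h, colProj]
    · simp [colProj, Matrix.nonsing_inv_apply_not_isUnit _ h]
  isSelfAdjoint := by
    rw [IsSelfAdjoint, Matrix.star_eq_conjTranspose, Matrix.conjTranspose_eq_transpose_of_trivial]
    simp [colProj, Matrix.transpose_mul, Matrix.transpose_nonsing_inv, Matrix.mul_assoc]

lemma transpose_colProj (W : Matrix m ι ℝ) : (colProj W)ᵀ = colProj W := by
  rw [← Matrix.conjTranspose_eq_transpose_of_trivial]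
  exact (isStarProjection_colProj W).isSelfAdjoint

variable [DecidableEq m]

lemma one_sub_colProj_mulVec {W : Matrix m ι ℝ} (h : IsUnit (Wᵀ * W).det) (d : ι → ℝ) :
    (1 - colProj W) *ᵥ (W *ᵥ d) = 0 := by
  rw [Matrix.mulVec_mulVec, Matrix.sub_mul, Matrix.one_mul, colProj_mul_self h, sub_self,
    Matrix.zero_mulVec]

lemma residual_sub_mulVec {W : Matrix m ι ℝ} (h : IsUnit (Wᵀ * W).det) (z : m → ℝ)
    (d : ι → ℝ) :
    (z - W *ᵥ d) ⬝ᵥ (1 - colProj W) *ᵥ (z - W *ᵥ d) = z ⬝ᵥ (1 - colProj W) *ᵥ z := by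
  have hP := (isStarProjection_colProj W).one_sub
  rw [dotProduct_mulVec_of_isStarProjection hP, dotProduct_mulVec_of_isStarProjection hP,
    Matrix.mulVec_sub, one_sub_colProj_mulVec h, sub_zero]

lemma residual_le_dotProduct_sub_mulVec {W : Matrix m ι ℝ} (h : IsUnit (Wᵀ * W).det) (z : m → ℝ)
    (d : ι → ℝ) : z ⬝ᵥ (1 - colProj W) *ᵥ z ≤ (z - W *ᵥ d) ⬝ᵥ (z - W *ᵥ d) := by
  rw [← residual_sub_mulVec h z d]
  exact dotProduct_mulVec_le_of_isStarProjection (isStarProjection_colProj W).one_sub _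

end ColProj

end QuadraticForm

/-! ### Eigenvalue bounds -/

section Eigenvalue

variable {ι : Type*} [Fintype ι] [DecidableEq ι] {A : Matrix ι ι ℝ}

lemma exists_dotProduct_mulVec_eq_eigenvalue (hA : A.IsHermitian) (i : ι) :
    ∃ v : ι → ℝ, v ⬝ᵥ v = 1 ∧ v ⬝ᵥ A *ᵥ v = hA.eigenvalues i := by
  refine ⟨(hA.eigenvectorBasis i).ofLp, ?_, by simpa using (hA.eigenvalues_eq i).symm⟩
  have hnorm : ‖hA.eigenvectorBasis i‖ ^ 2 = 1 := by
    rw [hA.eigenvectorBasis.orthonormal.1 i, one_pow]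
  rw [EuclideanSpace.real_norm_sq_eq] at hnorm
  simpa only [dotProduct, sq] using hnorm

lemma pow_card_le_det (hA : A.IsHermitian) {a : ℝ} (ha : 0 ≤ a)
    (h : ∀ x, a * (x ⬝ᵥ x) ≤ x ⬝ᵥ A *ᵥ x) : a ^ Fintype.card ι ≤ A.det := by
  rw [hA.det_eq_prod_eigenvalues, ← Finset.card_univ, ← Finset.prod_const]
  refine Finset.prod_le_prod (fun _ _ => ha) fun i _ => ?_
  obtain ⟨v, hv, hi⟩ := exists_dotProduct_mulVec_eq_eigenvalue hA i
  simpa [hv, hi] using h v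

lemma det_le_pow_card (hA : A.PosSemidef) {a : ℝ} (h : ∀ x, x ⬝ᵥ A *ᵥ x ≤ a * (x ⬝ᵥ x)) :
    A.det ≤ a ^ Fintype.card ι := by
  rw [hA.isHermitian.det_eq_prod_eigenvalues, ← Finset.card_univ, ← Finset.prod_const]
  refine Finset.prod_le_prod (fun i _ => hA.eigenvalues_nonneg i) fun i _ => ?_
  obtain ⟨v, hv, hi⟩ := exists_dotProduct_mulVec_eq_eigenvalue hA.isHermitian i
  simpa [hv, hi] using h v

lemma dotProduct_algebraMap_mulVec (a : ℝ) (x : ι → ℝ) :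
    x ⬝ᵥ algebraMap ℝ (Matrix ι ι ℝ) a *ᵥ x = a * (x ⬝ᵥ x) := by
  rw [Algebra.algebraMap_eq_smul_one, Matrix.smul_mulVec, Matrix.one_mulVec, dotProduct_smul,
    smul_eq_mul]

open scoped MatrixOrder in
lemma minEig_mul_dotProduct_self_le (hA : A.IsHermitian) (x : ι → ℝ) :
    minEig A * (x ⬝ᵥ x) ≤ x ⬝ᵥ A *ᵥ x := by
  have hle : algebraMap ℝ _ (minEig A) ≤ A := algebraMap_le_of_le_spectrum
    (fun a ha => csInf_le Matrix.finite_real_spectrum.bddBelow ha) hA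
  simpa only [dotProduct_algebraMap_mulVec] using dotProduct_mulVec_mono hle x

open scoped MatrixOrder in
lemma dotProduct_mulVec_le_maxEig_mul (hA : A.IsHermitian) (x : ι → ℝ) :
    x ⬝ᵥ A *ᵥ x ≤ maxEig A * (x ⬝ᵥ x) := by
  have hle : A ≤ algebraMap ℝ _ (maxEig A) := le_algebraMap_of_spectrum_le
    (fun a ha => le_csSup Matrix.finite_real_spectrum.bddAbove ha) hA
  simpa only [dotProduct_algebraMap_mulVec] using dotProduct_mulVec_mono hle x

end Eigenvalue

/-! ### Columns of the design -/

section Columns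

lemma sum_eq_sum_coe_of_eq_zero {ι M : Type*} [Fintype ι] [AddCommMonoid M] {s : Finset ι}
    {f : ι → M} (hf : ∀ j ∉ s, f j = 0) : ∑ j, f j = ∑ j : {j // j ∈ s}, f j := by
  rw [Finset.sum_coe_sort s f]
  exact (Finset.sum_subset (Finset.subset_univ s) fun j _ hj => hf j hj).symm

lemma dotProduct_self_eq_restrict {ι : Type*} [Fintype ι] {s : Finset ι} {v : ι → ℝ}
    (hv : ∀ j ∉ s, v j = 0) : v ⬝ᵥ v = (fun j : {j // j ∈ s} => v j) ⬝ᵥ fun j => v j :=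
  sum_eq_sum_coe_of_eq_zero (f := fun j => v j * v j) fun j hj => by rw [hv j hj, mul_zero]

variable {n p : ℕ} {X : Matrix (Fin n) (Fin p) ℝ} {γ₀ γ η : Finset (Fin p)} {v : Fin p → ℝ}

lemma projMat_eq_colProj (X : Matrix (Fin n) (Fin p) ℝ) (γ : Finset (Fin p)) :
    projMat X γ = colProj (colSub X γ) := rfl

lemma mulVec_eq_colSub_mulVec (X : Matrix (Fin n) (Fin p) ℝ) (hv : ∀ j ∉ γ, v j = 0) :
    X *ᵥ v = colSub X γ *ᵥ fun j => v j := by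
  ext i
  exact sum_eq_sum_coe_of_eq_zero (f := fun j => X i j * v j) fun j hj => by rw [hv j hj, mul_zero]

lemma colSub_mulVec (X : Matrix (Fin n) (Fin p) ℝ) (d : {j // j ∈ γ} → ℝ) :
    colSub X γ *ᵥ d = X *ᵥ Function.extend Subtype.val d 0 := by
  have hd : ∀ j ∉ γ, Function.extend Subtype.val d 0 j = 0 := fun j hj =>
    Function.extend_apply' _ _ _ (by simpa using hj)
  rw [mulVec_eq_colSub_mulVec X hd]
  exact congrArg _ (Function.extend_comp Subtype.val_injective d 0).symm

lemma isUnit_det_transpose_mul_self_colSub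
    (h : ∀ v : Fin p → ℝ, (∀ j ∉ γ, v j = 0) → X *ᵥ v = 0 → v = 0) :
    IsUnit ((colSub X γ)ᵀ * colSub X γ).det := by
  refine isUnit_det_transpose_mul_self fun d hd => ?_
  have hext : Function.extend Subtype.val d 0 = 0 :=
    h _ (fun j hj => Function.extend_apply' _ _ _ (by simpa using hj)) (colSub_mulVec X d ▸ hd)
  rw [← Function.extend_comp Subtype.val_injective d 0, hext]
  rfl

lemma isHermitian_residGram (X : Matrix (Fin n) (Fin p) ℝ) (η γ : Finset (Fin p)) :
    (residGram X η γ).IsHermitian := by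
  rw [Matrix.isHermitian_iff_isSymm]
  simp [Matrix.IsSymm, residGram, projMat_eq_colProj, Matrix.transpose_mul, transpose_colProj,
    Matrix.mul_assoc]

lemma dotProduct_residGram_mulVec (X : Matrix (Fin n) (Fin p) ℝ) (η γ : Finset (Fin p))
    (x : {j // j ∈ η} → ℝ) :
    x ⬝ᵥ residGram X η γ *ᵥ x =
      (1 / (n : ℝ)) * ((colSub X η *ᵥ x) ⬝ᵥ (1 - projMat X γ) *ᵥ (colSub X η *ᵥ x)) := by
  rw [residGram, Matrix.smul_mulVec, dotProduct_smul, smul_eq_mul, ← Matrix.mulVec_mulVec,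
    ← Matrix.mulVec_mulVec, Matrix.dotProduct_transpose_mulVec, dotProduct_comm]

lemma mul_dotProduct_self_le_of_le_minEig_residGram (hn : 0 < n) {a : ℝ}
    (ha : a ≤ minEig (residGram X η γ)) (hv : ∀ j ∉ η, v j = 0) :
    n * a * (v ⬝ᵥ v) ≤ (X *ᵥ v) ⬝ᵥ (1 - projMat X γ) *ᵥ (X *ᵥ v) := by
  have hle := minEig_mul_dotProduct_self_le (isHermitian_residGram X η γ) fun j => v j
  rw [dotProduct_residGram_mulVec, ← mulVec_eq_colSub_mulVec X hv,
    ← dotProduct_self_eq_restrict hv] at hle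
  have hale := (mul_le_mul_of_nonneg_right ha (dotProduct_self_nonneg v)).trans hle
  rw [one_div, ← div_eq_inv_mul, le_div_iff₀ (by exact_mod_cast hn)] at hale
  linarith

lemma dotProduct_self_mulVec_le_of_maxEig_gram_le (hn : 0 < n) {b : ℝ}
    (hb : maxEig ((1 / (n : ℝ)) • ((colSub X η)ᵀ * colSub X η)) ≤ b) (hv : ∀ j ∉ η, v j = 0) :
    (X *ᵥ v) ⬝ᵥ (X *ᵥ v) ≤ n * b * (v ⬝ᵥ v) := by
  have hle := dotProduct_mulVec_le_maxEig_mul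
    (A := (1 / (n : ℝ)) • ((colSub X η)ᵀ * colSub X η))
    (Matrix.isHermitian_iff_isSymm.2 (by simp [Matrix.IsSymm, Matrix.transpose_mul])) fun j => v j
  rw [Matrix.smul_mulVec, dotProduct_smul, smul_eq_mul, dotProduct_transpose_mul_self_mulVec,
    ← mulVec_eq_colSub_mulVec X hv, ← dotProduct_self_eq_restrict hv] at hle
  have hleb := hle.trans (mul_le_mul_of_nonneg_right hb (dotProduct_self_nonneg v))
  rw [one_div, ← div_eq_inv_mul, div_le_iff₀ (by exact_mod_cast hn)] at hleb
  linarith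

lemma mul_dotProduct_self_le_of_le_phiMin (hn : 0 < n) {a : ℝ} (ha : a ≤ phiMin X γ₀)
    (hv : ∀ j ∉ γ₀ \ γ, v j = 0) :
    n * a * (v ⬝ᵥ v) ≤ (X *ᵥ v) ⬝ᵥ (1 - projMat X γ) *ᵥ (X *ᵥ v) := by
  by_cases hγ : γ₀ ⊆ γ
  · have hv0 : v = 0 := funext fun j => hv j (by simp [Finset.sdiff_eq_empty_iff_subset.2 hγ])
    simp [hv0]
  · exact mul_dotProduct_self_le_of_le_minEig_residGram hn
      (ha.trans (csInf_le (Set.toFinite _).bddBelow ⟨γ, hγ, rfl⟩)) hv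

lemma dotProduct_self_mulVec_le_of_phiMax_le (hn : 0 < n) (h₀ : γ₀.Nonempty) {b : ℝ}
    (hb : phiMax X γ₀ ≤ b) (hv : ∀ j ∉ γ₀, v j = 0) :
    (X *ᵥ v) ⬝ᵥ (X *ᵥ v) ≤ n * b * (v ⬝ᵥ v) := by
  refine dotProduct_self_mulVec_le_of_maxEig_gram_le hn (η := γ₀ \ ∅) (le_trans ?_ hb)
    (by simpa using hv)
  refine le_csSup (Set.toFinite _).bddAbove ⟨∅, ?_, rfl⟩
  simpa [nonOverModels, Finset.subset_empty] using h₀.ne_empty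

end Columns

/-! ### Gaussian integrals -/

section GaussianIntegral

variable {ι : Type*} [Fintype ι]

/-- The standard Gaussian measure on `ι → ℝ`, as a product measure; Mathlib's `stdGaussian` lives
on a Euclidean space instead. -/
noncomputable abbrev stdGaussianPi (ι : Type*) [Fintype ι] : Measure (ι → ℝ) :=
  Measure.pi fun _ => gaussianReal 0 1

lemma stdGaussianPi_eq_withDensity :
    stdGaussianPi ι = (volume : Measure (ι → ℝ)).withDensity
      fun x => ENNReal.ofReal (∏ i, gaussianPDFReal 0 1 (x i)) := by
  refine Measure.pi_eq fun s hs => ?_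
  have hintegrable : Integrable (fun x : ι → ℝ => ∏ i, gaussianPDFReal 0 1 (x i))
      (Measure.pi fun i => (volume : Measure ℝ).restrict (s i)) :=
    Integrable.fintype_prod fun i => (integrable_gaussianPDFReal 0 1).restrict
  rw [withDensity_apply _ (MeasurableSet.univ_pi hs), volume_pi, Measure.restrict_pi_pi,
    ← ofReal_integral_eq_lintegral_ofReal hintegrable
      (Eventually.of_forall fun x => Finset.prod_nonneg fun i _ => gaussianPDFReal_nonneg _ _ _),
    integral_fintype_prod_eq_prod, ENNReal.ofReal_prod_of_nonneg
      (fun i _ => integral_nonneg fun x => gaussianPDFReal_nonneg _ _ _)]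
  exact Finset.prod_congr rfl fun i _ => (gaussianReal_apply_eq_integral 0 one_ne_zero _).symm

lemma prod_gaussianPDFReal {v : ℝ≥0} (m x : ι → ℝ) :
    ∏ i, gaussianPDFReal (m i) v (x i) =
      (√(2 * Real.pi * v))⁻¹ ^ Fintype.card ι * Real.exp (-((x - m) ⬝ᵥ (x - m)) / (2 * v)) := by
  simp only [gaussianPDFReal]
  rw [Finset.prod_mul_distrib, Finset.prod_const, Finset.card_univ, ← Real.exp_sum,
    ← Finset.sum_div, Finset.sum_neg_distrib, dotProduct]
  simp only [sq, Pi.sub_apply]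

lemma integral_stdGaussianPi (f : (ι → ℝ) → ℝ) :
    ∫ x, f x ∂stdGaussianPi ι =
      (√(2 * Real.pi))⁻¹ ^ Fintype.card ι * ∫ x, Real.exp (-(x ⬝ᵥ x) / 2) * f x := by
  have hmeas : Measurable fun x : ι → ℝ => ∏ i, gaussianPDFReal 0 1 (x i) :=
    Finset.measurable_prod _ fun i _ =>
      (measurable_gaussianPDFReal 0 1).comp (measurable_pi_apply i)
  rw [stdGaussianPi_eq_withDensity, integral_withDensity_eq_integral_toReal_smul
    hmeas.ennreal_ofReal (Eventually.of_forall fun x => ENNReal.ofReal_lt_top),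
    ← integral_const_mul]
  refine integral_congr_ae (Eventually.of_forall fun x => ?_)
  have hpdf := prod_gaussianPDFReal (v := 1) 0 x
  simp only [NNReal.coe_one, mul_one, sub_zero, Pi.zero_apply] at hpdf
  simp only [hpdf, smul_eq_mul, ENNReal.toReal_ofReal (show 0 ≤ (√(2 * Real.pi))⁻¹ ^
    Fintype.card ι * Real.exp (-(x ⬝ᵥ x) / 2) by positivity), mul_assoc]

lemma integral_exp_neg_dotProduct_self :
    ∫ x : ι → ℝ, Real.exp (-(x ⬝ᵥ x) / 2) = √(2 * Real.pi) ^ Fintype.card ι := by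
  have h := integral_stdGaussianPi (ι := ι) fun _ => 1
  simp only [integral_const, probReal_univ, smul_eq_mul, mul_one] at h
  rwa [inv_pow, eq_comm, inv_mul_eq_iff_eq_mul₀ (by positivity), mul_one] at h

variable [DecidableEq ι]

lemma integral_comp_mulVec {E : Type*} [NormedAddCommGroup E] [NormedSpace ℝ E]
    {B : Matrix ι ι ℝ} (hB : B.det ≠ 0) (f : (ι → ℝ) → E) :
    ∫ x, f (B *ᵥ x) = |B.det|⁻¹ • ∫ x, f x := by
  have hinj : Function.Injective (Matrix.toLin' B) :=
    Matrix.mulVec_injective_iff_isUnit.2 ((Matrix.isUnit_iff_isUnit_det B).2 hB.isUnit)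
  have hemb : MeasurableEmbedding (Matrix.toLin' B) :=
    (LinearMap.isClosedEmbedding_of_injective (LinearMap.ker_eq_bot.2 hinj)).measurableEmbedding
  have hmap := hemb.integral_map (μ := volume) f
  rw [Real.map_matrix_volume_pi_eq_smul_volume_pi hB, integral_smul_measure,
    ENNReal.toReal_ofReal (abs_nonneg _), abs_inv] at hmap
  exact hmap.symm

open scoped MatrixOrder Matrix.Norms.L2Operator in
lemma integral_exp_neg_dotProduct_mulVec {A : Matrix ι ι ℝ} (hA : A.PosDef) :
    ∫ x : ι → ℝ, Real.exp (-(x ⬝ᵥ A *ᵥ x) / 2) = √(2 * Real.pi) ^ Fintype.card ι / √A.det := by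
  obtain ⟨B, hB⟩ := CStarAlgebra.nonneg_iff_eq_star_mul_self.1 hA.posSemidef.nonneg
  rw [Matrix.star_eq_conjTranspose, Matrix.conjTranspose_eq_transpose_of_trivial] at hB
  have hdet : A.det = B.det * B.det := by rw [hB, Matrix.det_mul, Matrix.det_transpose]
  have hB0 : B.det ≠ 0 := fun h => hA.det_pos.ne' (by rw [hdet, h, mul_zero])
  have hquad : ∀ x : ι → ℝ, x ⬝ᵥ A *ᵥ x = (B *ᵥ x) ⬝ᵥ (B *ᵥ x) := fun x => by
    rw [hB, dotProduct_transpose_mul_self_mulVec]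
  simp only [hquad]
  rw [integral_comp_mulVec hB0 fun x => Real.exp (-(x ⬝ᵥ x) / 2), integral_exp_neg_dotProduct_self,
    hdet, Real.sqrt_mul_self_eq_abs, smul_eq_mul, ← div_eq_inv_mul]

lemma integral_stdGaussianPi_exp_quadratic {A : Matrix ι ι ℝ} (hA : A.PosDef) (b : ι → ℝ) :
    ∫ x, Real.exp ((x ⬝ᵥ x) / 2 - ((x - b) ⬝ᵥ A *ᵥ (x - b)) / 2) ∂stdGaussianPi ι =
      (√A.det)⁻¹ := by
  have hcancel : ∀ x : ι → ℝ, Real.exp (-(x ⬝ᵥ x) / 2) *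
      Real.exp ((x ⬝ᵥ x) / 2 - ((x - b) ⬝ᵥ A *ᵥ (x - b)) / 2) =
      Real.exp (-((x - b) ⬝ᵥ A *ᵥ (x - b)) / 2) := by
    intro x
    rw [← Real.exp_add]
    congr 1
    ring
  simp_rw [integral_stdGaussianPi, hcancel]
  rw [integral_sub_right_eq_self (fun x => Real.exp (-(x ⬝ᵥ A *ᵥ x) / 2)) b,
    integral_exp_neg_dotProduct_mulVec hA, inv_pow, div_eq_mul_inv,
    inv_mul_cancel_left₀ (by positivity)]

end GaussianIntegral

/-! ### Ridge regression -/

section Ridge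

lemma posDef_one_add_mul_transpose {m ι : Type*} [Finite m] [Fintype ι] [DecidableEq m]
    (W : Matrix m ι ℝ) : (1 + W * Wᵀ).PosDef := by
  simpa only [Matrix.conjTranspose_eq_transpose_of_trivial] using
    Matrix.PosDef.one.add_posSemidef (Matrix.posSemidef_self_mul_conjTranspose W)

variable {m ι : Type*} [Fintype m] [Fintype ι] [DecidableEq m]

lemma dotProduct_one_add_mul_transpose_mulVec (W : Matrix m ι ℝ) (x : m → ℝ) :
    x ⬝ᵥ (1 + W * Wᵀ) *ᵥ x = x ⬝ᵥ x + (Wᵀ *ᵥ x) ⬝ᵥ (Wᵀ *ᵥ x) := by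
  rw [Matrix.add_mulVec, Matrix.one_mulVec, dotProduct_add]
  simpa only [Matrix.transpose_transpose] using
    congrArg (x ⬝ᵥ x + ·) (dotProduct_transpose_mul_self_mulVec Wᵀ x)

/-- The minimum over `b` of the ridge regression objective `‖z - W b‖² + ‖b‖²`, in the closed form
`zᵀ (1 + W Wᵀ)⁻¹ z`. -/
noncomputable def ridgeResidual (W : Matrix m ι ℝ) (z : m → ℝ) : ℝ :=
  z ⬝ᵥ (1 + W * Wᵀ)⁻¹ *ᵥ z

/-- The minimizer of the ridge regression objective `‖z - W b‖² + ‖b‖²`. -/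
noncomputable def ridgeEstimator (W : Matrix m ι ℝ) (z : m → ℝ) : ι → ℝ :=
  Wᵀ *ᵥ ((1 + W * Wᵀ)⁻¹ *ᵥ z)

lemma inv_mulVec_add_mulVec_ridgeEstimator (W : Matrix m ι ℝ) (z : m → ℝ) :
    (1 + W * Wᵀ)⁻¹ *ᵥ z + W *ᵥ ridgeEstimator W z = z := by
  have hunit : IsUnit (1 + W * Wᵀ).det := (posDef_one_add_mul_transpose W).det_pos.ne'.isUnit
  have hz : (1 + W * Wᵀ) *ᵥ ((1 + W * Wᵀ)⁻¹ *ᵥ z) = z := by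
    rw [Matrix.mulVec_mulVec, Matrix.mul_nonsing_inv _ hunit, Matrix.one_mulVec]
  rwa [Matrix.add_mulVec, Matrix.one_mulVec, ← Matrix.mulVec_mulVec] at hz

lemma ridgeResidual_eq (W : Matrix m ι ℝ) (z : m → ℝ) :
    ridgeResidual W z =
      (z - W *ᵥ ridgeEstimator W z) ⬝ᵥ (z - W *ᵥ ridgeEstimator W z) +
        ridgeEstimator W z ⬝ᵥ ridgeEstimator W z := by
  have hz := inv_mulVec_add_mulVec_ridgeEstimator W z
  rw [sub_eq_of_eq_add hz.symm, ridgeResidual, ridgeEstimator]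
  set u := (1 + W * Wᵀ)⁻¹ *ᵥ z with hu
  conv_lhs => enter [1]; rw [← hz]
  rw [add_dotProduct, dotProduct_comm (W *ᵥ _) u,
    ← Matrix.dotProduct_transpose_mulVec W _ u, ridgeEstimator, ← hu]

lemma ridge_objective_eq [DecidableEq ι] (W : Matrix m ι ℝ) (z : m → ℝ) (b : ι → ℝ) :
    (z - W *ᵥ b) ⬝ᵥ (z - W *ᵥ b) + b ⬝ᵥ b = ridgeResidual W z +
      (b - ridgeEstimator W z) ⬝ᵥ (1 + Wᵀ * W) *ᵥ (b - ridgeEstimator W z) := by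
  have hquad := dotProduct_one_add_mul_transpose_mulVec Wᵀ (b - ridgeEstimator W z)
  rw [Matrix.transpose_transpose] at hquad
  rw [hquad, ridgeResidual_eq, sub_eq_of_eq_add (inv_mulVec_add_mulVec_ridgeEstimator W z).symm]
  set u := (1 + W * Wᵀ)⁻¹ *ᵥ z with hu
  set h := b - ridgeEstimator W z with hh
  have hb : b = Wᵀ *ᵥ u + h := by rw [hh, ridgeEstimator, ← hu]; abel
  have hres : z - W *ᵥ b = u - W *ᵥ h := by
    rw [hh, Matrix.mulVec_sub, ← sub_add, hu,
      eq_sub_of_add_eq (inv_mulVec_add_mulVec_ridgeEstimator W z)]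
    abel
  rw [hres, dotProduct_self_sub, hb, dotProduct_self_add, ridgeEstimator, ← hu,
    dotProduct_comm (Wᵀ *ᵥ u) h, Matrix.dotProduct_transpose_mulVec W h u]
  ring

lemma ridgeResidual_le (W : Matrix m ι ℝ) (z : m → ℝ) (b : ι → ℝ) :
    ridgeResidual W z ≤ (z - W *ᵥ b) ⬝ᵥ (z - W *ᵥ b) + b ⬝ᵥ b := by
  classical
  have hpos := (posDef_one_add_mul_transpose Wᵀ).posSemidef.dotProduct_mulVec_nonneg
    (b - ridgeEstimator W z)
  rw [star_trivial, Matrix.transpose_transpose] at hpos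
  rw [ridge_objective_eq]
  linarith

lemma dotProduct_sub_mulVec_ridgeEstimator_le (W : Matrix m ι ℝ) (z : m → ℝ) :
    (z - W *ᵥ ridgeEstimator W z) ⬝ᵥ (z - W *ᵥ ridgeEstimator W z) ≤ ridgeResidual W z := by
  rw [ridgeResidual_eq]
  exact le_add_of_nonneg_right (dotProduct_self_nonneg _)

lemma ridgeResidual_nonneg (W : Matrix m ι ℝ) (z : m → ℝ) : 0 ≤ ridgeResidual W z :=
  (dotProduct_self_nonneg _).trans (dotProduct_sub_mulVec_ridgeEstimator_le W z)

lemma ridgeResidual_smul (W : Matrix m ι ℝ) (t : ℝ) (z : m → ℝ) :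
    ridgeResidual W (t • z) = t ^ 2 * ridgeResidual W z := by
  rw [ridgeResidual, ridgeResidual, Matrix.mulVec_smul, smul_dotProduct, dotProduct_smul,
    smul_eq_mul, smul_eq_mul]
  ring

end Ridge

/-! ### Closed form of the posterior -/

section Marginal

variable {n p : ℕ} {c : Fin p → ℝ}

/-- The prior standard deviations of the coefficients in units of `σ`; they vanish off the
model. -/
noncomputable def priorScale (c : Fin p → ℝ) (γ : Finset (Fin p)) : Fin p → ℝ :=
  fun j => if j ∈ γ then √(c j) else 0

/-- The design matrix of the standardized coefficients of the model `γ`: its columns are scaled by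
the prior standard deviations, and those off the model are replaced by zero instead of being
deleted, so that all models share one index type. -/
noncomputable def scaledDesign (c : Fin p → ℝ) (X : Matrix (Fin n) (Fin p) ℝ)
    (γ : Finset (Fin p)) : Matrix (Fin n) (Fin p) ℝ :=
  X * Matrix.diagonal (priorScale c γ)

lemma scaledDesign_mulVec (c : Fin p → ℝ) (X : Matrix (Fin n) (Fin p) ℝ) (γ : Finset (Fin p))
    (b : Fin p → ℝ) : scaledDesign c X γ *ᵥ b = X *ᵥ (priorScale c γ * b) := by
  rw [scaledDesign, ← Matrix.mulVec_mulVec]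
  congr 1
  ext j
  rw [Matrix.mulVec_diagonal, Pi.mul_apply]

lemma coefPrior_eq_map (hc : ∀ j, 0 ≤ c j) (γ : Finset (Fin p)) {s : ℝ} (hs : 0 ≤ s) :
    coefPrior c γ s = (stdGaussianPi (Fin p)).map fun b => √s • (priorScale c γ * b) := by
  have hmap : (fun b : Fin p → ℝ => √s • (priorScale c γ * b)) =
      fun b j => (√s * priorScale c γ j) * b j := by
    ext b j
    simp [mul_assoc]
  rw [hmap, Measure.pi_map_pi (fun j => by fun_prop), coefPrior]
  congr 1
  ext1 j
  rw [gaussianReal_map_const_mul, mul_zero, mul_one]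
  by_cases hj : j ∈ γ
  · rw [if_pos hj, priorScale, if_pos hj]
    congr 1
    ext
    rw [NNReal.coe_mk, Real.coe_toNNReal _ (mul_nonneg (hc j) hs), mul_pow, Real.sq_sqrt hs,
      Real.sq_sqrt (hc j), mul_comm]
  · rw [if_neg hj, priorScale, if_neg hj, mul_zero, ← gaussianReal_zero_var]
    congr 1
    ext
    simp

lemma likelihood_eq (X : Matrix (Fin n) (Fin p) ℝ) (β : Fin p → ℝ) {s : ℝ} (hs : 0 ≤ s)
    (y : Fin n → ℝ) :
    likelihood X β s y =
      (√(2 * Real.pi * s))⁻¹ ^ n * Real.exp (-((y - X *ᵥ β) ⬝ᵥ (y - X *ᵥ β)) / (2 * s)) := by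
  rw [likelihood, prod_gaussianPDFReal, Real.coe_toNNReal _ hs, Fintype.card_fin]

lemma continuous_likelihood (X : Matrix (Fin n) (Fin p) ℝ) (s : ℝ) (y : Fin n → ℝ) :
    Continuous fun β => likelihood X β s y := by
  simp only [likelihood, gaussianPDFReal, Matrix.mulVec, dotProduct]
  fun_prop

lemma inv_sqrt_two_pi_mul_inv_pow {τ : ℝ} (hτ : 0 < τ) (n : ℕ) :
    (√(2 * Real.pi * τ⁻¹))⁻¹ ^ n = (√(2 * Real.pi))⁻¹ ^ n * τ ^ ((n : ℝ) / 2) := by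
  rw [Real.sqrt_mul (by positivity), Real.sqrt_inv, mul_inv, inv_inv, mul_pow,
    Real.sqrt_eq_rpow τ, ← Real.rpow_natCast (τ ^ (1 / 2 : ℝ)) n, ← Real.rpow_mul hτ.le]
  congr 2
  ring

lemma likelihood_smul_priorScale_mul (X : Matrix (Fin n) (Fin p) ℝ) (γ : Finset (Fin p)) {τ : ℝ}
    (hτ : 0 < τ) (y : Fin n → ℝ) (b : Fin p → ℝ) {W : Matrix (Fin n) (Fin p) ℝ}
    (hW : W = scaledDesign c X γ) {b₀ : Fin p → ℝ} (hb₀ : b₀ = ridgeEstimator W (√τ • y)) :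
    likelihood X (√τ⁻¹ • (priorScale c γ * b)) τ⁻¹ y =
      (√(2 * Real.pi))⁻¹ ^ n * τ ^ ((n : ℝ) / 2) * Real.exp (-(ridgeResidual W y / 2 * τ)) *
        Real.exp ((b ⬝ᵥ b) / 2 - ((b - b₀) ⬝ᵥ (1 + Wᵀ * W) *ᵥ (b - b₀)) / 2) := by
  have hscale : √τ • y - W *ᵥ b = √τ • (y - X *ᵥ (√τ⁻¹ • (priorScale c γ * b))) := by
    rw [Matrix.mulVec_smul, ← scaledDesign_mulVec, ← hW, smul_sub, smul_smul, Real.sqrt_inv,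
      mul_inv_cancel₀ (Real.sqrt_pos.2 hτ).ne', one_smul]
  have hsquare := ridge_objective_eq W (√τ • y) b
  rw [← hb₀, hscale, smul_dotProduct, dotProduct_smul, smul_eq_mul, smul_eq_mul, ← mul_assoc,
    Real.mul_self_sqrt hτ.le, ridgeResidual_smul, Real.sq_sqrt hτ.le] at hsquare
  rw [likelihood_eq X _ (inv_nonneg.2 hτ.le), inv_sqrt_two_pi_mul_inv_pow hτ,
    mul_assoc _ (Real.exp _), ← Real.exp_add]
  congr 2
  rw [div_mul_eq_div_div, div_inv_eq_mul]
  linarith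

lemma integral_likelihood (hc : ∀ j, 0 ≤ c j) (X : Matrix (Fin n) (Fin p) ℝ)
    (γ : Finset (Fin p)) {τ : ℝ} (hτ : 0 < τ) (y : Fin n → ℝ) :
    ∫ β, likelihood X β τ⁻¹ y ∂(coefPrior c γ τ⁻¹) =
      (√(1 + scaledDesign c X γ * (scaledDesign c X γ)ᵀ).det)⁻¹ * (√(2 * Real.pi))⁻¹ ^ n *
        (τ ^ ((n : ℝ) / 2) * Real.exp (-(ridgeResidual (scaledDesign c X γ) y / 2 * τ))) := by
  have hmeas : Measurable fun b : Fin p → ℝ => √τ⁻¹ • (priorScale c γ * b) := by fun_prop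
  have hposDef : (1 + (scaledDesign c X γ)ᵀ * scaledDesign c X γ).PosDef := by
    simpa using posDef_one_add_mul_transpose (scaledDesign c X γ)ᵀ
  rw [coefPrior_eq_map hc γ (inv_nonneg.2 hτ.le), integral_map hmeas.aemeasurable
    (continuous_likelihood X τ⁻¹ y).aestronglyMeasurable]
  simp only [likelihood_smul_priorScale_mul X γ hτ y _ rfl rfl]
  rw [integral_const_mul, integral_stdGaussianPi_exp_quadratic hposDef,
    ← Matrix.det_one_add_mul_comm]
  ring

lemma integral_chiSquared {ν : ℝ} (hν : 0 < ν) (f : ℝ → ℝ) :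
    ∫ τ, f τ ∂(chiSquared ν) = ∫ τ in Set.Ioi 0,
      ((1 / 2) ^ (ν / 2) / Real.Gamma (ν / 2) * τ ^ (ν / 2 - 1) * Real.exp (-(1 / 2 * τ))) *
        f τ := by
  have hmeas : Measurable (gammaPDF (ν / 2) (1 / 2)) :=
    (measurable_gammaPDFReal _ _).ennreal_ofReal
  rw [chiSquared, gammaMeasure, integral_withDensity_eq_integral_toReal_smul hmeas
    (Eventually.of_forall fun x => ENNReal.ofReal_lt_top),
    ← setIntegral_eq_integral_of_forall_compl_eq_zero (s := Set.Ici 0),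
    integral_Ici_eq_integral_Ioi]
  · refine setIntegral_congr_fun measurableSet_Ioi fun τ hτ => ?_
    have hτ₀ : 0 ≤ τ := le_of_lt hτ
    rw [gammaPDF_of_nonneg hτ₀, ENNReal.toReal_ofReal (by positivity), smul_eq_mul]
  · intro τ hτ
    rw [gammaPDF_of_neg (not_le.1 hτ), ENNReal.toReal_zero, zero_smul]

/-- The part of the marginal likelihood of `γ` that depends on the model. -/
noncomputable def modelScore (ν : ℝ) (c : Fin p → ℝ) (X : Matrix (Fin n) (Fin p) ℝ)
    (y : Fin n → ℝ) (γ : Finset (Fin p)) : ℝ :=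
  (√(1 + scaledDesign c X γ * (scaledDesign c X γ)ᵀ).det)⁻¹ *
    (1 + ridgeResidual (scaledDesign c X γ) y) ^ (-(((n : ℝ) + ν) / 2))

/-- The factor of the marginal likelihood that is common to all models. -/
noncomputable def marginalConst (n : ℕ) (ν : ℝ) : ℝ :=
  (1 / 2) ^ (ν / 2) / Real.Gamma (ν / 2) * (√(2 * Real.pi))⁻¹ ^ n *
    (2 ^ (((n : ℝ) + ν) / 2) * Real.Gamma (((n : ℝ) + ν) / 2))

lemma modelScore_pos (ν : ℝ) (c : Fin p → ℝ) (X : Matrix (Fin n) (Fin p) ℝ)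
    (y : Fin n → ℝ) (γ : Finset (Fin p)) : 0 < modelScore ν c X y γ := by
  have hdet := (posDef_one_add_mul_transpose (scaledDesign c X γ)).det_pos
  have hres := ridgeResidual_nonneg (scaledDesign c X γ) y
  exact mul_pos (inv_pos.2 (Real.sqrt_pos.2 hdet)) (Real.rpow_pos_of_pos (by linarith) _)

lemma marginalConst_pos {ν : ℝ} (hν : 0 < ν) (n : ℕ) : 0 < marginalConst n ν := by
  rw [marginalConst]
  positivity

lemma marginalLikelihood_eq {ν : ℝ} (hν : 0 < ν) (hc : ∀ j, 0 ≤ c j)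
    (X : Matrix (Fin n) (Fin p) ℝ) (y : Fin n → ℝ) (γ : Finset (Fin p)) :
    marginalLikelihood ν c X y γ = marginalConst n ν * modelScore ν c X y γ := by
  rw [marginalLikelihood, integral_chiSquared hν, modelScore, marginalConst]
  set q := ridgeResidual (scaledDesign c X γ) y with hq
  have hq₀ : 0 ≤ q := ridgeResidual_nonneg _ _
  set D := (√(1 + scaledDesign c X γ * (scaledDesign c X γ)ᵀ).det)⁻¹ with hD
  have hgamma : ∀ τ ∈ Set.Ioi (0 : ℝ),
      ((1 / 2) ^ (ν / 2) / Real.Gamma (ν / 2) * τ ^ (ν / 2 - 1) * Real.exp (-(1 / 2 * τ))) *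
        ∫ β, likelihood X β τ⁻¹ y ∂(coefPrior c γ τ⁻¹) =
      ((1 / 2) ^ (ν / 2) / Real.Gamma (ν / 2) * (√(2 * Real.pi))⁻¹ ^ n * D) *
        (τ ^ (((n : ℝ) + ν) / 2 - 1) * Real.exp (-((1 + q) / 2 * τ))) := by
    intro τ hτ
    have hpow : τ ^ (((n : ℝ) + ν) / 2 - 1) = τ ^ (ν / 2 - 1) * τ ^ ((n : ℝ) / 2) := by
      rw [← Real.rpow_add hτ]
      congr 1
      ring
    have hexp : Real.exp (-((1 + q) / 2 * τ)) =
        Real.exp (-(1 / 2 * τ)) * Real.exp (-(q / 2 * τ)) := by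
      rw [← Real.exp_add]
      congr 1
      ring
    rw [integral_likelihood hc X γ hτ y, ← hq, ← hD, hpow, hexp]
    ring
  have hrate : (1 / ((1 + q) / 2)) ^ (((n : ℝ) + ν) / 2) =
      2 ^ (((n : ℝ) + ν) / 2) * (1 + q) ^ (-(((n : ℝ) + ν) / 2)) := by
    rw [one_div_div, Real.div_rpow (by norm_num) (by positivity), Real.rpow_neg (by positivity),
      div_eq_mul_inv]
  rw [setIntegral_congr_fun measurableSet_Ioi hgamma, integral_const_mul,
    Real.integral_rpow_mul_exp_neg_mul_Ioi (by positivity) (by positivity), hrate]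
  ring

variable {ν : ℝ} {prior : PMF (Finset (Fin p))} {X : Matrix (Fin n) (Fin p) ℝ} {y : Fin n → ℝ}
  {γ₀ : Finset (Fin p)}

lemma posterior_eq (hν : 0 < ν) (prior : PMF (Finset (Fin p))) (hc : ∀ j, 0 ≤ c j)
    (X : Matrix (Fin n) (Fin p) ℝ) (y : Fin n → ℝ) (γ : Finset (Fin p)) :
    _root_.posterior ν prior c X y γ = (prior γ).toReal * modelScore ν c X y γ /
      ∑ γ', (prior γ').toReal * modelScore ν c X y γ' := by
  simp only [_root_.posterior, marginalLikelihood_eq hν hc, mul_left_comm _ (marginalConst n ν)]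
  rw [← Finset.mul_sum, mul_div_mul_left _ _ (marginalConst_pos hν n).ne']

lemma sum_prior_mul_modelScore_pos (ν : ℝ) (c : Fin p → ℝ) (X : Matrix (Fin n) (Fin p) ℝ)
    (y : Fin n → ℝ) (h₀ : prior γ₀ ≠ 0) :
    0 < ∑ γ, (prior γ).toReal * modelScore ν c X y γ :=
  Finset.sum_pos' (fun _ _ => mul_nonneg ENNReal.toReal_nonneg (modelScore_pos _ _ _ _ _).le)
    ⟨γ₀, Finset.mem_univ _, mul_pos (ENNReal.toReal_pos h₀ (prior.apply_ne_top γ₀))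
      (modelScore_pos _ _ _ _ _)⟩

lemma posterior_nonneg (hν : 0 < ν) (hc : ∀ j, 0 ≤ c j) (γ : Finset (Fin p)) :
    0 ≤ _root_.posterior ν prior c X y γ := by
  have hweight : ∀ γ, 0 ≤ (prior γ).toReal * modelScore ν c X y γ := fun γ =>
    mul_nonneg ENNReal.toReal_nonneg (modelScore_pos _ _ _ _ _).le
  rw [posterior_eq hν prior hc]
  exact div_nonneg (hweight γ) (Finset.sum_nonneg fun γ _ => hweight γ)

lemma posterior_pos (hν : 0 < ν) (hc : ∀ j, 0 ≤ c j) (h₀ : prior γ₀ ≠ 0) :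
    0 < _root_.posterior ν prior c X y γ₀ := by
  rw [posterior_eq hν prior hc]
  exact div_pos (mul_pos (ENNReal.toReal_pos h₀ (prior.apply_ne_top γ₀))
    (modelScore_pos _ _ _ _ _)) (sum_prior_mul_modelScore_pos ν c X y h₀)

lemma posterior_add_sum_erase (hν : 0 < ν) (hc : ∀ j, 0 ≤ c j) (h₀ : prior γ₀ ≠ 0) :
    _root_.posterior ν prior c X y γ₀ +
      ∑ γ ∈ Finset.univ.erase γ₀, _root_.posterior ν prior c X y γ = 1 := by
  rw [Finset.add_sum_erase _ _ (Finset.mem_univ γ₀)]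
  simp only [posterior_eq hν prior hc]
  rw [← Finset.sum_div, div_self (sum_prior_mul_modelScore_pos ν c X y h₀).ne']

lemma posterior_div_le (hν : 0 < ν) (hc : ∀ j, 0 ≤ c j) (h₀ : prior γ₀ ≠ 0) {C₀ : ℝ}
    {γ : Finset (Fin p)} (hγ : (prior γ).toReal / (prior γ₀).toReal ≤ C₀) :
    _root_.posterior ν prior c X y γ / _root_.posterior ν prior c X y γ₀ ≤
      C₀ * (modelScore ν c X y γ / modelScore ν c X y γ₀) := by
  rw [posterior_eq hν prior hc, posterior_eq hν prior hc,
    div_div_div_cancel_right₀ (sum_prior_mul_modelScore_pos ν c X y h₀).ne', mul_div_mul_comm]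
  exact mul_le_mul_of_nonneg_right hγ
    (div_nonneg (modelScore_pos _ _ _ _ _).le (modelScore_pos _ _ _ _ _).le)

lemma posterior_le (hν : 0 < ν) (hc : ∀ j, 0 ≤ c j) (h₀ : prior γ₀ ≠ 0) {C₀ : ℝ}
    {γ : Finset (Fin p)} (hγ : (prior γ).toReal / (prior γ₀).toReal ≤ C₀) :
    _root_.posterior ν prior c X y γ ≤ C₀ * (modelScore ν c X y γ / modelScore ν c X y γ₀) := by
  have hle : _root_.posterior ν prior c X y γ₀ ≤ 1 :=
    (le_add_of_nonneg_right (Finset.sum_nonneg fun _ _ => posterior_nonneg hν hc _)).trans_eq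
      (posterior_add_sum_erase hν hc h₀)
  exact (le_div_self (posterior_nonneg hν hc γ) (posterior_pos hν hc h₀) hle).trans
    (posterior_div_le hν hc h₀ hγ)

end Marginal

/-! ### Ridge residuals on a well-conditioned design -/

section RidgeBounds

lemma dotProduct_colProj_mul_mulVec_le {m ι κ : Type*} [Fintype m] [Fintype ι] [Fintype κ]
    [DecidableEq ι] [DecidableEq κ] {W : Matrix m ι ℝ} (h : IsUnit (Wᵀ * W).det)
    (A : Matrix ι κ ℝ) (z : m → ℝ) :
    z ⬝ᵥ colProj (W * A) *ᵥ z ≤ z ⬝ᵥ colProj W *ᵥ z := by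
  classical
  obtain ⟨d, hd⟩ : ∃ d, W *ᵥ d = colProj (W * A) *ᵥ z :=
    ⟨A *ᵥ (((W * A)ᵀ * (W * A))⁻¹ * (W * A)ᵀ) *ᵥ z, by
      rw [Matrix.mulVec_mulVec, Matrix.mulVec_mulVec, colProj, ← Matrix.mul_assoc,
        ← Matrix.mul_assoc]⟩
  have hfit : z - W *ᵥ d = (1 - colProj (W * A)) *ᵥ z := by
    rw [hd, Matrix.sub_mulVec, Matrix.one_mulVec]
  have hle := residual_le_dotProduct_sub_mulVec h z d
  rw [hfit, ← dotProduct_mulVec_of_isStarProjection (isStarProjection_colProj _).one_sub,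
    dotProduct_one_sub_mulVec, dotProduct_one_sub_mulVec] at hle
  linarith

lemma dotProduct_self_add_mulVec_ge {m ι : Type*} [Fintype m] [Fintype ι] [DecidableEq ι]
    {W : Matrix m ι ℝ} (h : IsUnit (Wᵀ * W).det) (e : m → ℝ) (u : ι → ℝ) :
    e ⬝ᵥ e - 2 * (e ⬝ᵥ colProj W *ᵥ e) + ((W *ᵥ u) ⬝ᵥ (W *ᵥ u)) / 2 ≤
      (e + W *ᵥ u) ⬝ᵥ (e + W *ᵥ u) := by
  have hP := isStarProjection_colProj W
  have hcross := Matrix.dotProduct_transpose_mulVec (colProj W) e (W *ᵥ u)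
  rw [transpose_colProj, Matrix.mulVec_mulVec, colProj_mul_self h, dotProduct_comm (W *ᵥ u)]
    at hcross
  have hyoung := dotProduct_self_nonneg (2 • (colProj W *ᵥ e) + W *ᵥ u)
  have hle := dotProduct_mulVec_le_of_isStarProjection hP e
  rw [dotProduct_mulVec_of_isStarProjection hP] at hle ⊢
  rw [dotProduct_self_add, smul_dotProduct, smul_dotProduct, dotProduct_smul] at hyoung
  rw [dotProduct_self_add, hcross]
  simp only [nsmul_eq_mul, Nat.cast_ofNat] at hyoung
  linarith

lemma one_le_det_one_add_mul_transpose {m ι : Type*} [Fintype m] [Fintype ι] [DecidableEq m]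
    (W : Matrix m ι ℝ) : 1 ≤ (1 + W * Wᵀ).det := by
  have hle := pow_card_le_det (posDef_one_add_mul_transpose W).isHermitian zero_le_one fun x => by
    rw [dotProduct_one_add_mul_transpose_mulVec, one_mul]
    exact le_add_of_nonneg_right (dotProduct_self_nonneg (Wᵀ *ᵥ x))
  rwa [one_pow] at hle

lemma one_add_pow_card_mul_det_le {m ι κ : Type*} [Fintype m] [Fintype ι] [Fintype κ]
    [DecidableEq m] (W : Matrix m ι ℝ) (U : Matrix m κ ℝ) {t : ℝ} (ht : 0 ≤ t)
    (h : ∀ x, t * (x ⬝ᵥ x) ≤ ridgeResidual W (U *ᵥ x)) :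
    (1 + t) ^ Fintype.card κ * (1 + W * Wᵀ).det ≤ (1 + (W * Wᵀ + U * Uᵀ)).det := by
  classical
  have hpos := posDef_one_add_mul_transpose W
  have hsymm : ((1 + W * Wᵀ)⁻¹)ᵀ = (1 + W * Wᵀ)⁻¹ := hpos.inv.isHermitian
  have hpow : (1 + t) ^ Fintype.card κ ≤ (1 + Uᵀ * (1 + W * Wᵀ)⁻¹ * U).det := by
    refine pow_card_le_det ?_ (by positivity) fun x => ?_
    · rw [Matrix.isHermitian_iff_isSymm]
      simp [Matrix.IsSymm, Matrix.transpose_mul, hsymm, Matrix.mul_assoc]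
    · rw [Matrix.add_mulVec, Matrix.one_mulVec, dotProduct_add, ← Matrix.mulVec_mulVec,
        ← Matrix.mulVec_mulVec, Matrix.dotProduct_transpose_mulVec, dotProduct_comm _ (U *ᵥ x),
        add_mul, one_mul]
      exact add_le_add_right (h x) _
  rw [← add_assoc, Matrix.det_add_mul U Uᵀ hpos.det_pos.ne'.isUnit, mul_comm]
  exact mul_le_mul_of_nonneg_left hpow hpos.det_pos.le

variable {n p : ℕ} {X : Matrix (Fin n) (Fin p) ℝ} {γ₀ γ : Finset (Fin p)} {c : Fin p → ℝ}
  {φ ν : ℝ}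

lemma le_ridgeResidual_scaledDesign {r : ℝ} {z : Fin n → ℝ}
    (h : ∀ v : Fin p → ℝ, (∀ j ∉ γ, v j = 0) → r ≤ (z - X *ᵥ v) ⬝ᵥ (z - X *ᵥ v)) :
    r ≤ ridgeResidual (scaledDesign c X γ) z := by
  refine le_trans ?_ (dotProduct_sub_mulVec_ridgeEstimator_le _ z)
  rw [scaledDesign_mulVec]
  exact h _ fun j hj => by rw [Pi.mul_apply, priorScale, if_neg hj, zero_mul]

lemma residual_le_ridgeResidual_scaledDesign (hu : IsUnit ((colSub X γ)ᵀ * colSub X γ).det)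
    (c : Fin p → ℝ) (z : Fin n → ℝ) :
    z ⬝ᵥ (1 - projMat X γ) *ᵥ z ≤ ridgeResidual (scaledDesign c X γ) z :=
  le_ridgeResidual_scaledDesign fun v hv => by
    rw [mulVec_eq_colSub_mulVec X hv]
    exact residual_le_dotProduct_sub_mulVec hu z _

lemma ridgeResidual_scaledDesign_le (hφ : 0 < φ) (hc : ∀ j, φ ≤ c j) (z : Fin n → ℝ)
    {v : Fin p → ℝ} (hv : ∀ j ∉ γ, v j = 0) :
    ridgeResidual (scaledDesign c X γ) z ≤ (z - X *ᵥ v) ⬝ᵥ (z - X *ᵥ v) + (v ⬝ᵥ v) / φ := by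
  have hunscale : priorScale c γ * (fun j => v j / √(c j)) = v := by
    ext j
    by_cases hj : j ∈ γ
    · rw [Pi.mul_apply, priorScale, if_pos hj, mul_div_cancel₀]
      exact (Real.sqrt_pos.2 (hφ.trans_le (hc j))).ne'
    · rw [Pi.mul_apply, hv j hj, zero_div, mul_zero]
  have hle := ridgeResidual_le (scaledDesign c X γ) z fun j => v j / √(c j)
  rw [scaledDesign_mulVec, hunscale] at hle
  refine hle.trans (add_le_add_right ?_ _)
  rw [dotProduct, dotProduct, Finset.sum_div]
  refine Finset.sum_le_sum fun j _ => ?_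
  rw [div_mul_div_comm, Real.mul_self_sqrt (hφ.le.trans (hc j))]
  exact div_le_div_of_nonneg_left (mul_self_nonneg _) hφ (hc j)

lemma scaledDesign_mul_transpose_apply (c : Fin p → ℝ) (X : Matrix (Fin n) (Fin p) ℝ)
    (γ : Finset (Fin p)) (i l : Fin n) :
    (scaledDesign c X γ * (scaledDesign c X γ)ᵀ) i l =
      ∑ j ∈ γ, (X i j * √(c j)) * (X l j * √(c j)) := by
  rw [Matrix.mul_apply, ← Finset.sum_subset (Finset.subset_univ γ)]
  · refine Finset.sum_congr rfl fun j hj => ?_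
    simp only [Matrix.transpose_apply, scaledDesign, Matrix.mul_diagonal, priorScale, if_pos hj]
  · intro j _ hj
    simp only [scaledDesign, Matrix.mul_diagonal, priorScale, if_neg hj, mul_zero, zero_mul]

lemma scaledDesign_mul_transpose_eq_add (c : Fin p → ℝ) (X : Matrix (Fin n) (Fin p) ℝ)
    (hγ : γ₀ ⊆ γ) :
    scaledDesign c X γ * (scaledDesign c X γ)ᵀ =
      scaledDesign c X γ₀ * (scaledDesign c X γ₀)ᵀ +
        colSub (scaledDesign c X γ) (γ \ γ₀) * (colSub (scaledDesign c X γ) (γ \ γ₀))ᵀ := by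
  ext i l
  have hexcess : (colSub (scaledDesign c X γ) (γ \ γ₀) *
      (colSub (scaledDesign c X γ) (γ \ γ₀))ᵀ) i l =
      ∑ j ∈ γ \ γ₀, (X i j * √(c j)) * (X l j * √(c j)) := by
    rw [Matrix.mul_apply, ← Finset.sum_coe_sort (γ \ γ₀)]
    refine Finset.sum_congr rfl fun j _ => ?_
    simp only [Matrix.transpose_apply, colSub, Matrix.submatrix_apply, id, scaledDesign,
      Matrix.mul_diagonal, priorScale, if_pos (Finset.mem_sdiff.1 j.2).1]
  rw [Matrix.add_apply, hexcess, scaledDesign_mul_transpose_apply,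
    scaledDesign_mul_transpose_apply, add_comm, Finset.sum_sdiff hγ]

lemma modelScore_div_le (hν : 0 < ν) (y : Fin n → ℝ) {D R : ℝ}
    (hD : (1 + scaledDesign c X γ₀ * (scaledDesign c X γ₀)ᵀ).det /
      (1 + scaledDesign c X γ * (scaledDesign c X γ)ᵀ).det ≤ D)
    (hR : (1 + ridgeResidual (scaledDesign c X γ₀) y) /
      (1 + ridgeResidual (scaledDesign c X γ) y) ≤ R) :
    modelScore ν c X y γ / modelScore ν c X y γ₀ ≤ √D * R ^ (((n : ℝ) + ν) / 2) := by
  have hdet := (posDef_one_add_mul_transpose (scaledDesign c X γ₀)).det_pos.le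
  have hres := ridgeResidual_nonneg (scaledDesign c X γ) y
  have hres₀ := ridgeResidual_nonneg (scaledDesign c X γ₀) y
  rw [modelScore, modelScore, mul_div_mul_comm]
  refine mul_le_mul ?_ ?_ (by positivity) (Real.sqrt_nonneg _)
  · rw [inv_div_inv, ← Real.sqrt_div hdet]
    exact Real.sqrt_le_sqrt hD
  · rw [Real.rpow_neg (by linarith), Real.rpow_neg (by linarith), inv_div_inv,
      ← Real.div_rpow (by linarith) (by linarith)]
    exact Real.rpow_le_rpow (by positivity) hR (by positivity)

end RidgeBounds

section DesignBounds

variable {n p : ℕ}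

/-- Quadratic-form versions of the eigenvalue conditions on a design `X` with true model `γ₀`:
`a` bounds from below the part of a signal on `γ₀` that the other covariates cannot explain, `b`
bounds that signal from above, and `h` bounds from below the part of the contribution of the
covariates outside `γ₀` that `γ₀` cannot explain. -/
structure DesignBounds (X : Matrix (Fin n) (Fin p) ℝ) (γ₀ : Finset (Fin p)) (a b h : ℝ) :
    Prop where
  missing_pos : 0 < a
  signal_nonneg : 0 ≤ b
  excess_pos : 0 < h
  missing : ∀ (γ : Finset (Fin p)) (v : Fin p → ℝ), (∀ j ∉ γ₀ \ γ, v j = 0) →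
    a * (v ⬝ᵥ v) ≤ (X *ᵥ v) ⬝ᵥ (1 - projMat X γ) *ᵥ (X *ᵥ v)
  signal : ∀ v : Fin p → ℝ, (∀ j ∉ γ₀, v j = 0) → (X *ᵥ v) ⬝ᵥ (X *ᵥ v) ≤ b * (v ⬝ᵥ v)
  excess : ∀ v : Fin p → ℝ, (∀ j ∈ γ₀, v j = 0) →
    h * (v ⬝ᵥ v) ≤ (X *ᵥ v) ⬝ᵥ (1 - projMat X γ₀) *ᵥ (X *ᵥ v)

namespace DesignBounds

variable {X : Matrix (Fin n) (Fin p) ℝ} {γ₀ γ : Finset (Fin p)} {a b h : ℝ} {c : Fin p → ℝ}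
  {φ φ' ν : ℝ} {β v : Fin p → ℝ} {e : Fin n → ℝ}

lemma mul_dotProduct_self_le (hX : DesignBounds X γ₀ a b h) (hv : ∀ j ∉ γ₀, v j = 0) :
    a * (v ⬝ᵥ v) ≤ (X *ᵥ v) ⬝ᵥ (X *ᵥ v) :=
  (hX.missing ∅ v (by simpa using hv)).trans
    (dotProduct_mulVec_le_of_isStarProjection (isStarProjection_colProj _).one_sub _)

lemma eq_zero_of_mulVec_eq_zero_of_support (hX : DesignBounds X γ₀ a b h)
    (hv : ∀ j ∉ γ₀, v j = 0) (h₀ : X *ᵥ v = 0) : v = 0 := by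
  have hle := hX.mul_dotProduct_self_le hv
  rw [h₀, dotProduct_zero] at hle
  exact dotProduct_self_eq_zero.1 ((nonpos_of_mul_nonpos_right hle hX.missing_pos).antisymm
    (dotProduct_self_nonneg v))

lemma isUnit_det_true (hX : DesignBounds X γ₀ a b h) :
    IsUnit ((colSub X γ₀)ᵀ * colSub X γ₀).det :=
  isUnit_det_transpose_mul_self_colSub fun _ hv => hX.eq_zero_of_mulVec_eq_zero_of_support hv

lemma eq_zero_of_mulVec_eq_zero (hX : DesignBounds X γ₀ a b h) (h₀ : X *ᵥ v = 0) : v = 0 := by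
  set v₁ := (γ₀ : Set (Fin p)).indicator v
  set v₂ := (γ₀ : Set (Fin p))ᶜ.indicator v
  have hsum : v₂ + v₁ = v := Set.indicator_compl_add_self _ _
  have hsupp₁ : ∀ j ∉ γ₀, v₁ j = 0 := fun j hj => Set.indicator_of_notMem (by simpa using hj) v
  have hsupp₂ : ∀ j ∈ γ₀, v₂ j = 0 := fun j hj => Set.indicator_of_notMem (by simpa using hj) v
  have hXv₂ : X *ᵥ v₂ = 0 - colSub X γ₀ *ᵥ fun j => v₁ j := by
    rw [← mulVec_eq_colSub_mulVec X hsupp₁, eq_sub_iff_add_eq, ← Matrix.mulVec_add, hsum, h₀]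
  have hzero₂ : v₂ = 0 := by
    have hle := hX.excess v₂ hsupp₂
    rw [hXv₂, projMat_eq_colProj, residual_sub_mulVec hX.isUnit_det_true, zero_dotProduct] at hle
    exact dotProduct_self_eq_zero.1 ((nonpos_of_mul_nonpos_right hle hX.excess_pos).antisymm
      (dotProduct_self_nonneg v₂))
  rw [hzero₂, zero_add] at hsum
  exact hX.eq_zero_of_mulVec_eq_zero_of_support (hsum ▸ hsupp₁) h₀

lemma isUnit_det (hX : DesignBounds X γ₀ a b h) : IsUnit (Xᵀ * X).det :=
  isUnit_det_transpose_mul_self fun _ => hX.eq_zero_of_mulVec_eq_zero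

lemma isUnit_det_colSub (hX : DesignBounds X γ₀ a b h) (γ : Finset (Fin p)) :
    IsUnit ((colSub X γ)ᵀ * colSub X γ).det :=
  isUnit_det_transpose_mul_self_colSub fun _ _ => hX.eq_zero_of_mulVec_eq_zero

/-! #### Models that miss a true covariate -/

lemma mul_sq_le_dotProduct_self_mulVec_sub (hX : DesignBounds X γ₀ a b h)
    (hβ : ∀ j ∉ γ₀, β j = 0) {ψ : ℝ} (hψ₀ : 0 ≤ ψ) (hψ : ∀ j ∈ γ₀, ψ ≤ |β j|) (hγ : ¬ γ₀ ⊆ γ)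
    (hv : ∀ j ∉ γ, v j = 0) : a * ψ ^ 2 ≤ (X *ᵥ (β - v)) ⬝ᵥ (X *ᵥ (β - v)) := by
  set w := ((γ₀ \ γ : Finset (Fin p)) : Set (Fin p)).indicator β with hw
  have hwv : ∀ j ∉ γ, (w - (β - v)) j = 0 := by
    intro j hj
    by_cases hj₀ : j ∈ γ₀
    · simp [hw, hj, hj₀, hv j hj]
    · simp [hw, hj₀, hv j hj, hβ j hj₀]
  have hdecomp : X *ᵥ (β - v) = X *ᵥ w - colSub X γ *ᵥ fun j => (w - (β - v)) j := by
    rw [← mulVec_eq_colSub_mulVec X hwv, ← Matrix.mulVec_sub, sub_sub_cancel]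
  obtain ⟨j, hj₀, hj⟩ := Finset.not_subset.1 hγ
  have hψw : ψ ^ 2 ≤ w ⬝ᵥ w := calc
    ψ ^ 2 ≤ w j * w j := by
      have hwj : w j = β j := Set.indicator_of_mem (by simp [hj₀, hj]) β
      rw [hwj, ← abs_mul_abs_self, sq]
      exact mul_self_le_mul_self hψ₀ (hψ j hj₀)
    _ ≤ w ⬝ᵥ w := Finset.single_le_sum (f := fun i => w i * w i)
      (fun i _ => mul_self_nonneg _) (Finset.mem_univ j)
  calc a * ψ ^ 2 ≤ a * (w ⬝ᵥ w) := mul_le_mul_of_nonneg_left hψw hX.missing_pos.le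
    _ ≤ (X *ᵥ w) ⬝ᵥ (1 - projMat X γ) *ᵥ (X *ᵥ w) :=
      hX.missing γ w fun j hj => Set.indicator_of_notMem (by simpa using hj) β
    _ ≤ _ := by
      rw [hdecomp]
      exact residual_le_dotProduct_sub_mulVec (hX.isUnit_det_colSub γ) _ _

lemma le_ridgeResidual_of_not_subset (hX : DesignBounds X γ₀ a b h) (c : Fin p → ℝ)
    (hβ : ∀ j ∉ γ₀, β j = 0) {ψ : ℝ} (hψ₀ : 0 ≤ ψ) (hψ : ∀ j ∈ γ₀, ψ ≤ |β j|) (e : Fin n → ℝ)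
    (hγ : ¬ γ₀ ⊆ γ) :
    e ⬝ᵥ e - 2 * (e ⬝ᵥ colProj X *ᵥ e) + a * ψ ^ 2 / 2 ≤
      ridgeResidual (scaledDesign c X γ) (X *ᵥ β + e) := by
  refine le_ridgeResidual_scaledDesign fun v hv => ?_
  have hres : X *ᵥ β + e - X *ᵥ v = e + X *ᵥ (β - v) := by
    rw [Matrix.mulVec_sub]
    abel
  have hsignal := hX.mul_sq_le_dotProduct_self_mulVec_sub hβ hψ₀ hψ hγ hv
  have hnoise := dotProduct_self_add_mulVec_ge hX.isUnit_det e (β - v)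
  rw [hres]
  linarith

lemma det_true_le (hX : DesignBounds X γ₀ a b h) (hc₀ : ∀ j, 0 ≤ c j) (hc : ∀ j, c j ≤ φ) :
    (1 + scaledDesign c X γ₀ * (scaledDesign c X γ₀)ᵀ).det ≤ (1 + b * φ) ^ p := by
  set W := scaledDesign c X γ₀ with hW
  have hpos : (1 + Wᵀ * W).PosDef := by simpa using posDef_one_add_mul_transpose Wᵀ
  have hscale : ∀ x, (priorScale c γ₀ * x) ⬝ᵥ (priorScale c γ₀ * x) ≤ φ * (x ⬝ᵥ x) := by
    intro x
    rw [dotProduct, dotProduct, Finset.mul_sum]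
    refine Finset.sum_le_sum fun j _ => ?_
    rw [Pi.mul_apply, mul_mul_mul_comm]
    refine mul_le_mul_of_nonneg_right ?_ (mul_self_nonneg _)
    rw [priorScale]
    split_ifs
    · rw [Real.mul_self_sqrt (hc₀ j)]
      exact hc j
    · rw [mul_zero]
      exact (hc₀ j).trans (hc j)
  rw [Matrix.det_one_add_mul_comm]
  refine (det_le_pow_card hpos.posSemidef (a := 1 + b * φ) fun x => ?_).trans_eq
    (by rw [Fintype.card_fin])
  rw [Matrix.add_mulVec, Matrix.one_mulVec, dotProduct_add, dotProduct_transpose_mul_self_mulVec,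
    add_mul, one_mul, hW, scaledDesign_mulVec, mul_assoc]
  refine add_le_add_right ((hX.signal _ fun j hj => ?_).trans
    (mul_le_mul_of_nonneg_left (hscale x) hX.signal_nonneg)) _
  rw [Pi.mul_apply, priorScale, if_neg hj, zero_mul]

lemma modelScore_div_le_of_not_subset (hX : DesignBounds X γ₀ a b h) (hν : 0 < ν) (hφ : 0 < φ)
    (hc : ∀ j, φ ≤ c j) (hc' : ∀ j, c j ≤ φ') (hβ : ∀ j ∉ γ₀, β j = 0) {ψ : ℝ} (hψ₀ : 0 ≤ ψ)
    (hψ : ∀ j ∈ γ₀, ψ ≤ |β j|) (hγ : ¬ γ₀ ⊆ γ)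
    (hpos : 0 < 1 + (e ⬝ᵥ e - 2 * (e ⬝ᵥ colProj X *ᵥ e) + a * ψ ^ 2 / 2)) :
    modelScore ν c X (X *ᵥ β + e) γ / modelScore ν c X (X *ᵥ β + e) γ₀ ≤
      √((1 + b * φ') ^ p) *
        ((1 + (e ⬝ᵥ e + (β ⬝ᵥ β) / φ)) /
          (1 + (e ⬝ᵥ e - 2 * (e ⬝ᵥ colProj X *ᵥ e) + a * ψ ^ 2 / 2))) ^ (((n : ℝ) + ν) / 2) := by
  refine modelScore_div_le hν _ ?_ ?_
  · have hdet := (posDef_one_add_mul_transpose (scaledDesign c X γ₀)).det_pos.le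
    exact (div_le_self hdet (one_le_det_one_add_mul_transpose _)).trans
      (hX.det_true_le (fun j => hφ.le.trans (hc j)) hc')
  · have hupper := ridgeResidual_scaledDesign_le (X := X) hφ hc (X *ᵥ β + e) hβ
    rw [add_sub_cancel_left] at hupper
    have hlower := hX.le_ridgeResidual_of_not_subset c hβ hψ₀ hψ e hγ
    have hnonneg := ridgeResidual_nonneg (scaledDesign c X γ₀) (X *ᵥ β + e)
    exact div_le_div₀ (by linarith) (by linarith) hpos (by linarith)

end DesignBounds

/-! #### Models that strictly contain the true one -/

/-- The columns of `η` projected to the orthogonal complement of those of `γ₀`. -/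
noncomputable def excessDesign (X : Matrix (Fin n) (Fin p) ℝ) (γ₀ η : Finset (Fin p)) :
    Matrix (Fin n) {j // j ∈ η} ℝ :=
  (1 - projMat X γ₀) * colSub X η

lemma colProj_excessDesign_mul_one_sub_projMat (X : Matrix (Fin n) (Fin p) ℝ)
    (γ₀ η : Finset (Fin p)) :
    colProj (excessDesign X γ₀ η) * (1 - projMat X γ₀) = colProj (excessDesign X γ₀ η) := by
  have hproj : (excessDesign X γ₀ η)ᵀ * (1 - projMat X γ₀) = (excessDesign X γ₀ η)ᵀ := by
    rw [excessDesign, projMat_eq_colProj, Matrix.transpose_mul, Matrix.transpose_sub,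
      Matrix.transpose_one, transpose_colProj, Matrix.mul_assoc,
      (isStarProjection_colProj (colSub X γ₀)).one_sub.isIdempotentElem]
  rw [colProj, Matrix.mul_assoc, hproj]

namespace DesignBounds

variable {X : Matrix (Fin n) (Fin p) ℝ} {γ₀ γ : Finset (Fin p)} {a b h : ℝ} {c : Fin p → ℝ}
  {φ ν : ℝ} {β u : Fin p → ℝ} {e : Fin n → ℝ}

lemma isUnit_det_excessDesign (hX : DesignBounds X γ₀ a b h) {η : Finset (Fin p)}
    (hη : Disjoint γ₀ η) :
    IsUnit ((excessDesign X γ₀ η)ᵀ * excessDesign X γ₀ η).det := by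
  refine isUnit_det_transpose_mul_self fun d hd => ?_
  have hsupp : ∀ j ∉ η, Function.extend Subtype.val d 0 j = 0 := fun j hj =>
    Function.extend_apply' _ _ _ (by simpa using hj)
  have hle := hX.excess _ fun j hj => hsupp j (Finset.disjoint_left.1 hη hj)
  rw [dotProduct_self_eq_restrict hsupp, ← colSub_mulVec, Matrix.mulVec_mulVec, ← excessDesign, hd,
    dotProduct_zero] at hle
  have hext : (fun j : {j // j ∈ η} => Function.extend Subtype.val d 0 j) = d :=
    Function.extend_comp Subtype.val_injective d 0
  rw [hext] at hle
  exact dotProduct_self_eq_zero.1 ((nonpos_of_mul_nonpos_right hle hX.excess_pos).antisymm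
    (dotProduct_self_nonneg d))

lemma residual_sub_excess_le (hX : DesignBounds X γ₀ a b h) (hu : ∀ j ∉ γ, j ∉ γ₀ → u j = 0)
    (e : Fin n → ℝ) :
    e ⬝ᵥ (1 - projMat X γ₀) *ᵥ e - e ⬝ᵥ colProj (excessDesign X γ₀ (γ \ γ₀)) *ᵥ e ≤
      (e - X *ᵥ u) ⬝ᵥ (e - X *ᵥ u) := by
  set G := excessDesign X γ₀ (γ \ γ₀) with hG
  set u₀ := (γ₀ : Set (Fin p)).indicator u with hu₀
  have hsupp₀ : ∀ j ∉ γ₀, u₀ j = 0 := fun j hj => Set.indicator_of_notMem (by simpa using hj) u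
  have hsupp₁ : ∀ j ∉ γ \ γ₀, (u - u₀) j = 0 := by
    intro j hj
    by_cases hj₀ : j ∈ γ₀
    · simp [hu₀, hj₀]
    · have hjγ : j ∉ γ := fun hmem => hj (Finset.mem_sdiff.2 ⟨hmem, hj₀⟩)
      simp [hu₀, hj₀, hu j hjγ hj₀]
  have hsplit : e - X *ᵥ u = (e - X *ᵥ (u - u₀)) - colSub X γ₀ *ᵥ fun j => u₀ j := by
    rw [← mulVec_eq_colSub_mulVec X hsupp₀, sub_sub, ← Matrix.mulVec_add, sub_add_cancel]
  have hP₀ : IsStarProjection (1 - projMat X γ₀) := (isStarProjection_colProj _).one_sub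
  have hPG := isStarProjection_colProj G
  have hproj : (1 - projMat X γ₀) *ᵥ (e - X *ᵥ (u - u₀)) =
      (1 - projMat X γ₀) *ᵥ e - G *ᵥ fun j => (u - u₀) j := by
    rw [Matrix.mulVec_sub _ e, mulVec_eq_colSub_mulVec X hsupp₁, Matrix.mulVec_mulVec, hG,
      excessDesign]
  have hGe : colProj G *ᵥ ((1 - projMat X γ₀) *ᵥ e) = colProj G *ᵥ e := by
    rw [Matrix.mulVec_mulVec, hG, colProj_excessDesign_mul_one_sub_projMat]
  calc e ⬝ᵥ (1 - projMat X γ₀) *ᵥ e - e ⬝ᵥ colProj G *ᵥ e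
      = ((1 - projMat X γ₀) *ᵥ e) ⬝ᵥ (1 - colProj G) *ᵥ ((1 - projMat X γ₀) *ᵥ e) := by
        rw [dotProduct_one_sub_mulVec (colProj G),
          dotProduct_mulVec_of_isStarProjection hPG (_ *ᵥ e), hGe,
          ← dotProduct_mulVec_of_isStarProjection hPG, dotProduct_mulVec_of_isStarProjection hP₀]
    _ ≤ (e - X *ᵥ (u - u₀)) ⬝ᵥ (1 - projMat X γ₀) *ᵥ (e - X *ᵥ (u - u₀)) := by
        rw [dotProduct_mulVec_of_isStarProjection hP₀ (e - _), hproj]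
        exact residual_le_dotProduct_sub_mulVec
          (hX.isUnit_det_excessDesign Finset.disjoint_sdiff) _ _
    _ ≤ _ := by
        rw [hsplit]
        exact residual_le_dotProduct_sub_mulVec hX.isUnit_det_true _ _

lemma residual_sub_excess_le_ridgeResidual (hX : DesignBounds X γ₀ a b h) (c : Fin p → ℝ)
    (hβ : ∀ j ∉ γ₀, β j = 0) (e : Fin n → ℝ) (γ : Finset (Fin p)) :
    e ⬝ᵥ (1 - projMat X γ₀) *ᵥ e - e ⬝ᵥ colProj (excessDesign X γ₀ (γ \ γ₀)) *ᵥ e ≤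
      ridgeResidual (scaledDesign c X γ) (X *ᵥ β + e) := by
  refine le_ridgeResidual_scaledDesign fun v hv => ?_
  have hres : X *ᵥ β + e - X *ᵥ v = e - X *ᵥ (v - β) := by
    rw [Matrix.mulVec_sub]
    abel
  rw [hres]
  exact hX.residual_sub_excess_le
    (fun j hj hj₀ => by rw [Pi.sub_apply, hv j hj, hβ j hj₀, sub_zero]) e

lemma residual_le_ridgeResidual (hX : DesignBounds X γ₀ a b h) (c : Fin p → ℝ) (β : Fin p → ℝ)
    (e : Fin n → ℝ) (γ : Finset (Fin p)) :
    e ⬝ᵥ e - e ⬝ᵥ colProj X *ᵥ e ≤ ridgeResidual (scaledDesign c X γ) (X *ᵥ β + e) := by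
  refine le_ridgeResidual_scaledDesign fun v _ => ?_
  have hres : X *ᵥ β + e - X *ᵥ v = e - X *ᵥ (v - β) := by
    rw [Matrix.mulVec_sub]
    abel
  rw [hres, ← dotProduct_one_sub_mulVec]
  exact residual_le_dotProduct_sub_mulVec hX.isUnit_det e _

lemma ridgeResidual_true_le (hX : DesignBounds X γ₀ a b h) (hφ : 0 < φ) (hc : ∀ j, φ ≤ c j)
    (hβ : ∀ j ∉ γ₀, β j = 0) (e : Fin n → ℝ) :
    ridgeResidual (scaledDesign c X γ₀) (X *ᵥ β + e) ≤ e ⬝ᵥ (1 - projMat X γ₀) *ᵥ e +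
      2 * (β ⬝ᵥ β + (e ⬝ᵥ colProj X *ᵥ e) / a) / φ := by
  obtain ⟨d, hd, hXd⟩ : ∃ d : Fin p → ℝ, (∀ j ∉ γ₀, d j = 0) ∧ X *ᵥ d = projMat X γ₀ *ᵥ e := by
    refine ⟨Function.extend Subtype.val
      ((((colSub X γ₀)ᵀ * colSub X γ₀)⁻¹ * (colSub X γ₀)ᵀ) *ᵥ e) 0,
      fun j hj => Function.extend_apply' _ _ _ (by simpa using hj), ?_⟩
    rw [← colSub_mulVec, Matrix.mulVec_mulVec, projMat, Matrix.mul_assoc]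
  have hP₀ := isStarProjection_colProj (colSub X γ₀)
  have hd_le : d ⬝ᵥ d ≤ (e ⬝ᵥ colProj X *ᵥ e) / a := by
    have hcols : colSub X γ₀ = X * (1 : Matrix (Fin p) (Fin p) ℝ).submatrix id Subtype.val := by
      simpa [colSub] using Matrix.submatrix_mul X (1 : Matrix (Fin p) (Fin p) ℝ) id id Subtype.val
        Function.bijective_id
    rw [le_div_iff₀ hX.missing_pos, mul_comm]
    calc a * (d ⬝ᵥ d) ≤ (X *ᵥ d) ⬝ᵥ (X *ᵥ d) := hX.mul_dotProduct_self_le hd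
      _ = e ⬝ᵥ colProj (colSub X γ₀) *ᵥ e := by
        rw [hXd, projMat_eq_colProj, ← dotProduct_mulVec_of_isStarProjection hP₀]
      _ ≤ e ⬝ᵥ colProj X *ᵥ e := by
        rw [hcols]
        exact dotProduct_colProj_mul_mulVec_le hX.isUnit_det _ e
  have hres : X *ᵥ β + e - X *ᵥ (β + d) = (1 - projMat X γ₀) *ᵥ e := by
    rw [Matrix.mulVec_add, hXd, Matrix.sub_mulVec, Matrix.one_mulVec]
    abel
  have hle := ridgeResidual_scaledDesign_le (X := X) hφ hc (X *ᵥ β + e) (v := β + d)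
    fun j hj => by rw [Pi.add_apply, hβ j hj, hd j hj, add_zero]
  rw [hres, projMat_eq_colProj, ← dotProduct_mulVec_of_isStarProjection hP₀.one_sub] at hle
  refine hle.trans (add_le_add_right (div_le_div_of_nonneg_right ?_ hφ.le) _)
  exact (dotProduct_self_add_le β d).trans (by linarith)

lemma mul_dotProduct_self_le_ridgeResidual_true (hX : DesignBounds X γ₀ a b h) (hφ : 0 < φ)
    (hc : ∀ j, φ ≤ c j) (x : {j // j ∈ γ \ γ₀} → ℝ) :
    h * φ * (x ⬝ᵥ x) ≤
      ridgeResidual (scaledDesign c X γ₀) (colSub (scaledDesign c X γ) (γ \ γ₀) *ᵥ x) := by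
  set w := Function.extend Subtype.val x 0 with hw
  have hsupp : ∀ j ∉ γ \ γ₀, w j = 0 := fun j hj =>
    Function.extend_apply' _ _ _ (by simpa using hj)
  have hx : x ⬝ᵥ x = w ⬝ᵥ w := by
    rw [dotProduct_self_eq_restrict hsupp]
    exact congrArg (fun y => y ⬝ᵥ y) (Function.extend_comp Subtype.val_injective x 0).symm
  have hscale : φ * (w ⬝ᵥ w) ≤ (priorScale c γ * w) ⬝ᵥ (priorScale c γ * w) := by
    rw [dotProduct, dotProduct, Finset.mul_sum]
    refine Finset.sum_le_sum fun j _ => ?_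
    by_cases hj : j ∈ γ \ γ₀
    · rw [Pi.mul_apply, mul_mul_mul_comm, priorScale, if_pos (Finset.mem_sdiff.1 hj).1,
        Real.mul_self_sqrt (hφ.le.trans (hc j))]
      exact mul_le_mul_of_nonneg_right (hc j) (mul_self_nonneg _)
    · simp [hsupp j hj]
  rw [hx, colSub_mulVec, ← hw, scaledDesign_mulVec, mul_assoc]
  refine (mul_le_mul_of_nonneg_left hscale hX.excess_pos.le).trans
    ((hX.excess _ fun j hj => ?_).trans
      (residual_le_ridgeResidual_scaledDesign hX.isUnit_det_true c _))
  rw [Pi.mul_apply, hsupp j fun hmem => (Finset.mem_sdiff.1 hmem).2 hj, mul_zero]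

lemma det_div_det_le (hX : DesignBounds X γ₀ a b h) (hφ : 0 < φ) (hc : ∀ j, φ ≤ c j)
    (hγ : γ₀ ⊆ γ) :
    (1 + scaledDesign c X γ₀ * (scaledDesign c X γ₀)ᵀ).det /
      (1 + scaledDesign c X γ * (scaledDesign c X γ)ᵀ).det ≤ ((1 + h * φ) ^ (γ \ γ₀).card)⁻¹ := by
  have hhφ : 0 < h * φ := mul_pos hX.excess_pos hφ
  have hdet := one_add_pow_card_mul_det_le _ _ hhφ.le
    (hX.mul_dotProduct_self_le_ridgeResidual_true (γ := γ) hφ hc)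
  rw [← scaledDesign_mul_transpose_eq_add c X hγ, Fintype.card_coe] at hdet
  rw [div_le_iff₀ (posDef_one_add_mul_transpose _).det_pos, inv_mul_eq_div,
    le_div_iff₀ (pow_pos (by linarith) _), mul_comm]
  exact hdet

lemma modelScore_div_le_of_subset (hX : DesignBounds X γ₀ a b h) (hν : 0 < ν) (hφ : 0 < φ)
    (hc : ∀ j, φ ≤ c j) (hβ : ∀ j ∉ γ₀, β j = 0) {L Q : ℝ} (hL : 0 < L)
    (hLe : L ≤ e ⬝ᵥ e - e ⬝ᵥ colProj X *ᵥ e) (hγ : γ₀ ⊆ γ)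
    (hQ : e ⬝ᵥ colProj (excessDesign X γ₀ (γ \ γ₀)) *ᵥ e +
      2 * (β ⬝ᵥ β + (e ⬝ᵥ colProj X *ᵥ e) / a) / φ ≤ Q) :
    modelScore ν c X (X *ᵥ β + e) γ / modelScore ν c X (X *ᵥ β + e) γ₀ ≤
      √(((1 + h * φ) ^ (γ \ γ₀).card)⁻¹) * Real.exp (((n : ℝ) + ν) / 2 * (Q / L)) := by
  rw [mul_comm (((n : ℝ) + ν) / 2), Real.exp_mul]
  refine modelScore_div_le hν _ (hX.det_div_det_le hφ hc hγ) ?_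
  have hlower := hLe.trans (hX.residual_le_ridgeResidual c β e γ)
  have hexcess := hX.residual_sub_excess_le_ridgeResidual c hβ e γ
  have htrue := hX.ridgeResidual_true_le hφ hc hβ e
  set q := ridgeResidual (scaledDesign c X γ) (X *ᵥ β + e)
  set q₀ := ridgeResidual (scaledDesign c X γ₀) (X *ᵥ β + e)
  have hQ₀ : 0 ≤ Q := by
    have ha := hX.missing_pos
    have := dotProduct_self_nonneg β
    have := dotProduct_mulVec_nonneg_of_isStarProjection (isStarProjection_colProj X) e
    exact (add_nonneg (dotProduct_mulVec_nonneg_of_isStarProjection (isStarProjection_colProj _) e)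
      (by positivity)).trans hQ
  have hq : L ≤ 1 + q := by linarith
  calc (1 + q₀) / (1 + q) ≤ (Q + (1 + q)) / (1 + q) :=
        div_le_div_of_nonneg_right (by linarith) (hL.le.trans hq)
    _ = Q / (1 + q) + 1 := by rw [add_div, div_self (hL.trans_le hq).ne']
    _ ≤ Q / L + 1 := add_le_add_left (div_le_div_of_nonneg_left hQ₀ hL hq) _
    _ ≤ Real.exp (Q / L) := Real.add_one_le_exp _

end DesignBounds

end DesignBounds

/-! ### Random matrices -/

section EntryMeasurable

variable {α l m k : Type*} [MeasurableSpace α]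

/-- A matrix-valued map all of whose entries are measurable (`Matrix` carries no measurable space
structure). -/
def EntryMeasurable (M : α → Matrix l m ℝ) : Prop :=
  ∀ i j, Measurable fun a => M a i j

namespace EntryMeasurable

lemma const (M : Matrix l m ℝ) : EntryMeasurable fun _ : α => M := fun _ _ => measurable_const

lemma transpose {M : α → Matrix l m ℝ} (hM : EntryMeasurable M) :
    EntryMeasurable fun a => (M a)ᵀ := fun i j => hM j i

lemma neg {M : α → Matrix l m ℝ} (hM : EntryMeasurable M) : EntryMeasurable fun a => -M a :=
  fun i j => (hM i j).neg

lemma submatrix {l' m' : Type*} {M : α → Matrix l m ℝ} (hM : EntryMeasurable M) (f : l' → l)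
    (g : m' → m) : EntryMeasurable fun a => (M a).submatrix f g := fun i j => hM (f i) (g j)

lemma mul [Fintype m] {M : α → Matrix l m ℝ} {N : α → Matrix m k ℝ} (hM : EntryMeasurable M)
    (hN : EntryMeasurable N) : EntryMeasurable fun a => M a * N a := fun i j => by
  simp only [Matrix.mul_apply]
  exact Finset.measurable_sum _ fun x _ => (hM i x).mul (hN x j)

lemma dotProduct_mulVec [Fintype m] {M : α → Matrix m m ℝ} (hM : EntryMeasurable M) {v : α → m → ℝ}
    (hv : Measurable v) : Measurable fun a => v a ⬝ᵥ M a *ᵥ v a := by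
  have hentry : ∀ i, Measurable fun a => v a i := fun i => (measurable_pi_apply i).comp hv
  exact Finset.measurable_sum _ fun i _ => (hentry i).mul
    (Finset.measurable_sum _ fun j _ => (hM i j).mul (hentry j))

lemma measurable_entries {M : α → Matrix l m ℝ} (hM : EntryMeasurable M) :
    Measurable fun a i j => M a i j :=
  measurable_pi_lambda _ fun i => measurable_pi_lambda _ fun j => hM i j

variable [DecidableEq m] {M : α → Matrix m m ℝ}

lemma one_sub (hM : EntryMeasurable M) : EntryMeasurable fun a => 1 - M a := fun i j => by
  simp only [Matrix.sub_apply]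
  exact measurable_const.sub (hM i j)

lemma measurable_det [Fintype m] (hM : EntryMeasurable M) : Measurable fun a => (M a).det := by
  simp only [Matrix.det_apply']
  exact Finset.measurable_sum _ fun σ _ =>
    (Finset.measurable_prod _ fun i _ => hM _ _).const_mul _

lemma inv [Fintype m] (hM : EntryMeasurable M) : EntryMeasurable fun a => (M a)⁻¹ := fun i j => by
  simp only [Matrix.inv_def, Matrix.smul_apply, Ring.inverse_eq_inv', smul_eq_mul,
    Matrix.adjugate_apply]
  refine hM.measurable_det.inv.mul (measurable_det fun x z => ?_)
  simp only [Matrix.updateRow_apply]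
  split_ifs
  · exact measurable_const
  · exact hM x z

lemma colProj [Fintype l] [Fintype m] {M : α → Matrix l m ℝ} (hM : EntryMeasurable M) :
    EntryMeasurable fun a => colProj (M a) :=
  (hM.mul (hM.transpose.mul hM).inv).mul hM.transpose

lemma colSub {n p : ℕ} {M : α → Matrix (Fin n) (Fin p) ℝ} (hM : EntryMeasurable M)
    (γ : Finset (Fin p)) : EntryMeasurable fun a => colSub (M a) γ :=
  hM.submatrix id Subtype.val

lemma excessDesign {n p : ℕ} {M : α → Matrix (Fin n) (Fin p) ℝ}
    (hM : EntryMeasurable M) (γ₀ η : Finset (Fin p)) :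
    EntryMeasurable fun a => excessDesign (M a) γ₀ η :=
  (hM.colSub γ₀).colProj.one_sub.mul (hM.colSub η)

end EntryMeasurable

lemma measurableSet_forall_mul_dotProduct_self_le [Fintype m] {M : α → Matrix m m ℝ}
    (hM : EntryMeasurable M) (S : Set (m → ℝ)) (a : ℝ) :
    MeasurableSet {x | ∀ v ∈ S, a * (v ⬝ᵥ v) ≤ v ⬝ᵥ M x *ᵥ v} := by
  have hclosed : IsClosed {A : m → m → ℝ | ∀ v ∈ S, a * (v ⬝ᵥ v) ≤ v ⬝ᵥ Matrix.of A *ᵥ v} := by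
    simp only [Set.ofPred_forall]
    refine isClosed_iInter fun v => isClosed_iInter fun _ => isClosed_le continuous_const ?_
    simp only [dotProduct, Matrix.mulVec, Matrix.of_apply]
    fun_prop
  exact hM.measurable_entries hclosed.measurableSet

end EntryMeasurable

section GaussianTail

variable {m ι : Type*} [Fintype m] [Fintype ι] [DecidableEq ι]

lemma det_one_sub_smul_colProj [DecidableEq m] {W : Matrix m ι ℝ} (hW : IsUnit (Wᵀ * W).det)
    (r : ℝ) :
    (1 - r • colProj W).det = (1 - r) ^ Fintype.card ι := by
  have hsmul : r • colProj W = (r • W) * ((Wᵀ * W)⁻¹ * Wᵀ) := by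
    rw [colProj, Matrix.smul_mul, Matrix.mul_assoc]
  have hone : (1 : Matrix ι ι ℝ) - r • (1 : Matrix ι ι ℝ) = (1 - r) • (1 : Matrix ι ι ℝ) := by
    rw [sub_smul, one_smul]
  rw [hsmul, Matrix.det_one_sub_mul_comm, Matrix.mul_smul, Matrix.mul_assoc,
    Matrix.nonsing_inv_mul _ hW, hone, Matrix.det_smul, Matrix.det_one, mul_one]

lemma posDef_one_sub_smul_colProj [DecidableEq m] (W : Matrix m ι ℝ) {r : ℝ} (hr : r < 1) :
    (1 - r • colProj W).PosDef := by
  have hsymm : (1 - r • colProj W).IsHermitian := by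
    rw [Matrix.isHermitian_iff_isSymm]
    simp [Matrix.IsSymm, transpose_colProj]
  refine Matrix.PosDef.of_dotProduct_mulVec_pos hsymm fun x hx => ?_
  rw [star_trivial, dotProduct_one_sub_mulVec, Matrix.smul_mulVec, dotProduct_smul, smul_eq_mul]
  have hpos : 0 < x ⬝ᵥ x :=
    (dotProduct_self_nonneg x).lt_of_ne fun h => hx (dotProduct_self_eq_zero.1 h.symm)
  have hP := isStarProjection_colProj W
  have hle := dotProduct_mulVec_le_of_isStarProjection hP x
  have hnonneg := dotProduct_mulVec_nonneg_of_isStarProjection hP x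
  rcases le_or_gt r 0 with hr₀ | hr₀ <;> nlinarith

lemma sqrt_pow_eq {x : ℝ} (hx : 0 ≤ x) (k : ℕ) : √(x ^ k) = √x ^ k := by
  rw [Real.sqrt_eq_iff_mul_self_eq (by positivity) (by positivity), ← mul_pow,
    Real.mul_self_sqrt hx]

lemma mgf_dotProduct_colProj_mulVec {W : Matrix m ι ℝ} (hW : IsUnit (Wᵀ * W).det) {t : ℝ}
    (ht : t < 1 / 2) :
    mgf (fun z => z ⬝ᵥ colProj W *ᵥ z) (stdGaussianPi m) t =
      (√(1 - 2 * t))⁻¹ ^ Fintype.card ι := by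
  classical
  have hgauss := integral_stdGaussianPi_exp_quadratic
    (posDef_one_sub_smul_colProj W (r := 2 * t) (by linarith)) 0
  rw [det_one_sub_smul_colProj hW] at hgauss
  rw [inv_pow, ← sqrt_pow_eq (by linarith : (0 : ℝ) ≤ 1 - 2 * t), ← hgauss, mgf]
  refine integral_congr_ae (Eventually.of_forall fun z => ?_)
  simp only [sub_zero, dotProduct_one_sub_mulVec, Matrix.smul_mulVec, dotProduct_smul, smul_eq_mul]
  congr 1
  ring

lemma integrable_exp_mul_dotProduct_colProj_mulVec {W : Matrix m ι ℝ} (hW : IsUnit (Wᵀ * W).det)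
    {t : ℝ} (ht : t < 1 / 2) :
    Integrable (fun z => Real.exp (t * (z ⬝ᵥ colProj W *ᵥ z))) (stdGaussianPi m) := by
  refine not_imp_comm.1 integral_undef (ne_of_gt ?_)
  change 0 < mgf (fun z => z ⬝ᵥ colProj W *ᵥ z) (stdGaussianPi m) t
  rw [mgf_dotProduct_colProj_mulVec hW ht]
  have : 0 < 1 - 2 * t := by linarith
  positivity

lemma measureReal_le_dotProduct_colProj_mulVec [Nonempty ι] (W : Matrix m ι ℝ) {t s : ℝ}
    (ht₀ : 0 ≤ t) (ht : t < 1 / 2) (hs : 0 < s) :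
    (stdGaussianPi m).real {z | Fintype.card ι * s ≤ z ⬝ᵥ colProj W *ᵥ z} ≤
      (Real.exp (-t * s) * (√(1 - 2 * t))⁻¹) ^ Fintype.card ι := by
  by_cases hW : IsUnit (Wᵀ * W).det
  · refine (measure_ge_le_exp_mul_mgf _ ht₀
      (integrable_exp_mul_dotProduct_colProj_mulVec hW ht)).trans_eq ?_
    rw [mgf_dotProduct_colProj_mulVec hW ht, mul_pow, ← Real.exp_nat_mul]
    congr 2
    ring
  · have hempty : {z : m → ℝ | Fintype.card ι * s ≤ z ⬝ᵥ colProj W *ᵥ z} = ∅ := by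
      ext z
      have : 0 < (Fintype.card ι : ℝ) * s := mul_pos (by exact_mod_cast Fintype.card_pos) hs
      simp [colProj, Matrix.nonsing_inv_apply_not_isUnit _ hW, this]
    rw [hempty, measureReal_empty]
    positivity

lemma colProj_one : colProj (1 : Matrix ι ι ℝ) = 1 := by simp [colProj]

lemma measureReal_dotProduct_self_le {t : ℝ} (ht : 0 ≤ t) (s : ℝ) :
    (stdGaussianPi m).real {z | z ⬝ᵥ z ≤ Fintype.card m * s} ≤
      (Real.exp (t * s) * (√(1 + 2 * t))⁻¹) ^ Fintype.card m := by
  classical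
  have hone : IsUnit ((1 : Matrix m m ℝ)ᵀ * 1).det := by simp
  have hlt : -t < 1 / 2 := by linarith
  have htail := measure_le_le_exp_mul_mgf (Fintype.card m * s) (neg_nonpos.2 ht)
    (integrable_exp_mul_dotProduct_colProj_mulVec hone hlt)
  rw [mgf_dotProduct_colProj_mulVec hone hlt] at htail
  simp only [colProj_one, Matrix.one_mulVec] at htail
  refine htail.trans_eq ?_
  rw [mul_pow, ← Real.exp_nat_mul]
  congr 2
  · ring
  · congr 3
    ring

lemma hasLaw_inv_smul {Ω : Type*} [MeasurableSpace Ω] {μ : Measure Ω} {ε : Ω → m → ℝ} {σ : ℝ}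
    (hσ : σ ≠ 0) (hε : HasLaw ε (Measure.pi fun _ => gaussianReal 0 (σ ^ 2).toNNReal) μ) :
    HasLaw (fun ω => σ⁻¹ • ε ω) (stdGaussianPi m) μ := by
  refine HasLaw.comp (Y := fun e : m → ℝ => σ⁻¹ • e)
    ⟨(measurable_const_smul _).aemeasurable, ?_⟩ hε
  change Measure.map (fun (e : m → ℝ) i => σ⁻¹ * e i) _ = _
  rw [Measure.pi_map_pi fun _ => by fun_prop]
  refine congrArg Measure.pi (funext fun _ => ?_)
  rw [gaussianReal_map_const_mul, mul_zero]
  congr 1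
  ext
  simp [Real.coe_toNNReal _ (sq_nonneg σ), hσ]

end GaussianTail

lemma measure_prodMk_mem_le_of_indepFun {Ω α β : Type*} [MeasurableSpace Ω] [MeasurableSpace α]
    [MeasurableSpace β] {μ : Measure Ω} [IsProbabilityMeasure μ] {ρ : Measure β}
    [IsProbabilityMeasure ρ] {U : Ω → α} {V : Ω → β} (hU : AEMeasurable U μ) (hV : HasLaw V ρ μ)
    (hUV : IndepFun U V μ) {B : Set (α × β)} (hB : MeasurableSet B) {q : ℝ≥0∞}
    (hq : ∀ u, ρ {v | (u, v) ∈ B} ≤ q) : μ {ω | (U ω, V ω) ∈ B} ≤ q := by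
  have hprob : IsProbabilityMeasure (μ.map U) := Measure.isProbabilityMeasure_map hU
  have hlaw := (indepFun_iff_map_prod_eq_prod_map_map hU hV.aemeasurable).1 hUV
  rw [hV.map_eq] at hlaw
  calc μ {ω | (U ω, V ω) ∈ B} = (μ.map U).prod ρ B := by
        rw [← hlaw, Measure.map_apply_of_aemeasurable (hU.prodMk hV.aemeasurable) hB]
        rfl
    _ = ∫⁻ u, ρ {v | (u, v) ∈ B} ∂μ.map U := Measure.prod_apply hB
    _ ≤ ∫⁻ _, q ∂μ.map U := lintegral_mono hq
    _ = q := by rw [lintegral_const, measure_univ, mul_one]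

section RandomDesign

variable {Ω m ι : Type*} [MeasurableSpace Ω] {μ : Measure Ω} [Fintype m] {z : Ω → m → ℝ}

lemma measure_le_dotProduct_colProj_mulVec [IsProbabilityMeasure μ] [Fintype ι] [DecidableEq ι]
    [Nonempty ι] {W : Ω → Matrix m ι ℝ} (hW : EntryMeasurable W) (hz : HasLaw z (stdGaussianPi m) μ)
    (hWz : IndepFun (fun ω i j => W ω i j) z μ) {t s : ℝ} (ht₀ : 0 ≤ t) (ht : t < 1 / 2)
    (hs : 0 < s) :
    μ {ω | Fintype.card ι * s ≤ z ω ⬝ᵥ colProj (W ω) *ᵥ z ω} ≤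
      ENNReal.ofReal ((Real.exp (-t * s) * (√(1 - 2 * t))⁻¹) ^ Fintype.card ι) := by
  have hfst : EntryMeasurable fun x : (m → ι → ℝ) × (m → ℝ) => Matrix.of x.1 := fun i j => by
    simp only [Matrix.of_apply]
    fun_prop
  refine measure_prodMk_mem_le_of_indepFun
    (B := {x | Fintype.card ι * s ≤ x.2 ⬝ᵥ colProj (Matrix.of x.1) *ᵥ x.2})
    hW.measurable_entries.aemeasurable hz hWz
    (measurableSet_le measurable_const (hfst.colProj.dotProduct_mulVec measurable_snd)) fun x => ?_
  rw [← ofReal_measureReal]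
  exact ENNReal.ofReal_le_ofReal (measureReal_le_dotProduct_colProj_mulVec (Matrix.of x) ht₀ ht hs)

lemma measure_dotProduct_self_le (hz : HasLaw z (stdGaussianPi m) μ) {t : ℝ} (ht : 0 ≤ t) (s : ℝ) :
    μ {ω | z ω ⬝ᵥ z ω ≤ Fintype.card m * s} ≤
      ENNReal.ofReal ((Real.exp (t * s) * (√(1 + 2 * t))⁻¹) ^ Fintype.card m) := by
  have hmeas : Measurable fun x : m → ℝ => x ⬝ᵥ x := by
    unfold dotProduct
    fun_prop
  rw [hz.measure_eq (p := fun x => x ⬝ᵥ x ≤ Fintype.card m * s)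
    (measurableSet_le hmeas measurable_const), ← ofReal_measureReal]
  exact ENNReal.ofReal_le_ofReal (measureReal_dotProduct_self_le ht s)

end RandomDesign

lemma sum_pow_card_erase_empty_le {ι : Type*} [Fintype ι] [DecidableEq ι] {x : ℝ} (hx : 0 ≤ x) :
    ∑ η ∈ Finset.univ.erase (∅ : Finset ι), x ^ η.card ≤ Real.exp (Fintype.card ι * x) - 1 := by
  have hsum : ∑ η : Finset ι, x ^ η.card = (1 + x) ^ Fintype.card ι := by
    simpa using (Finset.prod_one_add (f := fun _ : ι => x) Finset.univ).symm
  have herase := Finset.add_sum_erase Finset.univ (fun η : Finset ι => x ^ η.card)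
    (Finset.mem_univ ∅)
  rw [hsum, Finset.card_empty, pow_zero] at herase
  have hexp : (1 + x) ^ Fintype.card ι ≤ Real.exp (Fintype.card ι * x) := by
    rw [Real.exp_nat_mul]
    exact pow_le_pow_left₀ (by linarith) (by linarith [Real.add_one_le_exp x]) _
  linarith

lemma measure_exists_le_dotProduct_colProj_excessDesign {Ω : Type*} [MeasurableSpace Ω]
    {μ : Measure Ω} [IsProbabilityMeasure μ] {n p : ℕ} {X : Ω → Matrix (Fin n) (Fin p) ℝ}
    {z : Ω → Fin n → ℝ} (hX : EntryMeasurable X) (hz : HasLaw z (stdGaussianPi (Fin n)) μ)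
    (hXz : IndepFun (fun ω i j => X ω i j) z μ) (γ₀ : Finset (Fin p)) {t s : ℝ} (ht₀ : 0 ≤ t)
    (ht : t < 1 / 2) (hs : 0 < s) :
    μ {ω | ∃ η : Finset (Fin p), η.Nonempty ∧
        η.card * s ≤ z ω ⬝ᵥ colProj (excessDesign (X ω) γ₀ η) *ᵥ z ω} ≤
      ENNReal.ofReal (Real.exp (p * (Real.exp (-t * s) * (√(1 - 2 * t))⁻¹)) - 1) := by
  set x := Real.exp (-t * s) * (√(1 - 2 * t))⁻¹
  have hx : 0 ≤ x := by positivity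
  have hof : EntryMeasurable fun A : Fin n → Fin p → ℝ => Matrix.of A := fun i j => by
    simp only [Matrix.of_apply]
    fun_prop
  have htail : ∀ η ∈ Finset.univ.erase (∅ : Finset (Fin p)),
      μ {ω | η.card * s ≤ z ω ⬝ᵥ colProj (excessDesign (X ω) γ₀ η) *ᵥ z ω} ≤
        ENNReal.ofReal (x ^ η.card) := fun η hη => by
    have : Nonempty {j // j ∈ η} :=
      (Finset.nonempty_iff_ne_empty.2 (Finset.ne_of_mem_erase hη)).to_subtype
    simpa only [Fintype.card_coe] using measure_le_dotProduct_colProj_mulVec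
      (hX.excessDesign γ₀ η) hz
      (hXz.comp (hof.excessDesign γ₀ η).measurable_entries measurable_id) ht₀ ht hs
  calc _ ≤ μ (⋃ η ∈ Finset.univ.erase (∅ : Finset (Fin p)),
          {ω | η.card * s ≤ z ω ⬝ᵥ colProj (excessDesign (X ω) γ₀ η) *ᵥ z ω}) := by
        refine measure_mono fun ω ⟨η, hη, hω⟩ => Set.mem_biUnion ?_ hω
        exact Finset.mem_coe.2 (Finset.mem_erase.2 ⟨hη.ne_empty, Finset.mem_univ _⟩)
    _ ≤ ∑ η ∈ Finset.univ.erase (∅ : Finset (Fin p)), ENNReal.ofReal (x ^ η.card) :=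
        (measure_biUnion_finset_le _ _).trans (Finset.sum_le_sum htail)
    _ = ENNReal.ofReal (∑ η ∈ Finset.univ.erase (∅ : Finset (Fin p)), x ^ η.card) :=
        (ENNReal.ofReal_sum_of_nonneg fun η _ => pow_nonneg hx _).symm
    _ ≤ ENNReal.ofReal (Real.exp (p * x) - 1) := by
        simpa using ENNReal.ofReal_le_ofReal (sum_pow_card_erase_empty_le (ι := Fin p) hx)

/-! ### Posterior odds from bounds on the scores -/

/-- Bounds on the score of every wrong model relative to that of `γ₀`: geometric in the number of
excess covariates for a model that contains `γ₀`, exponentially small in `p` for one that does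
not. -/
structure ScoreBounds {n p : ℕ} (ν : ℝ) (c : Fin p → ℝ) (X : Matrix (Fin n) (Fin p) ℝ)
    (y : Fin n → ℝ) (γ₀ : Finset (Fin p)) (K x : ℝ) : Prop where
  of_subset : ∀ γ, γ₀ ⊆ γ → γ ≠ γ₀ →
    modelScore ν c X y γ / modelScore ν c X y γ₀ ≤ K * x ^ (γ \ γ₀).card
  of_not_subset : ∀ γ, ¬ γ₀ ⊆ γ →
    modelScore ν c X y γ / modelScore ν c X y γ₀ ≤ Real.exp (-2 * p)

lemma sum_superset_pow_card_sdiff_le {ι : Type*} [Fintype ι] [DecidableEq ι] (γ₀ : Finset ι)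
    {x : ℝ} (hx : 0 ≤ x) :
    ∑ γ ∈ (Finset.univ.erase γ₀).filter (γ₀ ⊆ ·), x ^ (γ \ γ₀).card ≤
      Real.exp (Fintype.card ι * x) - 1 := by
  refine le_trans ?_ (sum_pow_card_erase_empty_le hx)
  have hinj : Set.InjOn (fun γ : Finset ι => γ \ γ₀)
      ((Finset.univ.erase γ₀).filter (γ₀ ⊆ ·) : Finset (Finset ι)) := fun γ hγ γ' hγ' h => by
    rw [← Finset.sdiff_union_of_subset (Finset.mem_filter.1 hγ).2,
      ← Finset.sdiff_union_of_subset (Finset.mem_filter.1 hγ').2]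
    exact congrArg (· ∪ γ₀) h
  rw [← Finset.sum_image (f := fun η : Finset ι => x ^ η.card) hinj]
  refine Finset.sum_le_sum_of_subset_of_nonneg (fun η hη => ?_) fun η _ _ => pow_nonneg hx _
  obtain ⟨γ, hγ, rfl⟩ := Finset.mem_image.1 hη
  obtain ⟨hne, hsub⟩ := Finset.mem_filter.1 hγ
  exact Finset.mem_erase.2 ⟨fun h => Finset.ne_of_mem_erase hne
    ((Finset.sdiff_eq_empty_iff_subset.1 h).antisymm hsub), Finset.mem_univ _⟩

lemma two_pow_mul_exp_neg_two_mul_le (p : ℕ) :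
    (2 : ℝ) ^ p * Real.exp (-2 * p) ≤ Real.exp (-p) := by
  have htwo : (2 : ℝ) ≤ Real.exp 1 := by linarith [Real.add_one_le_exp 1]
  calc (2 : ℝ) ^ p * Real.exp (-2 * p) ≤ Real.exp 1 ^ p * Real.exp (-2 * p) := by gcongr
    _ = Real.exp (-p) := by
        rw [← Real.exp_nat_mul, ← Real.exp_add]
        congr 1
        ring

namespace ScoreBounds

variable {n p : ℕ} {ν : ℝ} {c : Fin p → ℝ} {X : Matrix (Fin n) (Fin p) ℝ} {y : Fin n → ℝ}
  {γ₀ : Finset (Fin p)} {K x : ℝ} {prior : PMF (Finset (Fin p))} {C₀ : ℝ}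

lemma posterior_odds_le (h : ScoreBounds ν c X y γ₀ K x) (hK : 0 ≤ K) (hx : 0 ≤ x) (hx' : x ≤ 1)
    (hν : 0 < ν) (hc : ∀ j, 0 ≤ c j) (h₀ : prior γ₀ ≠ 0) (hC₀ : 0 ≤ C₀)
    (hprior : ∀ γ, (prior γ).toReal / (prior γ₀).toReal ≤ C₀) {γ : Finset (Fin p)} (hγ : γ ≠ γ₀) :
    _root_.posterior ν prior c X y γ / _root_.posterior ν prior c X y γ₀ ≤
      C₀ * (K * x + Real.exp (-p)) := by
  refine (posterior_div_le hν hc h₀ (hprior γ)).trans (mul_le_mul_of_nonneg_left ?_ hC₀)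
  by_cases hsub : γ₀ ⊆ γ
  · have hcard : (γ \ γ₀).card ≠ 0 := by
      rw [Finset.card_ne_zero, Finset.sdiff_nonempty]
      exact fun hsub' => hγ (hsub'.antisymm hsub)
    exact (h.of_subset γ hsub hγ).trans (le_add_of_le_of_nonneg
      (mul_le_mul_of_nonneg_left (pow_le_of_le_one hx hx' hcard) hK) (Real.exp_pos _).le)
  · refine (h.of_not_subset γ hsub).trans (le_add_of_nonneg_of_le (mul_nonneg hK hx) ?_)
    exact Real.exp_le_exp.2 (by linarith [(Nat.cast_nonneg p : (0 : ℝ) ≤ p)])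

lemma sum_modelScore_div_le (h : ScoreBounds ν c X y γ₀ K x) (hK : 0 ≤ K) (hx : 0 ≤ x) :
    ∑ γ ∈ Finset.univ.erase γ₀, modelScore ν c X y γ / modelScore ν c X y γ₀ ≤
      K * (Real.exp (p * x) - 1) + Real.exp (-p) := by
  rw [← Finset.sum_filter_add_sum_filter_not _ (γ₀ ⊆ ·)]
  refine add_le_add ?_ ?_
  · calc _ ≤ ∑ γ ∈ (Finset.univ.erase γ₀).filter (γ₀ ⊆ ·), K * x ^ (γ \ γ₀).card :=
          Finset.sum_le_sum fun γ hγ => h.of_subset γ (Finset.mem_filter.1 hγ).2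
            (Finset.ne_of_mem_erase (Finset.mem_filter.1 hγ).1)
      _ ≤ K * (Real.exp (p * x) - 1) := by
          rw [← Finset.mul_sum]
          refine mul_le_mul_of_nonneg_left ?_ hK
          simpa only [Fintype.card_fin] using sum_superset_pow_card_sdiff_le γ₀ hx
  · calc _ ≤ ((Finset.univ.erase γ₀).filter (¬ γ₀ ⊆ ·)).card • Real.exp (-2 * p) :=
          Finset.sum_le_card_nsmul _ _ _ fun γ hγ => h.of_not_subset γ (Finset.mem_filter.1 hγ).2
      _ ≤ (2 : ℝ) ^ p * Real.exp (-2 * p) := by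
          rw [nsmul_eq_mul]
          gcongr
          exact_mod_cast (Finset.card_le_univ _).trans_eq (by simp)
      _ ≤ Real.exp (-p) := two_pow_mul_exp_neg_two_mul_le p

lemma sum_posterior_le (h : ScoreBounds ν c X y γ₀ K x) (hK : 0 ≤ K) (hx : 0 ≤ x) (hν : 0 < ν)
    (hc : ∀ j, 0 ≤ c j) (h₀ : prior γ₀ ≠ 0) (hC₀ : 0 ≤ C₀)
    (hprior : ∀ γ, (prior γ).toReal / (prior γ₀).toReal ≤ C₀) :
    ∑ γ ∈ Finset.univ.erase γ₀, _root_.posterior ν prior c X y γ ≤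
      C₀ * (K * (Real.exp (p * x) - 1) + Real.exp (-p)) :=
  calc _ ≤ ∑ γ ∈ Finset.univ.erase γ₀,
          C₀ * (modelScore ν c X y γ / modelScore ν c X y γ₀) :=
        Finset.sum_le_sum fun γ _ => posterior_le hν hc h₀ (hprior γ)
    _ ≤ _ := by
        rw [← Finset.mul_sum]
        exact mul_le_mul_of_nonneg_left (h.sum_modelScore_div_le hK hx) hC₀

end ScoreBounds

/-! ### Scores under typical noise -/

namespace DesignBounds

variable {n p : ℕ} {X : Matrix (Fin n) (Fin p) ℝ} {γ₀ γ : Finset (Fin p)} {a b h : ℝ}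
  {c : Fin p → ℝ} {φ φ' ν : ℝ} {β : Fin p → ℝ} {e : Fin n → ℝ}

lemma modelScore_div_le_exp_of_not_subset (hX : DesignBounds X γ₀ a b h) (hν : 0 < ν) (hφ : 0 < φ)
    (hφ' : 0 ≤ φ') (hc : ∀ j, φ ≤ c j) (hc' : ∀ j, c j ≤ φ') (hβ : ∀ j ∉ γ₀, β j = 0) {ψ : ℝ}
    (hψ₀ : 0 ≤ ψ) (hψ : ∀ j ∈ γ₀, ψ ≤ |β j|) (hγ : ¬ γ₀ ⊆ γ) {t : ℝ} (ht : 0 ≤ t)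
    (hsignal : 2 * (e ⬝ᵥ colProj X *ᵥ e) + (β ⬝ᵥ β) / φ +
      t * (1 + (e ⬝ᵥ e + (β ⬝ᵥ β) / φ)) ≤ a * ψ ^ 2 / 2)
    (hdet : p * Real.log (1 + b * φ') + 4 * p ≤ (n + ν) * Real.log (1 + t)) :
    modelScore ν c X (X *ᵥ β + e) γ / modelScore ν c X (X *ᵥ β + e) γ₀ ≤ Real.exp (-2 * p) := by
  have hb := hX.signal_nonneg
  have hnum : 0 < 1 + (e ⬝ᵥ e + (β ⬝ᵥ β) / φ) := by
    have := dotProduct_self_nonneg e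
    have := div_nonneg (dotProduct_self_nonneg β) hφ.le
    linarith
  have hden : (1 + (e ⬝ᵥ e + (β ⬝ᵥ β) / φ)) * (1 + t) ≤
      1 + (e ⬝ᵥ e - 2 * (e ⬝ᵥ colProj X *ᵥ e) + a * ψ ^ 2 / 2) := by linarith
  have hpos := (mul_pos hnum (by linarith : 0 < 1 + t)).trans_le hden
  have hresidual : (1 + (e ⬝ᵥ e + (β ⬝ᵥ β) / φ)) /
      (1 + (e ⬝ᵥ e - 2 * (e ⬝ᵥ colProj X *ᵥ e) + a * ψ ^ 2 / 2)) ≤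
        Real.exp (-Real.log (1 + t)) := by
    rw [Real.exp_neg, Real.exp_log (by linarith), div_le_iff₀ hpos, inv_mul_eq_div,
      le_div_iff₀ (by linarith)]
    exact hden
  have hdeterminant : √((1 + b * φ') ^ p) = Real.exp (p * Real.log (1 + b * φ') / 2) := by
    rw [Real.exp_half, Real.exp_nat_mul, Real.exp_log (by positivity)]
  calc _ ≤ √((1 + b * φ') ^ p) * ((1 + (e ⬝ᵥ e + (β ⬝ᵥ β) / φ)) /
          (1 + (e ⬝ᵥ e - 2 * (e ⬝ᵥ colProj X *ᵥ e) + a * ψ ^ 2 / 2))) ^ (((n : ℝ) + ν) / 2) :=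
        hX.modelScore_div_le_of_not_subset hν hφ hc hc' hβ hψ₀ hψ hγ hpos
    _ ≤ Real.exp (p * Real.log (1 + b * φ') / 2) *
          Real.exp (-Real.log (1 + t)) ^ (((n : ℝ) + ν) / 2) := by
        rw [hdeterminant]
        have := div_nonneg hnum.le hpos.le
        gcongr
    _ ≤ Real.exp (-2 * p) := by
        rw [← Real.exp_mul, ← Real.exp_add, Real.exp_le_exp]
        linarith

lemma modelScore_div_le_geometric_of_subset (hX : DesignBounds X γ₀ a b h) (hν : 0 < ν)
    (hφ : 0 < φ) (hc : ∀ j, φ ≤ c j) (hβ : ∀ j ∉ γ₀, β j = 0) {L r s T : ℝ} (hL : 0 < L)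
    (hLe : L ≤ e ⬝ᵥ e - e ⬝ᵥ colProj X *ᵥ e) (hr : n + ν ≤ r * L) (hγ : γ₀ ⊆ γ)
    (hexcess : e ⬝ᵥ colProj (excessDesign X γ₀ (γ \ γ₀)) *ᵥ e ≤ (γ \ γ₀).card * s)
    (hshrink : 2 * (β ⬝ᵥ β + (e ⬝ᵥ colProj X *ᵥ e) / a) / φ ≤ T) :
    modelScore ν c X (X *ᵥ β + e) γ / modelScore ν c X (X *ᵥ β + e) γ₀ ≤
      Real.exp (r * T / 2) * (Real.exp (r * s / 2) / √(h * φ)) ^ (γ \ γ₀).card := by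
  have ha := hX.missing_pos
  have hh := hX.excess_pos
  have hs := (dotProduct_mulVec_nonneg_of_isStarProjection (isStarProjection_colProj _) e).trans
    hexcess
  have hT : 0 ≤ T := by
    refine le_trans ?_ hshrink
    have := dotProduct_self_nonneg β
    have := dotProduct_mulVec_nonneg_of_isStarProjection (isStarProjection_colProj X) e
    positivity
  refine (hX.modelScore_div_le_of_subset hν hφ hc hβ hL hLe hγ
    (add_le_add hexcess hshrink)).trans ?_
  set k := (γ \ γ₀).card
  have hdet : √(((1 + h * φ) ^ k)⁻¹) ≤ (√(h * φ))⁻¹ ^ k := by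
    rw [← inv_pow, sqrt_pow_eq (by positivity), Real.sqrt_inv]
    gcongr
    linarith
  have hexp : ((n : ℝ) + ν) / 2 * ((k * s + T) / L) ≤ r * T / 2 + k * (r * s / 2) :=
    calc ((n : ℝ) + ν) / 2 * ((k * s + T) / L) ≤ r * L / 2 * ((k * s + T) / L) := by gcongr
      _ = r * T / 2 + k * (r * s / 2) := by
          field_simp
          ring
  calc _ ≤ (√(h * φ))⁻¹ ^ k * Real.exp (r * T / 2 + k * (r * s / 2)) := by gcongr
    _ = Real.exp (r * T / 2) * (Real.exp (r * s / 2) / √(h * φ)) ^ k := by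
        rw [Real.exp_add, Real.exp_nat_mul, div_pow, inv_pow]
        ring

end DesignBounds

/-- The standardized noise `z` is of typical size relative to the design: its projection to the
column space of `X` is small, its squared norm is of order `n`, and it is explained to at most `s`
per covariate by covariates outside `γ₀`. -/
structure NoiseBounds {n p : ℕ} (X : Matrix (Fin n) (Fin p) ℝ) (γ₀ : Finset (Fin p))
    (z : Fin n → ℝ) (κ s : ℝ) : Prop where
  proj : z ⬝ᵥ colProj X *ᵥ z ≤ p * 4
  upper : z ⬝ᵥ z ≤ n * 4
  lower : n * κ ≤ z ⬝ᵥ z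
  excess : ∀ η : Finset (Fin p), η.Nonempty →
    z ⬝ᵥ colProj (excessDesign X γ₀ η) *ᵥ z ≤ η.card * s

lemma smul_dotProduct_mulVec_smul {m : Type*} [Fintype m] (σ : ℝ) (A : Matrix m m ℝ) (z : m → ℝ) :
    (σ • z) ⬝ᵥ A *ᵥ (σ • z) = σ ^ 2 * (z ⬝ᵥ A *ᵥ z) := by
  rw [Matrix.mulVec_smul, smul_dotProduct, dotProduct_smul, smul_eq_mul, smul_eq_mul, sq, mul_assoc]

lemma smul_dotProduct_smul_self {m : Type*} [Fintype m] (σ : ℝ) (z : m → ℝ) :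
    (σ • z) ⬝ᵥ (σ • z) = σ ^ 2 * (z ⬝ᵥ z) := by
  rw [smul_dotProduct, dotProduct_smul, smul_eq_mul, smul_eq_mul, sq, mul_assoc]

namespace NoiseBounds

variable {n p : ℕ} {X : Matrix (Fin n) (Fin p) ℝ} {γ₀ : Finset (Fin p)} {z : Fin n → ℝ} {κ s : ℝ}

lemma signal_dominates (hN : NoiseBounds X γ₀ z κ s) (hn : 1 ≤ n) (hp : 1 ≤ p) {σ A B C t ψ : ℝ}
    (hA : 0 ≤ A) (hB : 0 ≤ B) (hBC : B ≤ C) (ht : 0 ≤ t)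
    (ht' : t * (1 + 4 * σ ^ 2 + C) ≤ A / 8 * min (ψ ^ 2) 1)
    (hdim : (8 * σ ^ 2 + C) * p ≤ A / 8 * (n * min (ψ ^ 2) 1)) :
    2 * ((σ • z) ⬝ᵥ colProj X *ᵥ (σ • z)) + B + t * (1 + ((σ • z) ⬝ᵥ (σ • z) + B)) ≤
      n * (A / 2) * ψ ^ 2 / 2 := by
  rw [smul_dotProduct_mulVec_smul, smul_dotProduct_smul_self]
  have hn' : (1 : ℝ) ≤ n := by exact_mod_cast hn
  have hp' : (1 : ℝ) ≤ p := by exact_mod_cast hp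
  have hC : 0 ≤ C := hB.trans hBC
  have hproj : 2 * (σ ^ 2 * (z ⬝ᵥ colProj X *ᵥ z)) + B ≤ (8 * σ ^ 2 + C) * p := by
    have := mul_le_mul_of_nonneg_left hN.proj (sq_nonneg σ)
    have := le_mul_of_one_le_right hC hp'
    linarith
  have hnorm : 1 + (σ ^ 2 * (z ⬝ᵥ z) + B) ≤ (1 + 4 * σ ^ 2 + C) * n := by
    have := mul_le_mul_of_nonneg_left hN.upper (sq_nonneg σ)
    have := le_mul_of_one_le_right hC hn'
    linarith
  calc _ ≤ (8 * σ ^ 2 + C) * p + t * ((1 + 4 * σ ^ 2 + C) * n) := by gcongr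
    _ = (8 * σ ^ 2 + C) * p + t * (1 + 4 * σ ^ 2 + C) * n := by ring
    _ ≤ A / 8 * (n * min (ψ ^ 2) 1) + A / 8 * min (ψ ^ 2) 1 * n := by gcongr
    _ = n * (A / 2) * min (ψ ^ 2) 1 / 2 := by ring
    _ ≤ n * (A / 2) * ψ ^ 2 / 2 := by
        gcongr
        exact min_le_left _ _

lemma le_residual (hN : NoiseBounds X γ₀ z κ s) (σ : ℝ) :
    σ ^ 2 * (n * κ - 4 * p) ≤ (σ • z) ⬝ᵥ (σ • z) - (σ • z) ⬝ᵥ colProj X *ᵥ (σ • z) := by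
  rw [smul_dotProduct_mulVec_smul, smul_dotProduct_smul_self, ← mul_sub]
  exact mul_le_mul_of_nonneg_left (by linarith [hN.lower, hN.proj]) (sq_nonneg σ)

lemma shrinkage_le (hN : NoiseBounds X γ₀ z κ s) (hn : 0 < n) {σ A B C φ : ℝ} (hA : 0 < A)
    (hφ : 0 < φ) (hB : B ≤ C * φ) (hpφ : p ≤ n * φ) :
    2 * (B + (σ • z) ⬝ᵥ colProj X *ᵥ (σ • z) / (n * (A / 2))) / φ ≤ 2 * (C + 8 * σ ^ 2 / A) := by
  have : (0 : ℝ) < n := by exact_mod_cast hn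
  rw [smul_dotProduct_mulVec_smul, div_le_iff₀ hφ]
  have hproj : σ ^ 2 * (z ⬝ᵥ colProj X *ᵥ z) / (n * (A / 2)) ≤ 8 * σ ^ 2 / A * φ := by
    calc _ ≤ σ ^ 2 * (n * φ * 4) / (n * (A / 2)) := by
          gcongr
          exact hN.proj.trans (by gcongr)
      _ = 8 * σ ^ 2 / A * φ := by
          field_simp
          ring
  linarith

end NoiseBounds

/-! ### Growth of the dimension -/

lemma eq_zero_of_notMem_stateVector {p : ℕ} {β : Fin p → ℝ} {j : Fin p} (hj : j ∉ stateVector β) :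
    β j = 0 := by
  simpa [stateVector] using hj

lemma mul_log_one_add_le {c x : ℝ} (hc₀ : 0 ≤ c) (hc₁ : c ≤ 1) (hx : 0 ≤ x) :
    c * Real.log (1 + x) ≤ Real.log (1 + c * x) := by
  rw [← Real.log_rpow (by linarith)]
  exact Real.log_le_log (by positivity)
    (rpow_one_add_le_one_add_mul_self (by linarith) hc₀ hc₁)

lemma eventually_log_one_add_mul_le {f : ℕ → ℝ} {b d : ℝ} (hb : 0 ≤ b) (hd : 0 ≤ d)
    (hf₀ : ∀ᶠ n in atTop, 0 ≤ f n) (hf : f =O[atTop] fun n : ℕ => (n : ℝ) ^ d) :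
    ∀ᶠ n : ℕ in atTop, Real.log (1 + n * b * f n) ≤ (d + 2) * Real.log n := by
  obtain ⟨C, _, hbound⟩ := hf.exists_pos
  filter_upwards [hf₀, hbound.bound, eventually_ge_atTop 1,
    tendsto_natCast_atTop_atTop.eventually_ge_atTop (1 + b * C)] with n hf₀ hfn hn hlarge
  have hn₁ : (1 : ℝ) ≤ n := by exact_mod_cast hn
  have hpow : (1 : ℝ) ≤ (n : ℝ) ^ d := Real.one_le_rpow hn₁ hd
  rw [Real.norm_of_nonneg hf₀, Real.norm_of_nonneg (by linarith)] at hfn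
  rw [← Real.log_rpow (by linarith)]
  refine Real.log_le_log (by positivity) ?_
  calc 1 + n * b * f n ≤ (n : ℝ) ^ d * n + n * b * (C * (n : ℝ) ^ d) := by
        gcongr
        exact one_le_mul_of_one_le_of_one_le hpow hn₁
    _ = (n : ℝ) ^ d * n * (1 + b * C) := by ring
    _ ≤ (n : ℝ) ^ d * n * n := by gcongr
    _ = (n : ℝ) ^ (d + 2) := by
        rw [Real.rpow_add (by linarith), Real.rpow_two]
        ring

section Dimension

variable {p : ℕ → ℕ} {m φ : ℕ → ℝ}

lemma eventually_mul_dim_log_le (hm : ∀ n, 0 ≤ m n)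
    (hp : (fun n : ℕ => (p n : ℝ) * Real.log n) =o[atTop] fun n : ℕ => n * Real.log (1 + m n))
    {C : ℝ} (hC : 0 < C) :
    ∀ᶠ n : ℕ in atTop, C * (p n * Real.log n) ≤ n * Real.log (1 + m n) := by
  filter_upwards [hp.def (inv_pos.2 hC)] with n hn
  have hlog : 0 ≤ Real.log (1 + m n) := Real.log_nonneg (by linarith [hm n])
  rw [Real.norm_of_nonneg (by positivity : 0 ≤ (n : ℝ) * Real.log (1 + m n))] at hn
  rw [← le_inv_mul_iff₀ hC]
  exact (le_abs_self _).trans hn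

lemma eventually_one_le_log_natCast : ∀ᶠ n : ℕ in atTop, 1 ≤ Real.log n :=
  (Real.tendsto_log_atTop.comp tendsto_natCast_atTop_atTop).eventually_ge_atTop 1

lemma eventually_mul_dim_le (hm : ∀ n, 0 ≤ m n)
    (hp : (fun n : ℕ => (p n : ℝ) * Real.log n) =o[atTop] fun n : ℕ => n * Real.log (1 + m n))
    {C : ℝ} (hC : 0 < C) : ∀ᶠ n : ℕ in atTop, C * p n ≤ n * m n := by
  filter_upwards [eventually_mul_dim_log_le hm hp hC, eventually_one_le_log_natCast] with n hn hlog
  have hlog_le := Real.log_le_sub_one_of_pos (by linarith [hm n] : 0 < 1 + m n)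
  calc C * p n ≤ C * (p n * Real.log n) := by
        gcongr
        exact le_mul_of_one_le_right (Nat.cast_nonneg _) hlog
    _ ≤ n * Real.log (1 + m n) := hn
    _ ≤ n * m n := by
        gcongr
        linarith

lemma eventually_add_le_mul_sub (hm : ∀ n, 0 ≤ m n) (hm₁ : ∀ n, m n ≤ 1)
    (hp : (fun n : ℕ => (p n : ℝ) * Real.log n) =o[atTop] fun n : ℕ => n * Real.log (1 + m n))
    (ν : ℝ) {r κ : ℝ} (hr : 0 < r) (hκ : 1 < r * κ) :
    ∀ᶠ n : ℕ in atTop, n + ν ≤ r * (n * κ - 4 * p n) := by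
  have hgap : 0 < r * κ - 1 := by linarith
  filter_upwards [eventually_mul_dim_le hm hp (C := 8 * r / (r * κ - 1)) (by positivity),
    tendsto_natCast_atTop_atTop.eventually_ge_atTop (2 * ν / (r * κ - 1))] with n hdim hlarge
  replace hdim := hdim.trans (mul_le_of_le_one_right (Nat.cast_nonneg n) (hm₁ n))
  rw [div_mul_eq_mul_div, div_le_iff₀ hgap] at hdim
  rw [div_le_iff₀ hgap] at hlarge
  linarith

lemma eventually_dim_le_mul {α₀ δ : ℝ} (hα₀ : 1 ≤ α₀) (hδ : 0 ≤ δ)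
    (hφ : ∀ n, 1 ≤ n → 0 < φ n) (hp_lim : Tendsto p atTop atTop)
    (hpα : (fun n => (p n : ℝ) ^ α₀) =o[atTop] fun n : ℕ => (n : ℝ) ^ (1 - δ) * φ n) :
    ∀ᶠ n in atTop, (p n : ℝ) ≤ n * φ n := by
  filter_upwards [hpα.def one_pos, eventually_ge_atTop 1, hp_lim.eventually_ge_atTop 1] with
    n hle hn hp
  have hn₁ : (1 : ℝ) ≤ n := by exact_mod_cast hn
  have hp₁ : (1 : ℝ) ≤ p n := by exact_mod_cast hp
  have hφn := hφ n hn
  rw [one_mul, Real.norm_of_nonneg (by positivity), Real.norm_of_nonneg (by positivity)] at hle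
  calc (p n : ℝ) ≤ (p n : ℝ) ^ α₀ := Real.self_le_rpow_of_one_le hp₁ hα₀
    _ ≤ (n : ℝ) ^ (1 - δ) * φ n := hle
    _ ≤ n * φ n := by
        gcongr
        exact Real.rpow_le_self_of_one_le hn₁ (by linarith)

/-- The ratio of the geometric bound on the score of models that strictly contain the true one:
`√(C₃ n^(1-δ) φ)` is the price of an additional covariate, `√(p^α₀)` its largest gain in fit. -/
noncomputable def excessRatio (C₃ δ α₀ : ℝ) (p : ℕ → ℕ) (φ : ℕ → ℝ) (n : ℕ) : ℝ :=
  √((p n : ℝ) ^ α₀ / (C₃ * (n : ℝ) ^ (1 - δ) * φ n))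

lemma tendsto_pow_mul_excessRatio {C₃ δ α₀ : ℝ} (q : ℕ) (hp_lim : Tendsto p atTop atTop)
    (hpα : (fun n => (p n : ℝ) ^ (α₀ + 2 * q)) =o[atTop] fun n : ℕ => (n : ℝ) ^ (1 - δ) * φ n) :
    Tendsto (fun n => (p n : ℝ) ^ q * excessRatio C₃ δ α₀ p φ n) atTop (𝓝 0) := by
  have hsqrt := (hpα.tendsto_div_nhds_zero.div_const C₃).sqrt
  rw [zero_div, Real.sqrt_zero] at hsqrt
  refine hsqrt.congr' ?_
  filter_upwards [hp_lim.eventually_ge_atTop 1] with n hp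
  have hp₀ : (0 : ℝ) < p n := by exact_mod_cast hp
  rw [excessRatio, ← Real.sqrt_sq (by positivity : 0 ≤ (p n : ℝ) ^ q),
    ← Real.sqrt_mul (by positivity), Real.rpow_add hp₀, mul_comm 2 (q : ℝ), Real.rpow_mul hp₀.le,
    Real.rpow_natCast, Real.rpow_two, div_div, ← mul_div_assoc]
  congr 1
  ring

end Dimension

/-! ### Scores for all large samples -/

section Scores

variable {p : ℕ → ℕ} {β₀ : ∀ n, Fin (p n) → ℝ} {ν σ A b : ℝ}

lemma eventually_exists_signal_rate {ψ φ : ℕ → ℝ} {C δ₀ : ℝ} (hA : 0 < A) (hb : 0 ≤ b)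
    (hC : 0 ≤ C) (hδ₀ : 0 ≤ δ₀) (hν : 0 < ν) (hφ₀ : ∀ᶠ n in atTop, 0 ≤ φ n)
    (hφ : φ =O[atTop] fun n : ℕ => (n : ℝ) ^ δ₀)
    (hp : (fun n : ℕ => (p n : ℝ) * Real.log n) =o[atTop]
      fun n : ℕ => n * Real.log (1 + min (ψ n ^ 2) 1)) :
    ∀ᶠ n : ℕ in atTop, ∃ t : ℝ, 0 ≤ t ∧ t * (1 + 4 * σ ^ 2 + C) ≤ A / 8 * min (ψ n ^ 2) 1 ∧
      p n * Real.log (1 + n * b * φ n) + 4 * p n ≤ (n + ν) * Real.log (1 + t) := by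
  have hm : ∀ n, 0 ≤ min (ψ n ^ 2) 1 := fun n => le_min (sq_nonneg _) zero_le_one
  have : 0 < 1 + 4 * σ ^ 2 + C := by positivity
  set c₀ := min 1 (A / (8 * (1 + 4 * σ ^ 2 + C)))
  have hc₀ : 0 < c₀ := lt_min one_pos (by positivity)
  filter_upwards [eventually_log_one_add_mul_le hb hδ₀ hφ₀ hφ, eventually_one_le_log_natCast,
    eventually_mul_dim_log_le hm hp (C := (δ₀ + 2 + 4) / c₀) (by positivity)] with n hdet hlog hdim
  have hlogm : 0 ≤ Real.log (1 + c₀ * min (ψ n ^ 2) 1) :=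
    Real.log_nonneg (by linarith [mul_nonneg hc₀.le (hm n)])
  refine ⟨c₀ * min (ψ n ^ 2) 1, mul_nonneg hc₀.le (hm n), ?_, ?_⟩
  · calc _ ≤ A / (8 * (1 + 4 * σ ^ 2 + C)) * min (ψ n ^ 2) 1 * (1 + 4 * σ ^ 2 + C) := by
          gcongr
          exact min_le_right _ _
      _ = A / 8 * min (ψ n ^ 2) 1 := by
          field_simp
  · rw [div_mul_eq_mul_div, div_le_iff₀ hc₀] at hdim
    calc _ ≤ p n * ((δ₀ + 2) * Real.log n) + 4 * (p n * Real.log n) := by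
          gcongr
          exact le_mul_of_one_le_right (Nat.cast_nonneg _) hlog
      _ = (δ₀ + 2 + 4) * (p n * Real.log n) := by ring
      _ ≤ n * (c₀ * Real.log (1 + min (ψ n ^ 2) 1)) := by linarith
      _ ≤ n * Real.log (1 + c₀ * min (ψ n ^ 2) 1) := by
          gcongr
          exact mul_log_one_add_le hc₀.le (min_le_left _ _) (hm n)
      _ ≤ (n + ν) * Real.log (1 + c₀ * min (ψ n ^ 2) 1) := by
          gcongr
          linarith

lemma eventually_modelScore_div_le_exp_of_not_subset {ψ φlo φhi : ℕ → ℝ} {C δ₀ : ℝ} (hA : 0 < A)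
    (hb : 0 ≤ b) (hδ₀ : 0 ≤ δ₀) (hν : 0 < ν) (hψ₀ : ∀ n, 1 ≤ n → 0 < ψ n)
    (hψ : ∀ n, 1 ≤ n → ∀ j ∈ stateVector (β₀ n), ψ n ≤ |β₀ n j|)
    (hp_lim : Tendsto p atTop atTop)
    (hp : (fun n : ℕ => (p n : ℝ) * Real.log n) =o[atTop]
      fun n : ℕ => n * Real.log (1 + min (ψ n ^ 2) 1))
    (hφlo : ∀ n, 1 ≤ n → 0 < φlo n) (hφ_le : ∀ n, 1 ≤ n → φlo n ≤ φhi n)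
    (hφhi : φhi =O[atTop] fun n : ℕ => (n : ℝ) ^ δ₀) (hC : 0 < C)
    (hβ : ∀ᶠ n in atTop, β₀ n ⬝ᵥ β₀ n ≤ C * φlo n) :
    ∀ᶠ n : ℕ in atTop, ∀ {X : Matrix (Fin n) (Fin (p n)) ℝ} {z : Fin n → ℝ} {h κ s : ℝ}
      {c : Fin (p n) → ℝ} {γ : Finset (Fin (p n))},
      DesignBounds X (stateVector (β₀ n)) (n * (A / 2)) (n * b) h →
      NoiseBounds X (stateVector (β₀ n)) z κ s → (∀ j, φlo n ≤ c j) → (∀ j, c j ≤ φhi n) →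
      ¬ stateVector (β₀ n) ⊆ γ →
      modelScore ν c X (X *ᵥ β₀ n + σ • z) γ /
        modelScore ν c X (X *ᵥ β₀ n + σ • z) (stateVector (β₀ n)) ≤ Real.exp (-2 * p n) := by
  have hφhi₀ : ∀ᶠ n in atTop, 0 ≤ φhi n := by
    filter_upwards [eventually_ge_atTop 1] with n hn
    exact (hφlo n hn).le.trans (hφ_le n hn)
  filter_upwards [eventually_ge_atTop 1, hp_lim.eventually_ge_atTop 1, hφhi₀, hβ,
    eventually_exists_signal_rate (σ := σ) hA hb hC.le hδ₀ hν hφhi₀ hφhi hp,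
    eventually_mul_dim_le (fun n => le_min (sq_nonneg (ψ n)) zero_le_one) hp
      (C := (8 * σ ^ 2 + C) * (8 / A)) (by positivity)] with n hn hpn hφhin hβn
    ⟨t, ht, ht', hdet⟩ hdim X z h κ s c γ hX hN hc hc' hγ
  have hφn := hφlo n hn
  refine hX.modelScore_div_le_exp_of_not_subset hν hφn hφhin hc hc'
    (fun j => eq_zero_of_notMem_stateVector) (hψ₀ n hn).le (hψ n hn) hγ ht
    (hN.signal_dominates hn hpn hA.le (div_nonneg (dotProduct_self_nonneg _) hφn.le)
      ((div_le_iff₀ hφn).2 hβn) ht ht' ?_) hdet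
  calc (8 * σ ^ 2 + C) * p n = A / 8 * ((8 * σ ^ 2 + C) * (8 / A) * p n) := by
        field_simp
    _ ≤ _ := by gcongr

lemma exp_half_div_sqrt_eq_sqrt_rpow_div {x r y : ℝ} (hx : 0 < x) :
    Real.exp (r * Real.log x / 2) / √y = √(x ^ r / y) := by
  rw [Real.exp_half, Real.sqrt_div (by positivity), Real.rpow_def_of_pos hx, mul_comm r]

lemma exists_eventually_modelScore_div_le_geometric_of_subset {m φ : ℕ → ℝ} {C C₃ δ α α₀ κ : ℝ}
    (hσ : 0 < σ) (hA : 0 < A) (hδ : 0 ≤ δ) (hν : 0 < ν) (hα : 0 < α) (hα₀ : 1 ≤ α₀)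
    (hκ : 1 < α₀ / α * κ) (hp_lim : Tendsto p atTop atTop) (hm : ∀ n, 0 ≤ m n)
    (hm₁ : ∀ n, m n ≤ 1)
    (hp : (fun n : ℕ => (p n : ℝ) * Real.log n) =o[atTop] fun n : ℕ => n * Real.log (1 + m n))
    (hφ : ∀ n, 1 ≤ n → 0 < φ n)
    (hpα : (fun n => (p n : ℝ) ^ α₀) =o[atTop] fun n : ℕ => (n : ℝ) ^ (1 - δ) * φ n)
    (hβ : ∀ᶠ n in atTop, β₀ n ⬝ᵥ β₀ n ≤ C * φ n) :
    ∃ K > 0, ∀ᶠ n : ℕ in atTop, ∀ {X : Matrix (Fin n) (Fin (p n)) ℝ} {z : Fin n → ℝ}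
      {c : Fin (p n) → ℝ} {γ : Finset (Fin (p n))},
      DesignBounds X (stateVector (β₀ n)) (n * (A / 2)) (n * b) (C₃ * (n : ℝ) ^ (1 - δ)) →
      NoiseBounds X (stateVector (β₀ n)) z κ (α * Real.log (p n)) → (∀ j, φ n ≤ c j) →
      stateVector (β₀ n) ⊆ γ → γ ≠ stateVector (β₀ n) →
      modelScore ν c X (X *ᵥ β₀ n + σ • z) γ /
        modelScore ν c X (X *ᵥ β₀ n + σ • z) (stateVector (β₀ n)) ≤
          K * excessRatio C₃ δ α₀ p φ n ^ (γ \ stateVector (β₀ n)).card := by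
  have hr : 0 < α₀ / α := by positivity
  refine ⟨Real.exp (α₀ / α / σ ^ 2 * (2 * (C + 8 * σ ^ 2 / A)) / 2), Real.exp_pos _, ?_⟩
  filter_upwards [eventually_ge_atTop 1, hp_lim.eventually_ge_atTop 1, hβ,
    eventually_dim_le_mul hα₀ hδ hφ hp_lim hpα,
    eventually_add_le_mul_sub hm hm₁ hp ν hr hκ] with n hn hpn hβn hdim hL X z c γ hX hN hc hγ hne
  have hp₀ : (0 : ℝ) < p n := by exact_mod_cast hpn
  have hL₀ : 0 < σ ^ 2 * (n * κ - 4 * p n) := by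
    have := pos_of_mul_pos_right (lt_of_lt_of_le (by positivity) hL) hr.le
    positivity
  refine (hX.modelScore_div_le_geometric_of_subset hν (hφ n hn) hc
    (fun j => eq_zero_of_notMem_stateVector) (r := α₀ / α / σ ^ 2)
    (s := σ ^ 2 * (α * Real.log (p n))) hL₀ (hN.le_residual σ) ?_ hγ ?_
    (hN.shrinkage_le hn hA (hφ n hn) hβn hdim)).trans_eq ?_
  · calc (n : ℝ) + ν ≤ _ := hL
      _ = _ := by field_simp
  · rw [smul_dotProduct_mulVec_smul, mul_left_comm]
    gcongr
    exact hN.excess _ (Finset.sdiff_nonempty.2 fun hsub => hne (hsub.antisymm hγ))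
  · have hexp : α₀ / α / σ ^ 2 * (σ ^ 2 * (α * Real.log (p n))) = α₀ * Real.log (p n) := by
      field_simp
    rw [hexp, exp_half_div_sqrt_eq_sqrt_rpow_div hp₀, excessRatio]

lemma exists_eventually_scoreBounds {ψ φlo φhi : ℕ → ℝ} {C₃ δ δ₀ α α₀ κ : ℝ} (hσ : 0 < σ)
    (hA : 0 < A) (hb : 0 ≤ b) (hδ₀ : 0 ≤ δ₀) (hδ : 0 ≤ δ) (hν : 0 < ν)
    (hα : 0 < α) (hα₀ : 1 ≤ α₀) (hκ : 1 < α₀ / α * κ) (hψ₀ : ∀ n, 1 ≤ n → 0 < ψ n)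
    (hψ : ∀ n, 1 ≤ n → ∀ j ∈ stateVector (β₀ n), ψ n ≤ |β₀ n j|)
    (hp_lim : Tendsto p atTop atTop)
    (hp : (fun n : ℕ => (p n : ℝ) * Real.log n) =o[atTop]
      fun n : ℕ => n * Real.log (1 + min (ψ n ^ 2) 1))
    (hφlo : ∀ n, 1 ≤ n → 0 < φlo n) (hφ_le : ∀ n, 1 ≤ n → φlo n ≤ φhi n)
    (hφhi : φhi =O[atTop] fun n : ℕ => (n : ℝ) ^ δ₀)
    (hβ : (fun n => ∑ j, β₀ n j ^ 2) =O[atTop] φlo)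
    (hpα : (fun n => (p n : ℝ) ^ α₀) =o[atTop] fun n : ℕ => (n : ℝ) ^ (1 - δ) * φlo n) :
    ∃ K > 0, ∀ᶠ n : ℕ in atTop, ∀ {X : Matrix (Fin n) (Fin (p n)) ℝ} {z : Fin n → ℝ}
      {c : Fin (p n) → ℝ},
      DesignBounds X (stateVector (β₀ n)) (n * (A / 2)) (n * b) (C₃ * (n : ℝ) ^ (1 - δ)) →
      NoiseBounds X (stateVector (β₀ n)) z κ (α * Real.log (p n)) →
      (∀ j, φlo n ≤ c j) → (∀ j, c j ≤ φhi n) →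
      ScoreBounds ν c X (X *ᵥ β₀ n + σ • z) (stateVector (β₀ n)) K
        (excessRatio C₃ δ α₀ p φlo n) := by
  obtain ⟨C, hC, hbound⟩ := hβ.exists_pos
  have hβ' : ∀ᶠ n in atTop, β₀ n ⬝ᵥ β₀ n ≤ C * φlo n := by
    filter_upwards [hbound.bound, eventually_ge_atTop 1] with n hle hn
    rw [Real.norm_of_nonneg (hφlo n hn).le] at hle
    simpa only [dotProduct, sq] using (le_abs_self _).trans hle
  obtain ⟨K, hK, hsubset⟩ := exists_eventually_modelScore_div_le_geometric_of_subset (b := b)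
    (ν := ν) (C₃ := C₃) hσ hA hδ hν hα hα₀ hκ hp_lim (fun n => le_min (sq_nonneg (ψ n)) zero_le_one)
    (fun n => min_le_right _ _) hp hφlo hpα hβ'
  refine ⟨K, hK, ?_⟩
  filter_upwards [hsubset, eventually_modelScore_div_le_exp_of_not_subset (σ := σ) hA hb hδ₀ hν hψ₀
    hψ hp_lim hp hφlo hφ_le hφhi hC hβ'] with n hsubset hnot_subset X z c hX hN hc hc'
  exact ⟨fun γ => hsubset hX hN hc, fun γ => hnot_subset hX hN hc hc'⟩

end Scores

/-! ### Events of probability tending to one -/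

/-- The event `P i` has (outer) probability tending to one along `l`. No measurability of the
events is required. -/
def WithHighProb {Ω ι : Type*} [MeasurableSpace Ω] (μ : Measure Ω) (l : Filter ι)
    (P : ι → Ω → Prop) : Prop :=
  Tendsto (fun i => μ {ω | ¬ P i ω}) l (𝓝 0)

namespace WithHighProb

variable {Ω ι : Type*} [MeasurableSpace Ω] {μ : Measure Ω} {l : Filter ι} {P Q : ι → Ω → Prop}

lemma of_measure_le {u : ι → ℝ≥0∞} (hu : Tendsto u l (𝓝 0))
    (h : ∀ᶠ i in l, μ {ω | ¬ P i ω} ≤ u i) : WithHighProb μ l P :=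
  tendsto_of_tendsto_of_tendsto_of_le_of_le' tendsto_const_nhds hu
    (Eventually.of_forall fun _ => zero_le) h

lemma of_measure_le_ofReal {u : ι → ℝ} (hu : Tendsto u l (𝓝 0))
    (h : ∀ᶠ i in l, μ {ω | ¬ P i ω} ≤ ENNReal.ofReal (u i)) : WithHighProb μ l P :=
  of_measure_le (by simpa using ENNReal.tendsto_ofReal hu) h

lemma of_eventually_ae (h : ∀ᶠ i in l, ∀ᵐ ω ∂μ, P i ω) : WithHighProb μ l P :=
  of_measure_le tendsto_const_nhds (h.mono fun _ hi => (ae_iff.1 hi).le)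

lemma of_ae_eventually [IsFiniteMeasure μ] [l.IsCountablyGenerated]
    (hP : ∀ i, MeasurableSet {ω | P i ω}) (h : ∀ᵐ ω ∂μ, ∀ᶠ i in l, P i ω) :
    WithHighProb μ l P := by
  have hlim := tendsto_measure_of_ae_tendsto_indicator (μ := μ) (A := ∅)
    (As := fun i => {ω | ¬ P i ω}) l MeasurableSet.empty (fun i => (hP i).compl)
    MeasurableSet.univ (measure_ne_top μ _) (Eventually.of_forall fun _ => Set.subset_univ _) ?_
  · rwa [measure_empty] at hlim
  · filter_upwards [h] with ω hω
    filter_upwards [hω] with i hi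
    simp [hi]

lemma and (hP : WithHighProb μ l P) (hQ : WithHighProb μ l Q) :
    WithHighProb μ l fun i ω => P i ω ∧ Q i ω := by
  refine of_measure_le (by simpa only [add_zero] using hP.add hQ) (Eventually.of_forall fun i => ?_)
  refine (measure_mono fun ω hω => ?_).trans (measure_union_le _ _)
  exact not_and_or.1 hω

lemma mono (hP : WithHighProb μ l P) (h : ∀ᶠ i in l, ∀ ω, P i ω → Q i ω) : WithHighProb μ l Q :=
  of_measure_le hP (h.mono fun _ hi => measure_mono fun ω hω hPω => hω (hi ω hPω))

lemma tendstoInMeasure {E : Type*} [EDist E] {f : ι → Ω → E} {g : Ω → E} {u : ι → ℝ}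
    (h : WithHighProb μ l fun i ω => edist (f i ω) (g ω) ≤ ENNReal.ofReal (u i))
    (hu : Tendsto u l (𝓝 0)) : TendstoInMeasure μ f l g := by
  intro ε hε
  have hlt : ∀ᶠ i in l, ENNReal.ofReal (u i) < ε :=
    (by simpa using ENNReal.tendsto_ofReal hu :
      Tendsto (fun i => ENNReal.ofReal (u i)) l (𝓝 0)).eventually_lt_const hε
  have hclose := h.mono (Q := fun i ω => ¬ ε ≤ edist (f i ω) (g ω))
    (hlt.mono fun i hi ω hω => (hω.trans_lt hi).not_ge)
  simpa only [WithHighProb, not_not] using hclose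

end WithHighProb

/-! ### The random design -/

section RandomDesignEvents

variable {Ω : Type*} [MeasurableSpace Ω] {μ : Measure Ω}

lemma measurableSet_missing_bound {n p : ℕ} {X : Ω → Matrix (Fin n) (Fin p) ℝ}
    (hX : EntryMeasurable X) (γ₀ : Finset (Fin p)) (a : ℝ) :
    MeasurableSet {ω | ∀ (γ : Finset (Fin p)) (v : Fin p → ℝ), (∀ j ∉ γ₀ \ γ, v j = 0) →
      a * (v ⬝ᵥ v) ≤ (X ω *ᵥ v) ⬝ᵥ (1 - projMat (X ω) γ) *ᵥ (X ω *ᵥ v)} := by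
  have hform : ∀ ω γ (v : Fin p → ℝ), (X ω *ᵥ v) ⬝ᵥ (1 - projMat (X ω) γ) *ᵥ (X ω *ᵥ v) =
      v ⬝ᵥ ((X ω)ᵀ * ((1 - colProj (colSub (X ω) γ)) * X ω)) *ᵥ v := fun ω γ v => by
    rw [← Matrix.mulVec_mulVec, Matrix.dotProduct_transpose_mulVec, dotProduct_comm,
      Matrix.mulVec_mulVec, projMat_eq_colProj]
  simp only [hform]
  rw [Set.ofPred_forall]
  exact MeasurableSet.iInter fun γ => measurableSet_forall_mul_dotProduct_self_le
    (hX.transpose.mul ((hX.colSub γ).colProj.one_sub.mul hX)) {v | ∀ j ∉ γ₀ \ γ, v j = 0} a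

lemma measurableSet_signal_bound {n p : ℕ} {X : Ω → Matrix (Fin n) (Fin p) ℝ}
    (hX : EntryMeasurable X) (γ₀ : Finset (Fin p)) (b : ℝ) :
    MeasurableSet {ω | ∀ v : Fin p → ℝ, (∀ j ∉ γ₀, v j = 0) →
      (X ω *ᵥ v) ⬝ᵥ (X ω *ᵥ v) ≤ b * (v ⬝ᵥ v)} := by
  have hform : ∀ ω (v : Fin p → ℝ), (X ω *ᵥ v) ⬝ᵥ (X ω *ᵥ v) ≤ b * (v ⬝ᵥ v) ↔
      -b * (v ⬝ᵥ v) ≤ v ⬝ᵥ (-((X ω)ᵀ * X ω)) *ᵥ v := fun ω v => by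
    rw [Matrix.neg_mulVec, dotProduct_neg, dotProduct_transpose_mul_self_mulVec, neg_mul,
      neg_le_neg_iff]
  simp only [hform]
  exact measurableSet_forall_mul_dotProduct_self_le (hX.transpose.mul hX).neg
    {v | ∀ j ∉ γ₀, v j = 0} (-b)

lemma mul_dotProduct_self_le_of_overModels {n p : ℕ} {X : Matrix (Fin n) (Fin p) ℝ}
    {γ₀ : Finset (Fin p)} (hn : 0 < n) {h : ℝ}
    (hover : ∀ γ ∈ overModels γ₀, h ≤ minEig (residGram X (γ \ γ₀) γ₀)) {v : Fin p → ℝ}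
    (hv : ∀ j ∈ γ₀, v j = 0) :
    n * h * (v ⬝ᵥ v) ≤ (X *ᵥ v) ⬝ᵥ (1 - projMat X γ₀) *ᵥ (X *ᵥ v) := by
  by_cases huniv : γ₀ = Finset.univ
  · have hv₀ : v = 0 := funext fun j => hv j (huniv ▸ Finset.mem_univ j)
    simp [hv₀]
  · exact mul_dotProduct_self_le_of_le_minEig_residGram hn
      (hover Finset.univ ⟨Finset.subset_univ _, fun h => huniv h.symm⟩)
      fun j hj => hv j (by simpa using hj)

variable [IsFiniteMeasure μ] {p : ℕ → ℕ} {X : ∀ n, Ω → Matrix (Fin n) (Fin (p n)) ℝ}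
  {γ₀ : ∀ n, Finset (Fin (p n))}

lemma withHighProb_missing_bound (hX : ∀ n, EntryMeasurable (X n)) {a a' : ℝ} (ha : a < a')
    (hphiMin : ∀ᵐ ω ∂μ, (a' : EReal) ≤ liminf (fun n => (phiMin (X n ω) (γ₀ n) : EReal)) atTop) :
    WithHighProb μ atTop fun n ω => ∀ (γ : Finset (Fin (p n))) (v : Fin (p n) → ℝ),
      (∀ j ∉ γ₀ n \ γ, v j = 0) →
        n * a * (v ⬝ᵥ v) ≤ (X n ω *ᵥ v) ⬝ᵥ (1 - projMat (X n ω) γ) *ᵥ (X n ω *ᵥ v) := by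
  refine .of_ae_eventually (fun n => measurableSet_missing_bound (hX n) _ _) ?_
  filter_upwards [hphiMin] with ω hω
  filter_upwards [eventually_lt_of_lt_liminf ((EReal.coe_lt_coe_iff.2 ha).trans_le hω),
    eventually_ge_atTop 1] with n hlt hn γ v hv
  exact mul_dotProduct_self_le_of_le_phiMin hn (EReal.coe_lt_coe_iff.1 hlt).le hv

lemma withHighProb_signal_bound (hX : ∀ n, EntryMeasurable (X n))
    (hγ₀ : ∀ n, 1 ≤ n → (γ₀ n).Nonempty) {b b' : ℝ} (hb : b' < b)
    (hphiMax : ∀ᵐ ω ∂μ, limsup (fun n => (phiMax (X n ω) (γ₀ n) : EReal)) atTop ≤ (b' : EReal)) :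
    WithHighProb μ atTop fun n ω => ∀ v : Fin (p n) → ℝ, (∀ j ∉ γ₀ n, v j = 0) →
      (X n ω *ᵥ v) ⬝ᵥ (X n ω *ᵥ v) ≤ n * b * (v ⬝ᵥ v) := by
  refine .of_ae_eventually (fun n => measurableSet_signal_bound (hX n) _ _) ?_
  filter_upwards [hphiMax] with ω hω
  filter_upwards [eventually_lt_of_limsup_lt (hω.trans_lt (EReal.coe_lt_coe_iff.2 hb)),
    eventually_ge_atTop 1] with n hlt hn v hv
  exact dotProduct_self_mulVec_le_of_phiMax_le hn (hγ₀ n hn) (EReal.coe_lt_coe_iff.1 hlt).le hv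

lemma withHighProb_designBounds (hX : ∀ n, EntryMeasurable (X n))
    (hγ₀ : ∀ n, 1 ≤ n → (γ₀ n).Nonempty) {C₁ C₂ C₃ δ : ℝ} (hC₁ : 0 < C₁) (hC₂ : 0 < C₂)
    (hC₃ : 0 < C₃)
    (hphiMin : ∀ᵐ ω ∂μ, (C₁ : EReal) ≤ liminf (fun n => (phiMin (X n ω) (γ₀ n) : EReal)) atTop)
    (hphiMax : ∀ᵐ ω ∂μ, limsup (fun n => (phiMax (X n ω) (γ₀ n) : EReal)) atTop ≤ (C₂ : EReal))
    (hover : ∀ n, 1 ≤ n → ∀ᵐ ω ∂μ, ∀ γ ∈ overModels (γ₀ n),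
      C₃ * (n : ℝ) ^ (-δ) ≤ minEig (residGram (X n ω) (γ \ γ₀ n) (γ₀ n))) :
    WithHighProb μ atTop fun n ω => DesignBounds (X n ω) (γ₀ n) (n * (C₁ / 2)) (n * (2 * C₂))
      (C₃ * (n : ℝ) ^ (1 - δ)) := by
  have hexcess : WithHighProb μ atTop fun n ω => ∀ γ ∈ overModels (γ₀ n),
      C₃ * (n : ℝ) ^ (-δ) ≤ minEig (residGram (X n ω) (γ \ γ₀ n) (γ₀ n)) :=
    .of_eventually_ae ((eventually_ge_atTop 1).mono hover)
  refine (((withHighProb_missing_bound hX (half_lt_self hC₁) hphiMin).and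
    (withHighProb_signal_bound hX hγ₀ (by linarith : C₂ < 2 * C₂) hphiMax)).and hexcess).mono ?_
  filter_upwards [eventually_ge_atTop 1] with n hn ω ⟨⟨hmissing, hsignal⟩, hover⟩
  have hn₀ : (0 : ℝ) < n := by exact_mod_cast hn
  have hpow : C₃ * (n : ℝ) ^ (1 - δ) = n * (C₃ * (n : ℝ) ^ (-δ)) := by
    rw [sub_eq_add_neg, Real.rpow_add hn₀, Real.rpow_one]
    ring
  exact ⟨by positivity, by positivity, by positivity, hmissing, hsignal,
    fun v hv => hpow ▸ mul_dotProduct_self_le_of_overModels hn hover hv⟩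

end RandomDesignEvents

/-! ### The noise -/

lemma exp_neg_one_mul_inv_sqrt_lt_one : Real.exp (-(1 / 4) * 4) * (√(1 - 2 * (1 / 4)))⁻¹ < 1 := by
  have hsqrt : (1 / 2 : ℝ) ≤ √(1 - 2 * (1 / 4)) := Real.le_sqrt_of_sq_le (by norm_num)
  have hexp : 2 < Real.exp 1 := by linarith [Real.exp_one_gt_d9]
  have hmul := mul_lt_mul hexp hsqrt (by norm_num) (Real.exp_pos 1).le
  rw [show -(1 / 4) * 4 = (-1 : ℝ) by norm_num, Real.exp_neg, ← mul_inv]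
  exact inv_lt_one_of_one_lt₀ (by linarith)

lemma exists_exp_mul_inv_sqrt_lt_one {κ : ℝ} (hκ₀ : 0 < κ) (hκ₁ : κ < 1) :
    ∃ t : ℝ, 0 ≤ t ∧ Real.exp (t * κ) * (√(1 + 2 * t))⁻¹ < 1 := by
  refine ⟨1 - κ, by linarith, ?_⟩
  have hpos : 0 < 1 + 2 * (1 - κ) := by linarith
  have hlog := Real.le_log_one_add_of_nonneg (x := 2 * (1 - κ)) (by linarith)
  have hlt : 2 * ((1 - κ) * κ) < 2 * (2 * (1 - κ)) / (2 * (1 - κ) + 2) := by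
    rw [lt_div_iff₀ (by linarith)]
    have : 0 < (1 - κ) ^ 3 := pow_pos (by linarith) 3
    linear_combination 4 * this
  rw [← div_eq_mul_inv, div_lt_one (Real.sqrt_pos.2 hpos), Real.lt_sqrt (Real.exp_pos _).le,
    ← Real.exp_nat_mul, ← Real.lt_log_iff_exp_lt hpos]
  exact_mod_cast hlt.trans_le hlog

section NoiseEvents

variable {Ω : Type*} [MeasurableSpace Ω] {μ : Measure Ω} {z : ∀ n, Ω → Fin n → ℝ}

lemma withHighProb_dotProduct_colProj_mulVec_le [IsProbabilityMeasure μ] {d : ℕ → ℕ}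
    {W : ∀ n, Ω → Matrix (Fin n) (Fin (d n)) ℝ} (hW : ∀ n, EntryMeasurable (W n))
    (hz : ∀ n, HasLaw (z n) (stdGaussianPi (Fin n)) μ)
    (hWz : ∀ n, IndepFun (fun ω i j => W n ω i j) (z n) μ) (hd : Tendsto d atTop atTop) :
    WithHighProb μ atTop fun n ω => z n ω ⬝ᵥ colProj (W n ω) *ᵥ z n ω ≤ d n * 4 := by
  refine .of_measure_le_ofReal ((tendsto_pow_atTop_nhds_zero_of_lt_one (by positivity)
    exp_neg_one_mul_inv_sqrt_lt_one).comp hd) ?_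
  filter_upwards [hd.eventually_ge_atTop 1] with n hn
  have : Nonempty (Fin (d n)) := ⟨⟨0, hn⟩⟩
  have htail := measure_le_dotProduct_colProj_mulVec (hW n) (hz n) (hWz n) (t := 1 / 4) (s := 4)
    (by norm_num) (by norm_num) (by norm_num)
  rw [Fintype.card_fin] at htail
  exact (measure_mono fun ω hω => (not_le.1 hω).le).trans htail

lemma withHighProb_mul_le_dotProduct_self (hz : ∀ n, HasLaw (z n) (stdGaussianPi (Fin n)) μ)
    {κ : ℝ} (hκ₀ : 0 < κ) (hκ₁ : κ < 1) :
    WithHighProb μ atTop fun n ω => n * κ ≤ z n ω ⬝ᵥ z n ω := by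
  obtain ⟨t, ht₀, ht⟩ := exists_exp_mul_inv_sqrt_lt_one hκ₀ hκ₁
  refine .of_measure_le_ofReal (tendsto_pow_atTop_nhds_zero_of_lt_one (by positivity) ht)
    (Eventually.of_forall fun n => ?_)
  have htail := measure_dotProduct_self_le (hz n) ht₀ κ
  rw [Fintype.card_fin] at htail
  exact (measure_mono fun ω hω => (not_le.1 hω).le).trans htail

lemma tendsto_exp_mul_exp_neg_mul_log_sub_one {p : ℕ → ℕ} (hp_lim : Tendsto p atTop atTop)
    {t α : ℝ} (htα : 1 < t * α) (r : ℝ) :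
    Tendsto (fun n => Real.exp (p n * (Real.exp (-t * (α * Real.log (p n))) * r)) - 1) atTop
      (𝓝 0) := by
  have hexponent : Tendsto (fun n => (p n : ℝ) * (Real.exp (-t * (α * Real.log (p n))) * r)) atTop
      (𝓝 0) := by
    have hrpow := ((tendsto_rpow_neg_atTop (by linarith : 0 < t * α - 1)).comp
      (tendsto_natCast_atTop_atTop.comp hp_lim)).mul_const r
    rw [zero_mul] at hrpow
    refine hrpow.congr' ?_
    filter_upwards [hp_lim.eventually_ge_atTop 1] with n hn
    have hp₀ : (0 : ℝ) < p n := by exact_mod_cast hn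
    rw [Function.comp_apply, Function.comp_apply, neg_sub, Real.rpow_sub hp₀, Real.rpow_one,
      Real.rpow_def_of_pos hp₀, div_eq_mul_inv, ← Real.exp_neg, mul_assoc]
    congr 3
    ring
  simpa using ((Real.continuous_exp.tendsto 0).comp hexponent).sub_const 1

lemma withHighProb_dotProduct_colProj_excessDesign_le [IsProbabilityMeasure μ] {p : ℕ → ℕ}
    {X : ∀ n, Ω → Matrix (Fin n) (Fin (p n)) ℝ} (hX : ∀ n, EntryMeasurable (X n))
    (hz : ∀ n, HasLaw (z n) (stdGaussianPi (Fin n)) μ)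
    (hXz : ∀ n, IndepFun (fun ω i j => X n ω i j) (z n) μ) (γ₀ : ∀ n, Finset (Fin (p n)))
    (hp_lim : Tendsto p atTop atTop) {α : ℝ} (hα : 2 < α) :
    WithHighProb μ atTop fun n ω => ∀ η : Finset (Fin (p n)), η.Nonempty →
      z n ω ⬝ᵥ colProj (excessDesign (X n ω) (γ₀ n) η) *ᵥ z n ω ≤
        η.card * (α * Real.log (p n)) := by
  obtain ⟨t, ht, ht'⟩ : ∃ t, 1 / α < t ∧ t < 1 / 2 :=
    exists_between (one_div_lt_one_div_of_lt two_pos hα)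
  have hα₀ : 0 < α := two_pos.trans hα
  have ht₀ : 0 ≤ t := (by positivity : (0 : ℝ) ≤ 1 / α).trans ht.le
  refine .of_measure_le_ofReal (tendsto_exp_mul_exp_neg_mul_log_sub_one hp_lim
    ((div_lt_iff₀ hα₀).1 ht) (√(1 - 2 * t))⁻¹) ?_
  filter_upwards [hp_lim.eventually_ge_atTop 2] with n hn
  have hlog : 0 < Real.log (p n) := Real.log_pos (by exact_mod_cast hn)
  refine (measure_mono fun ω hω => ?_).trans (measure_exists_le_dotProduct_colProj_excessDesign
    (hX n) (hz n) (hXz n) (γ₀ n) ht₀ ht' (mul_pos hα₀ hlog))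
  obtain ⟨η, hη⟩ := not_forall.1 hω
  obtain ⟨hne, hlt⟩ := Classical.not_imp.1 hη
  exact ⟨η, hne, (not_le.1 hlt).le⟩

lemma withHighProb_noiseBounds [IsProbabilityMeasure μ] {p : ℕ → ℕ}
    {X : ∀ n, Ω → Matrix (Fin n) (Fin (p n)) ℝ} (hX : ∀ n, EntryMeasurable (X n))
    (hz : ∀ n, HasLaw (z n) (stdGaussianPi (Fin n)) μ)
    (hXz : ∀ n, IndepFun (fun ω i j => X n ω i j) (z n) μ) (γ₀ : ∀ n, Finset (Fin (p n)))
    (hp_lim : Tendsto p atTop atTop) {α κ : ℝ} (hα : 2 < α) (hκ₀ : 0 < κ) (hκ₁ : κ < 1) :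
    WithHighProb μ atTop fun n ω =>
      NoiseBounds (X n ω) (γ₀ n) (z n ω) κ (α * Real.log (p n)) := by
  have hupper := withHighProb_dotProduct_colProj_mulVec_le
    (W := fun n _ => (1 : Matrix (Fin n) (Fin n) ℝ)) (fun n => .const 1) hz
    (fun n => indepFun_const_left _ _) tendsto_id
  refine (((withHighProb_dotProduct_colProj_mulVec_le hX hz hXz hp_lim).and hupper).and
    ((withHighProb_mul_le_dotProduct_self hz hκ₀ hκ₁).and
    (withHighProb_dotProduct_colProj_excessDesign_le hX hz hXz γ₀ hp_lim hα))).mono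
    (Eventually.of_forall fun n ω ⟨⟨hproj, hupper⟩, hlower, hexcess⟩ => ?_)
  rw [colProj_one, Matrix.one_mulVec] at hupper
  exact ⟨hproj, hupper, hlower, hexcess⟩

end NoiseEvents

/-! ### Posterior consistency -/

lemma dist_iSup_le {ι : Type*} [Nonempty ι] {f : ι → ℝ} {a u : ℝ} (h : ∀ i, dist (f i) a ≤ u) :
    dist (⨆ i, f i) a ≤ u := by
  simp only [Real.dist_eq, abs_sub_le_iff, sub_le_iff_le_add] at h ⊢
  have hbdd : BddAbove (Set.range f) := ⟨u + a, Set.forall_mem_range.2 fun i => (h i).1⟩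
  obtain ⟨i⟩ := ‹Nonempty ι›
  exact ⟨ciSup_le fun i => (h i).1,
    (h i).2.trans (add_le_add_right (le_ciSup hbdd i) u)⟩

lemma dist_iInf_le {ι : Type*} [Nonempty ι] {f : ι → ℝ} {a u : ℝ} (h : ∀ i, dist (f i) a ≤ u) :
    dist (⨅ i, f i) a ≤ u := by
  simp only [Real.dist_eq, abs_sub_le_iff] at h ⊢
  have hle : ∀ i, a - u ≤ f i := fun i => sub_le_comm.1 (h i).2
  have hbdd : BddBelow (Set.range f) := ⟨a - u, Set.forall_mem_range.2 hle⟩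
  obtain ⟨i⟩ := ‹Nonempty ι›
  exact ⟨(sub_le_sub_right (ciInf_le hbdd i) a).trans (h i).1, sub_le_comm.1 (le_ciInf hle)⟩

lemma edist_zero_eq_self (x : ℝ≥0∞) : edist x 0 = x := by
  cases x with
  | top => rfl
  | coe a =>
    change edist a 0 = _
    rw [edist_nndist, NNReal.nndist_zero_eq_val']

section Consistency

variable {Ω : Type*} [MeasurableSpace Ω] {μ : Measure Ω} {p : ℕ → ℕ}

lemma exists_lt_one_lt_div_mul {α α₀ : ℝ} (hα : 0 < α) (hα₀ : α < α₀) :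
    ∃ κ : ℝ, 0 < κ ∧ κ < 1 ∧ 1 < α₀ / α * κ := by
  have hpos : 0 < α₀ := hα.trans hα₀
  obtain ⟨κ, hκ, hκ₁⟩ := exists_between ((div_lt_one hpos).2 hα₀)
  exact ⟨κ, (div_pos hα hpos).trans hκ, hκ₁, by
    rwa [div_mul_eq_mul_div, one_lt_div hα, mul_comm, ← div_lt_iff₀ hpos]⟩

lemma exists_withHighProb_scoreBounds [IsProbabilityMeasure μ] {β₀ : ∀ n, Fin (p n) → ℝ}
    {X : ∀ n, Ω → Matrix (Fin n) (Fin (p n)) ℝ} {ε : ∀ n, Ω → Fin n → ℝ}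
    {σ ν C₁ C₂ C₃ δ δ₀ α₀ : ℝ} {ψ φlo φhi : ℕ → ℝ} (hσ : 0 < σ)
    (hX : ∀ n, EntryMeasurable (X n))
    (hε : ∀ n, HasLaw (ε n) (Measure.pi fun _ => gaussianReal 0 (σ ^ 2).toNNReal) μ)
    (hXε : ∀ n, IndepFun (fun ω i j => X n ω i j) (ε n) μ) (hν : 0 < ν)
    (hγ₀ : ∀ n, 1 ≤ n → (stateVector (β₀ n)).Nonempty) (hC₁ : 0 < C₁) (hC₂ : 0 < C₂)
    (hphiMin : ∀ᵐ ω ∂μ,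
      (C₁ : EReal) ≤ liminf (fun n => (phiMin (X n ω) (stateVector (β₀ n)) : EReal)) atTop)
    (hphiMax : ∀ᵐ ω ∂μ,
      limsup (fun n => (phiMax (X n ω) (stateVector (β₀ n)) : EReal)) atTop ≤ (C₂ : EReal))
    (hψ₀ : ∀ n, 1 ≤ n → 0 < ψ n) (hψ : ∀ n, 1 ≤ n → ∀ j ∈ stateVector (β₀ n), ψ n ≤ |β₀ n j|)
    (hp_lim : Tendsto p atTop atTop)
    (hp : (fun n : ℕ => (p n : ℝ) * Real.log n) =o[atTop]
      fun n : ℕ => n * Real.log (1 + min (ψ n ^ 2) 1))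
    (hφlo : ∀ n, 1 ≤ n → 0 < φlo n) (hφ_le : ∀ n, 1 ≤ n → φlo n ≤ φhi n) (hδ₀ : 0 ≤ δ₀)
    (hφhi : φhi =O[atTop] fun n : ℕ => (n : ℝ) ^ δ₀)
    (hβ : (fun n => ∑ j, β₀ n j ^ 2) =O[atTop] φlo) (hC₃ : 0 < C₃) (hδ : 0 ≤ δ)
    (hover : ∀ n, 1 ≤ n → ∀ᵐ ω ∂μ, ∀ γ ∈ overModels (stateVector (β₀ n)),
      C₃ * (n : ℝ) ^ (-δ) ≤
        minEig (residGram (X n ω) (γ \ stateVector (β₀ n)) (stateVector (β₀ n))))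
    (hα₀ : 2 < α₀)
    (hpα : (fun n => (p n : ℝ) ^ α₀) =o[atTop] fun n : ℕ => (n : ℝ) ^ (1 - δ) * φlo n) :
    ∃ K > 0, WithHighProb μ atTop fun n ω =>
      ∀ c ∈ Set.Icc (fun _ : Fin (p n) => φlo n) (fun _ => φhi n),
        ScoreBounds ν c (X n ω) (X n ω *ᵥ β₀ n + ε n ω) (stateVector (β₀ n)) K
          (excessRatio C₃ δ α₀ p φlo n) := by
  obtain ⟨α, hα, hαα₀⟩ := exists_between hα₀
  obtain ⟨κ, hκ₀, hκ₁, hκ⟩ := exists_lt_one_lt_div_mul (two_pos.trans hα) hαα₀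
  obtain ⟨K, hK, hscore⟩ := exists_eventually_scoreBounds (b := 2 * C₂) hσ hC₁ (by positivity) hδ₀
    hδ hν (two_pos.trans hα) (one_le_two.trans hα₀.le) hκ hψ₀ hψ hp_lim hp hφlo hφ_le hφhi hβ hpα
  have hdesign := withHighProb_designBounds hX hγ₀ hC₁ hC₂ hC₃ hphiMin hphiMax hover
  have hnoise := withHighProb_noiseBounds hX (fun n => hasLaw_inv_smul hσ.ne' (hε n))
    (fun n => (hXε n).comp measurable_id (measurable_const_smul σ⁻¹))
    (fun n => stateVector (β₀ n)) hp_lim hα hκ₀ hκ₁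
  refine ⟨K, hK, (hdesign.and hnoise).mono (hscore.mono fun n hn ω ⟨hD, hN⟩ c hc => ?_)⟩
  simpa only [smul_inv_smul₀ hσ.ne'] using hn hD hN hc.1 hc.2

lemma isLittleO_rpow_of_isLittleO_rpow_add {α₀ r : ℝ} {g : ℕ → ℝ} (hr : 0 ≤ r)
    (hp_lim : Tendsto p atTop atTop) (h : (fun n => (p n : ℝ) ^ (α₀ + r)) =o[atTop] g) :
    (fun n => (p n : ℝ) ^ α₀) =o[atTop] g := by
  refine IsBigO.trans_isLittleO (IsBigO.of_bound' ?_) h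
  filter_upwards [hp_lim.eventually_ge_atTop 1] with n hn
  rw [Real.norm_of_nonneg (by positivity), Real.norm_of_nonneg (by positivity)]
  exact Real.rpow_le_rpow_of_exponent_le (by exact_mod_cast hn) (by linarith)

lemma tendsto_exp_neg_dim (hp_lim : Tendsto p atTop atTop) :
    Tendsto (fun n => Real.exp (-(p n : ℝ))) atTop (𝓝 0) :=
  Real.tendsto_exp_neg_atTop_nhds_zero.comp (tendsto_natCast_atTop_atTop.comp hp_lim)

variable {X : ∀ n, Ω → Matrix (Fin n) (Fin (p n)) ℝ} {y : ∀ n, Ω → Fin n → ℝ}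
  {γ₀ : ∀ n, Finset (Fin (p n))} {prior : ∀ n, PMF (Finset (Fin (p n)))}
  {φlo φhi x : ℕ → ℝ} {ν C₀ K : ℝ}

lemma tendstoInMeasure_iSup_posterior_odds (hν : 0 < ν) (hC₀ : 0 ≤ C₀)
    (hprior₀ : ∀ n, 1 ≤ n → prior n (γ₀ n) ≠ 0)
    (hprior : ∀ n, 1 ≤ n → ∀ γ, (prior n γ).toReal / (prior n (γ₀ n)).toReal ≤ C₀)
    (hφlo : ∀ n, 1 ≤ n → 0 < φlo n) (hp_lim : Tendsto p atTop atTop) (hK : 0 ≤ K)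
    (hx : ∀ n, 0 ≤ x n) (hx_lim : Tendsto x atTop (𝓝 0))
    (h : WithHighProb μ atTop fun n ω =>
      ∀ c ∈ Set.Icc (fun _ : Fin (p n) => φlo n) (fun _ => φhi n),
        ScoreBounds ν c (X n ω) (y n ω) (γ₀ n) K (x n)) :
    TendstoInMeasure μ
      (fun n ω => ⨆ c : Set.Icc (fun _ : Fin (p n) => φlo n) (fun _ => φhi n),
        ⨆ γ : {γ : Finset (Fin (p n)) // γ ≠ γ₀ n},
          ENNReal.ofReal (_root_.posterior ν (prior n) c.1 (X n ω) (y n ω) γ.1 /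
            _root_.posterior ν (prior n) c.1 (X n ω) (y n ω) (γ₀ n)))
      atTop (fun _ => 0) := by
  have hbound : Tendsto (fun n => C₀ * (K * x n + Real.exp (-(p n : ℝ)))) atTop (𝓝 0) := by
    simpa using ((hx_lim.const_mul K).add (tendsto_exp_neg_dim hp_lim)).const_mul C₀
  refine (h.mono ?_).tendstoInMeasure hbound
  filter_upwards [hx_lim.eventually_le_const zero_lt_one, eventually_ge_atTop 1] with
    n hx₁ hn ω hω
  rw [edist_zero_eq_self]
  exact iSup_le fun c => iSup_le fun γ => ENNReal.ofReal_le_ofReal <|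
    (hω c.1 c.2).posterior_odds_le hK (hx n) hx₁ hν (fun j => (hφlo n hn).le.trans (c.2.1 j))
      (hprior₀ n hn) hC₀ (hprior n hn) γ.2

lemma withHighProb_sum_posterior_le (hν : 0 < ν) (hC₀ : 0 ≤ C₀)
    (hprior₀ : ∀ n, 1 ≤ n → prior n (γ₀ n) ≠ 0)
    (hprior : ∀ n, 1 ≤ n → ∀ γ, (prior n γ).toReal / (prior n (γ₀ n)).toReal ≤ C₀)
    (hφlo : ∀ n, 1 ≤ n → 0 < φlo n) (hK : 0 ≤ K) (hx : ∀ n, 0 ≤ x n)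
    (h : WithHighProb μ atTop fun n ω =>
      ∀ c ∈ Set.Icc (fun _ : Fin (p n) => φlo n) (fun _ => φhi n),
        ScoreBounds ν c (X n ω) (y n ω) (γ₀ n) K (x n)) :
    WithHighProb μ atTop fun n ω =>
      ∀ c : Set.Icc (fun _ : Fin (p n) => φlo n) (fun _ => φhi n),
        ∑ γ ∈ Finset.univ.erase (γ₀ n), _root_.posterior ν (prior n) c.1 (X n ω) (y n ω) γ ≤
          C₀ * (K * (Real.exp (p n * x n) - 1) + Real.exp (-(p n : ℝ))) :=
  h.mono <| (eventually_ge_atTop 1).mono fun n hn _ hω c =>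
    (hω c.1 c.2).sum_posterior_le hK (hx n) hν (fun j => (hφlo n hn).le.trans (c.2.1 j))
      (hprior₀ n hn) hC₀ (hprior n hn)

lemma tendsto_mul_exp_sub_one_add_exp_neg (C₀ K : ℝ) (hp_lim : Tendsto p atTop atTop)
    (hx : Tendsto (fun n => p n * x n) atTop (𝓝 0)) :
    Tendsto (fun n => C₀ * (K * (Real.exp (p n * x n) - 1) + Real.exp (-(p n : ℝ)))) atTop
      (𝓝 0) := by
  have hexp := ((((Real.continuous_exp.tendsto 0).comp hx).sub_const 1).const_mul K).add
    (tendsto_exp_neg_dim hp_lim)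
  simpa using hexp.const_mul C₀

lemma tendstoInMeasure_posterior (hν : 0 < ν) (hprior₀ : ∀ n, 1 ≤ n → prior n (γ₀ n) ≠ 0)
    (hφlo : ∀ n, 1 ≤ n → 0 < φlo n) (hφ_le : ∀ n, 1 ≤ n → φlo n ≤ φhi n) {u : ℕ → ℝ}
    (hu : Tendsto u atTop (𝓝 0))
    (h : WithHighProb μ atTop fun n ω =>
      ∀ c : Set.Icc (fun _ : Fin (p n) => φlo n) (fun _ => φhi n),
        ∑ γ ∈ Finset.univ.erase (γ₀ n), _root_.posterior ν (prior n) c.1 (X n ω) (y n ω) γ ≤ u n) :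
    TendstoInMeasure μ
      (fun n ω => ⨆ c : Set.Icc (fun _ : Fin (p n) => φlo n) (fun _ => φhi n),
        ∑ γ ∈ Finset.univ.erase (γ₀ n), _root_.posterior ν (prior n) c.1 (X n ω) (y n ω) γ)
      atTop (fun _ => 0) ∧
    TendstoInMeasure μ
      (fun n ω => ⨅ c : Set.Icc (fun _ : Fin (p n) => φlo n) (fun _ => φhi n),
        _root_.posterior ν (prior n) c.1 (X n ω) (y n ω) (γ₀ n))
      atTop (fun _ => 1) := by
  have hc : ∀ n, 1 ≤ n → ∀ c : Set.Icc (fun _ : Fin (p n) => φlo n) (fun _ => φhi n),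
      ∀ j, 0 ≤ c.1 j := fun n hn c j => (hφlo n hn).le.trans (c.2.1 j)
  refine ⟨(h.mono ?_).tendstoInMeasure hu, (h.mono ?_).tendstoInMeasure hu⟩
  all_goals
    filter_upwards [eventually_ge_atTop 1] with n hn ω hω
    have : Nonempty (Set.Icc (fun _ : Fin (p n) => φlo n) (fun _ => φhi n)) :=
      ⟨⟨fun _ => φlo n, le_rfl, fun _ => hφ_le n hn⟩⟩
    rw [edist_dist]
  · refine ENNReal.ofReal_le_ofReal (dist_iSup_le fun c => ?_)
    rw [Real.dist_0_eq_abs, abs_of_nonneg (Finset.sum_nonneg fun γ _ =>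
      posterior_nonneg hν (hc n hn c) γ)]
    exact hω c
  · refine ENNReal.ofReal_le_ofReal (dist_iInf_le fun c => ?_)
    rw [dist_comm, Real.dist_eq, ← posterior_add_sum_erase (prior := prior n) hν (hc n hn c)
      (hprior₀ n hn), add_sub_cancel_left, abs_of_nonneg (Finset.sum_nonneg fun γ _ =>
      posterior_nonneg hν (hc n hn c) γ)]
    exact hω c

end Consistency

theorem mainTheorem1
    {Ω : Type*} [MeasurableSpace Ω] (μ : Measure Ω) [IsProbabilityMeasure μ]
    -- dimensions, true coefficients, design, noise
    (p : ℕ → ℕ) (β₀ : ∀ n, Fin (p n) → ℝ)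
    (X : ∀ n, Ω → Matrix (Fin n) (Fin (p n)) ℝ) (ε : ∀ n, Ω → Fin n → ℝ)
    (σ₀ : ℝ) (hσ₀ : 0 < σ₀)
    (hX_meas : ∀ n i j, Measurable fun ω => X n ω i j)
    (hε_law : ∀ n, HasLaw (ε n) (Measure.pi fun _ => gaussianReal 0 (σ₀ ^ 2).toNNReal) μ)
    (hindep : ∀ n, IndepFun (fun ω i j => X n ω i j) (ε n) μ)
    -- prior on models and degrees of freedom
    (ν : ℝ) (hν : 0 < ν) (prior : ∀ n, PMF (Finset (Fin (p n))))
    -- the true model is nonnull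
    (hnonnull : ∀ n, 1 ≤ n → (stateVector (β₀ n)).Nonempty)
    -- prior odds
    (C₀ : ℝ) (hC₀ : 0 < C₀)
    (hprior_pos : ∀ n, 1 ≤ n → prior n (stateVector (β₀ n)) ≠ 0)
    (hprior : ∀ n, 1 ≤ n → ∀ γ,
      (prior n γ).toReal / (prior n (stateVector (β₀ n))).toReal ≤ C₀)
    -- eigenvalue condition on the models that miss a true covariate
    (C₁ C₂ : ℝ) (hC₁ : 0 < C₁) (hC₂ : 0 < C₂)
    (hphiMin : ∀ᵐ ω ∂μ,
      (C₁ : EReal) ≤ liminf (fun n => (phiMin (X n ω) (stateVector (β₀ n)) : EReal)) atTop)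
    (hphiMax : ∀ᵐ ω ∂μ,
      limsup (fun n => (phiMax (X n ω) (stateVector (β₀ n)) : EReal)) atTop ≤ (C₂ : EReal))
    -- minimal signal
    (ψ : ℕ → ℝ) (hψ_pos : ∀ n, 1 ≤ n → 0 < ψ n)
    (hψ : ∀ n, 1 ≤ n → ∀ j ∈ stateVector (β₀ n), ψ n ≤ |β₀ n j|)
    (hψ_lim : Tendsto (fun n : ℕ => ψ n * Real.sqrt n) atTop atTop)
    -- growth of the dimension
    (hp_lim : Tendsto p atTop atTop) (hp_le : ∀ n, p n ≤ n)
    (hp_rate : (fun n : ℕ => (p n : ℝ) * Real.log n) =o[atTop]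
      fun n : ℕ => (n : ℝ) * Real.log (1 + min (ψ n ^ 2) 1))
    -- range of the prior variances
    (φlo φhi : ℕ → ℝ) (hφlo_pos : ∀ n, 1 ≤ n → 0 < φlo n) (hφ_le : ∀ n, 1 ≤ n → φlo n ≤ φhi n)
    (δ₀ : ℝ) (hδ₀ : 0 < δ₀)
    (hφhi : φhi =O[atTop] fun n : ℕ => (n : ℝ) ^ δ₀)
    (hφlo : (fun n => ∑ j, β₀ n j ^ 2) =O[atTop] φlo)
    -- eigenvalue condition on the models that strictly contain the true one
    (C₃ δ : ℝ) (hC₃ : 0 < C₃) (hδ : 0 ≤ δ)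
    (hδ_lim : Tendsto (fun n : ℕ => (n : ℝ) ^ (1 - δ) * φlo n) atTop atTop)
    (hover : ∀ n, 1 ≤ n → ∀ᵐ ω ∂μ, ∀ γ ∈ overModels (stateVector (β₀ n)),
      C₃ * (n : ℝ) ^ (-δ) ≤
        minEig (residGram (X n ω) (γ \ stateVector (β₀ n)) (stateVector (β₀ n))))
    -- the responses
    (y : ∀ n, Ω → Fin n → ℝ) (hy : ∀ n ω, y n ω = X n ω *ᵥ β₀ n + ε n ω) :
    ((∃ α₀ : ℝ, 2 < α₀ ∧
        (fun n => (p n : ℝ) ^ α₀) =o[atTop] fun n : ℕ => (n : ℝ) ^ (1 - δ) * φlo n) →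
      TendstoInMeasure μ
        (fun n ω =>
          ⨆ c : Set.Icc (fun _ : Fin (p n) => φlo n) (fun _ => φhi n),
            ⨆ γ : {γ : Finset (Fin (p n)) // γ ≠ stateVector (β₀ n)},
              ENNReal.ofReal
                (posterior ν (prior n) c.1 (X n ω) (y n ω) γ.1 /
                  posterior ν (prior n) c.1 (X n ω) (y n ω) (stateVector (β₀ n))))
        atTop (fun _ => 0)) ∧
    ((∃ α₀ : ℝ, 2 < α₀ ∧
        (fun n => (p n : ℝ) ^ (α₀ + 2)) =o[atTop] fun n : ℕ => (n : ℝ) ^ (1 - δ) * φlo n) →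
      TendstoInMeasure μ
        (fun n ω =>
          ⨆ c : Set.Icc (fun _ : Fin (p n) => φlo n) (fun _ => φhi n),
            ∑ γ ∈ Finset.univ.erase (stateVector (β₀ n)),
              posterior ν (prior n) c.1 (X n ω) (y n ω) γ)
        atTop (fun _ => 0) ∧
      TendstoInMeasure μ
        (fun n ω =>
          ⨅ c : Set.Icc (fun _ : Fin (p n) => φlo n) (fun _ => φhi n),
            posterior ν (prior n) c.1 (X n ω) (y n ω) (stateVector (β₀ n)))
        atTop (fun _ => 1)) := by
  obtain rfl : y = fun n ω => X n ω *ᵥ β₀ n + ε n ω := funext₂ hy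
  have hscore := fun α₀ => exists_withHighProb_scoreBounds (α₀ := α₀) hσ₀ hX_meas hε_law hindep hν
    hnonnull hC₁ hC₂ hphiMin hphiMax hψ_pos hψ hp_lim hp_rate hφlo_pos hφ_le hδ₀.le hφhi hφlo hC₃ hδ
    hover
  have hratio : ∀ α₀ n, 0 ≤ excessRatio C₃ δ α₀ p φlo n := fun _ _ => Real.sqrt_nonneg _
  constructor
  · rintro ⟨α₀, hα₀, hpα⟩
    obtain ⟨K, hK, hgood⟩ := hscore α₀ hα₀ hpα
    have hlim : Tendsto (excessRatio C₃ δ α₀ p φlo) atTop (𝓝 0) := by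
      simpa using tendsto_pow_mul_excessRatio (C₃ := C₃) 0 hp_lim (by simpa using hpα)
    exact tendstoInMeasure_iSup_posterior_odds hν hC₀.le hprior_pos hprior hφlo_pos hp_lim hK.le
      (hratio α₀) hlim hgood
  · rintro ⟨α₀, hα₀, hpα⟩
    obtain ⟨K, hK, hgood⟩ :=
      hscore α₀ hα₀ (isLittleO_rpow_of_isLittleO_rpow_add zero_le_two hp_lim hpα)
    have hlim : Tendsto (fun n => p n * excessRatio C₃ δ α₀ p φlo n) atTop (𝓝 0) := by
      simpa using tendsto_pow_mul_excessRatio (C₃ := C₃) 1 hp_lim (by simpa using hpα)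
    exact tendstoInMeasure_posterior hν hprior_pos hφlo_pos hφ_le
      (tendsto_mul_exp_sub_one_add_exp_neg C₀ K hp_lim hlim)
      (withHighProb_sum_posterior_le hν hC₀.le hprior_pos hprior hφlo_pos hK.le (hratio α₀) hgood)
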